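/- **Setting.** Let $d\ge 1$, $\mathbb T^d=(-\pi,\pi]^d$. For absolutely summable $\phi:\mathbb Z^d\to\mathbb C$ put $\widehat\phi(\xi)=\sum_{x\in\mathbb Z^d}\phi(x)e^{ix\cdot\xi}$ for $\xi\in\mathbb R^d$, and let $\phi^{(1)}=\phi$, $\phi^{(n)}=\phi^{(n-1)}*\phi$ for $n\ge2$ be its convolution powers. Write $\phi\in\mathcal H_d^*$ if $\widehat\phi$ is holomorphic on a neighbourhood of $\mathbb T^d$ in $\mathbb C^d$ (i.e. some holomorphic function on an open $U\subseteq\mathbb C^d$ containing $\mathbb T^d$ agrees with $\widehat\phi$ on $U\cap\mathbb R^d$) and $\sup_{\xi\in\mathbb T^d}|\widehat\phi(\xi)|=1$. Let $\Omega(\phi)=\{\xi\in\mathbb T^d:|\widehat\phi(\xi)|=1\}$. For a real $d\times d$ matrix $E$ and $t>0$ let $t^E=\exp((\ln t)E)$. For a complex polynomial $P$ in $d$ variables let $\operatorname{Exp}(P)$ be the set of real matrices $E$ with $tP(\xi)=P(t^E\xi)$ for all $t>0$, $\xi\in\mathbb R^d$. $P$ is *positive-homogeneous* if $\operatorname{Exp}(P)\ne\varnothing$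 and $R=\operatorname{Re}P$ satisfies $R(\xi)\ge 0$ on $\mathbb R^d$, with $R(\xi)=0$ only when $\xi=0$. For such $P$ put $R^{\#}(x)=\sup_{\xi\in\mathbb R^d}\{x\cdot\xi-R(\xi)\}$ and $$H_P^t(x)=\frac1{(2\pi)^d}\int_{\mathbb R^d}e^{-tP(\xi)}e^{-ix\cdot\xi}\,d\xi\qquad(t>0,\ x\in\mathbb R^d),$$ where $d\xi$ is Lebesgue measure. A point $\xi_0\in\Omega(\phi)$ is *of positive-homogeneous type for $\widehat\phi$*, with drift $\alpha\in\mathbb R^d$ and positive-homogeneous polynomial $P$, if, with the principal logarithm, $$\operatorname{Log}\frac{\widehat\phi(\xi+\xi_0)}{\widehat\phi(\xi_0)}=i\alpha\cdot\xi-P(\xi)+\Upsilon(\xi),\qquad \Upsilon(\xi)=o(\operatorname{Re}P(\xi))\ \text{ as }\xi\to0\text{ in }\mathbb R^d .$$ **Theorem.** Let $\phi\in\mathcal H_d^*$ and suppose that every $\xi\in\Omega(\phi)$ is of positive-homogeneous type for $\widehat\phi$. Then $\Omega(\phi)=\{\xi_1,\dots,\xi_K\}$ is finite. Let $\alpha_k$,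 $P_k$ and $\Upsilon_k$ be the drift, polynomial and remainder at $\xi_k$, and let $R_k=\operatorname{Re}P_k$. For each $k$ the numbers $$\mu_k=\operatorname{tr}E,\qquad \lambda_k=\sup\Bigl\{\gamma\ge0:\ \lim_{t\to0^+}t^{-(1+\gamma)}\sup_{\xi\in\mathbb R^d,\ R_k(\xi)\le1}|\Upsilon_k(t^E\xi)|=0\Bigr\}\qquad(E\in\operatorname{Exp}(P_k))$$ do not depend on the choice of $E\in\operatorname{Exp}(P_k)$ and are positive and finite. For every $L>0$ there are positive constants $C_1,\dots,C_K,M_1,\dots,M_K$ such that $$\Bigl|\phi^{(n)}(x)-\sum_{k=1}^Ke^{-ix\cdot\xi_k}\,\widehat\phi(\xi_k)^n\,H_{P_k}^n(x-n\alpha_k)\Bigr|\le\sum_{k=1}^K\frac{C_k}{n^{\mu_k+\lambda_k}}\exp\Bigl(-nM_kR_k^{\#}\Bigl(\frac{x-n\alpha_k}n\Bigr)\Bigr)\qquad(*)$$ for all integers $n\ge1$ and all $x\in\mathbb Z^d$ with $|x|\le nL$, where $|\cdot|$ is the Euclidean norm. If moreover $\phi$ is finitely supported, then there are positive constants $C_1,\dots,C_K,M_1,\dots,M_K$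 such that $(*)$ holds for all integers $n\ge1$ and all $x\in\mathbb Z^d$. -/

import Mathlib

open scoped Matrix
open Filter Topology Asymptotics MeasureTheory

namespace ConvPow

noncomputable section

/-- The point of `ℝ^d` underlying a lattice point of `ℤ^d`. -/
def latticePt {d : ℕ} (x : Fin d → ℤ) : Fin d → ℝ := fun j => (x j : ℝ)

/-- The Euclidean norm `|x|` of a point of `ℝ^d`. -/
def euclNorm {d : ℕ} (x : Fin d → ℝ) : ℝ := √(∑ j, x j ^ 2)

/-- Convolution of two functions on `ℤ^d`. -/
def convolve {d : ℕ} (φ ψ : (Fin d → ℤ) → ℂ) (x : Fin d → ℤ) : ℂ :=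
  ∑' y : Fin d → ℤ, φ (x - y) * ψ y

/-- The convolution powers: `φ^{(1)} = φ` and `φ^{(n)} = φ^{(n-1)} ∗ φ` for `n ≥ 2`.
(The value at `n = 0` is the unit mass at the origin; it plays no role.) -/
def convPow {d : ℕ} (φ : (Fin d → ℤ) → ℂ) : ℕ → (Fin d → ℤ) → ℂ
  | 0 => Pi.single 0 1
  | 1 => φ
  | n + 2 => convolve (convPow φ (n + 1)) φ

/-- The Fourier transform `φ̂(ξ) = ∑_x φ(x) e^{i x·ξ}`, for real `ξ`. -/
def fourierT {d : ℕ} (φ : (Fin d → ℤ) → ℂ) (ξ : Fin d → ℝ) : ℂ :=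
  ∑' x : Fin d → ℤ, φ x * Complex.exp (Complex.I * ((latticePt x ⬝ᵥ ξ : ℝ) : ℂ))

/-- `𝕋^d = (-π, π]^d`. -/
def torus (d : ℕ) : Set (Fin d → ℝ) := {ξ | ∀ j, ξ j ∈ Set.Ioc (-Real.pi) Real.pi}

/-- The real point `ξ` seen as a point of `ℂ^d`. -/
def toComplex {d : ℕ} (ξ : Fin d → ℝ) : Fin d → ℂ := fun j => (ξ j : ℂ)

/-- The class `𝓗_d`: `φ` is absolutely summable and `φ̂` is holomorphic on a neighbourhood of `𝕋^d`
in `ℂ^d`, that is, there is a holomorphic function on an open set `U ⊆ ℂ^d` containing `𝕋^d`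
that coincides with `φ̂` at all real points of `U`. -/
def IsHolo {d : ℕ} (φ : (Fin d → ℤ) → ℂ) : Prop :=
  Summable (fun x => ‖φ x‖) ∧
    ∃ (U : Set (Fin d → ℂ)) (F : (Fin d → ℂ) → ℂ), IsOpen U ∧ (∀ ξ ∈ torus d, toComplex ξ ∈ U) ∧
      DifferentiableOn ℂ F U ∧ ∀ ξ : Fin d → ℝ, toComplex ξ ∈ U → F (toComplex ξ) = fourierT φ ξ

/-- The class `𝓗_d^*`: elements of `𝓗_d` normalized by `sup_{ξ ∈ 𝕋^d} |φ̂(ξ)| = 1`. -/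
def IsNormalizedHolo {d : ℕ} (φ : (Fin d → ℤ) → ℂ) : Prop :=
  IsHolo φ ∧ IsLUB ((fun ξ => ‖fourierT φ ξ‖) '' torus d) 1

/-- `Ω(φ)`, the set of points of `𝕋^d` at which `|φ̂| = 1`. -/
def maxSet {d : ℕ} (φ : (Fin d → ℤ) → ℂ) : Set (Fin d → ℝ) := {ξ | ξ ∈ torus d ∧ ‖fourierT φ ξ‖ = 1}

/-- `t^E = exp((ln t) E)`, for `t > 0`. -/
def dil {d : ℕ} (E : Matrix (Fin d) (Fin d) ℝ) (t : ℝ) : Matrix (Fin d) (Fin d) ℝ :=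
  NormedSpace.exp (Real.log t • E)

/-- The values of a complex polynomial on `ℝ^d`. -/
def evalR {d : ℕ} (P : MvPolynomial (Fin d) ℂ) (ξ : Fin d → ℝ) : ℂ :=
  MvPolynomial.eval (toComplex ξ) P

/-- The real part `R = Re P` on `ℝ^d`. -/
def rePart {d : ℕ} (P : MvPolynomial (Fin d) ℂ) (ξ : Fin d → ℝ) : ℝ := (evalR P ξ).re

/-- The exponent set `Exp(P)`. -/
def expSet {d : ℕ} (P : MvPolynomial (Fin d) ℂ) : Set (Matrix (Fin d) (Fin d) ℝ) :=
  {E | ∀ t : ℝ, 0 < t → ∀ ξ : Fin d → ℝ, (t : ℂ) * evalR P ξ = evalR P (dil E t *ᵥ ξ)}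

/-- Positive-homogeneous polynomials: `Exp(P)` is nonempty and `Re P` is positive definite. -/
def IsPosHom {d : ℕ} (P : MvPolynomial (Fin d) ℂ) : Prop :=
  (expSet P).Nonempty ∧ (∀ ξ, 0 ≤ rePart P ξ) ∧ ∀ ξ, rePart P ξ = 0 → ξ = 0

/-- The Legendre-Fenchel transform `R^#(x) = sup_ξ (x·ξ - R(ξ))` of `R = Re P`. -/
def legendre {d : ℕ} (P : MvPolynomial (Fin d) ℂ) (x : Fin d → ℝ) : ℝ :=
  ⨆ ξ : Fin d → ℝ, (x ⬝ᵥ ξ - rePart P ξ)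

/-- `Γ_{ξ₀}(ξ) = Log (φ̂(ξ + ξ₀) / φ̂(ξ₀))`, with the principal logarithm. -/
def logRatio {d : ℕ} (φ : (Fin d → ℤ) → ℂ) (ξ₀ ξ : Fin d → ℝ) : ℂ :=
  Complex.log (fourierT φ (ξ + ξ₀) / fourierT φ ξ₀)

/-- The remainder `Υ` in `Γ_{ξ₀}(ξ) = i α·ξ - P(ξ) + Υ(ξ)`. Only its values near `0` matter. -/
def remainder {d : ℕ} (φ : (Fin d → ℤ) → ℂ) (ξ₀ α : Fin d → ℝ) (P : MvPolynomial (Fin d) ℂ)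
    (ξ : Fin d → ℝ) : ℂ :=
  logRatio φ ξ₀ ξ - Complex.I * ((α ⬝ᵥ ξ : ℝ) : ℂ) + evalR P ξ

/-- `ξ₀` is a point of positive-homogeneous type for `φ̂`, with drift `α` and
positive-homogeneous polynomial `P`. -/
def IsPosHomType {d : ℕ} (φ : (Fin d → ℤ) → ℂ) (ξ₀ α : Fin d → ℝ)
    (P : MvPolynomial (Fin d) ℂ) : Prop :=
  IsPosHom P ∧ remainder φ ξ₀ α P =o[𝓝 0] rePart P

/-- The set of `γ ≥ 0` with `lim_{t → 0+} t^{-(1+γ)} sup_{R(ξ) ≤ 1} |Υ(t^E ξ)| = 0`, of which the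
order `λ(Υ)` is the supremum. -/
def orderSet {d : ℕ} (P : MvPolynomial (Fin d) ℂ) (Υ : (Fin d → ℝ) → ℂ)
    (E : Matrix (Fin d) (Fin d) ℝ) : Set ℝ :=
  {γ | 0 ≤ γ ∧ Tendsto
    (fun t : ℝ => t ^ (-(1 + γ)) * sSup ((fun ξ => ‖Υ (dil E t *ᵥ ξ)‖) '' {ξ | rePart P ξ ≤ 1}))
    (𝓝[>] 0) (𝓝 0)}

/-- The heat kernel `H_P^t(x) = ∫ e^{-tP(ξ)} e^{-i x·ξ} dξ`, where `dξ` is Lebesgue measure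
normalized so that `𝕋^d` has measure `1`, that is, divided by `(2π)^d`. -/
def heatKernel {d : ℕ} (P : MvPolynomial (Fin d) ℂ) (t : ℝ) (x : Fin d → ℝ) : ℂ :=
  (((2 * Real.pi) ^ d : ℝ) : ℂ)⁻¹ *
    ∫ ξ : Fin d → ℝ, Complex.exp (-(t : ℂ) * evalR P ξ) *
      Complex.exp (-Complex.I * ((x ⬝ᵥ ξ : ℝ) : ℂ))

/-- The local limit `∑_k e^{-i x·ξ_k} φ̂(ξ_k)^n H_{P_k}^n(x - n α_k)`; the sum is over the finite
set `s` of the points `ξ_k`. -/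
def localLimit {d : ℕ} (φ : (Fin d → ℤ) → ℂ) (s : Finset (Fin d → ℝ))
    (α : (Fin d → ℝ) → Fin d → ℝ) (P : (Fin d → ℝ) → MvPolynomial (Fin d) ℂ)
    (n : ℕ) (x : Fin d → ℤ) : ℂ :=
  ∑ ξ ∈ s, Complex.exp (-Complex.I * ((latticePt x ⬝ᵥ ξ : ℝ) : ℂ)) * fourierT φ ξ ^ n *
    heatKernel (P ξ) n (latticePt x - (n : ℝ) • α ξ)

/-- The generalized Gaussian `∑_k C_k n^{-a_k} exp(-n M_k R_k^#((x - n α_k) / n))`. -/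
def gaussBound {d : ℕ} (s : Finset (Fin d → ℝ))
    (α : (Fin d → ℝ) → Fin d → ℝ) (P : (Fin d → ℝ) → MvPolynomial (Fin d) ℂ)
    (a C M : (Fin d → ℝ) → ℝ) (n : ℕ) (x : Fin d → ℤ) : ℝ :=
  ∑ ξ ∈ s, C ξ / (n : ℝ) ^ a ξ *
    Real.exp (-(n * M ξ * legendre (P ξ) ((n : ℝ)⁻¹ • (latticePt x - (n : ℝ) • α ξ))))

end

end ConvPow

open ConvPow

/-! Fourier inversion writes φ^{(n)}(x) as the mean of φ̂(ξ)^n e^{-ix·ξ} over a period cell. Away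
from the maximizers of |φ̂| the integrand is exponentially small. Near a maximizer ξ_k it is a phase
times exp(-nP_k(ξ) - i(x - nα_k)·ξ) e^{nΥ_k(ξ)}, and the heat kernel is the same integral over all
of ℝ^d with e^{nΥ_k} replaced by 1. So the error is governed by the integral of exp(-nP_k - i(x -
nα_k)·ξ)(e^{nΥ_k} - 1) against a cutoff.

The power of n comes from scaling. If |Υ| ≤ C R^{1+λ}, then n|Υ| ≤ C n^{-λ}(nR)^{1+λ}, and
(nR)^{1+λ} is absorbed by a small part of the Gaussian e^{-nR}, whose integral is a constant times
n^{-tr E} by the change of variables ξ ↦ n^E ξ. The same change of variables shows that tr E does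
not depend on E. The decay in x comes from moving the contour to ξ - iη with η = θν
(`norm_integral_shift_le`): the shift gains exp(-nθ(y·ν - R(ν))) with y = (x - nα)/n, because R(θν)
= o(θ) R(ν), and the best ν produces the Legendre transform (`le_mul_exp_legendre`). This needs the
bound on Υ at complex points too.

The delicate point is that the supremum λ comes with matching upper and lower powers, even at
complex points (`IsPosHom.exists_order`). A basis of maximal total order of vanishing makes R
comparable to ∑|x_j|^{k_j} near 0 (`IsPosHom.exists_adapted`). With weights e_j satisfying e_j k_j =
q, a holomorphic Υ has an integer order m along the curves s ↦ (s^{e_j} w_j), sharp at some real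
point, and 1 + λ = m/q. The order m is finite because Υ cannot vanish identically: otherwise |φ̂| =
e^{-R} along a whole line, contradicting periodicity (`IsHolo.not_forall_eq_exp`).

For finitely supported φ, points with |x| large compared to n have φ^{(n)}(x) = 0, and there the
Gaussian bound for the heat kernel already contains the missing factor n^{-λ}, since the Legendre
transform is at least 1. -/

namespace ConvPow

/-! ### The one-parameter group t ↦ t^E. -/

section Dilations

variable {d : ℕ} {E : Matrix (Fin d) (Fin d) ℝ}

lemma dil_one : dil E 1 = 1 := by
  simp [dil]

lemma dil_mul {s t : ℝ} (hs : 0 < s) (ht : 0 < t) : dil E (s * t) = dil E s * dil E t := by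
  rw [dil, Real.log_mul hs.ne' ht.ne', add_smul, Matrix.exp_add_of_commute, dil, dil]
  exact ((Commute.refl E).smul_left _).smul_right _

lemma dil_mulVec_dil_mulVec {s t : ℝ} (hs : 0 < s) (ht : 0 < t) (ξ : Fin d → ℝ) :
    dil E s *ᵥ dil E t *ᵥ ξ = dil E (s * t) *ᵥ ξ := by
  rw [dil_mul hs ht, Matrix.mulVec_mulVec]

lemma dil_inv_mulVec {t : ℝ} (ht : 0 < t) (ξ : Fin d → ℝ) :
    dil E t⁻¹ *ᵥ dil E t *ᵥ ξ = ξ := by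
  rw [dil_mulVec_dil_mulVec (inv_pos.2 ht) ht, inv_mul_cancel₀ ht.ne', dil_one, Matrix.one_mulVec]

lemma dil_mulVec_inv {t : ℝ} (ht : 0 < t) (ξ : Fin d → ℝ) :
    dil E t *ᵥ dil E t⁻¹ *ᵥ ξ = ξ := by
  rw [dil_mulVec_dil_mulVec ht (inv_pos.2 ht), mul_inv_cancel₀ ht.ne', dil_one, Matrix.one_mulVec]

lemma continuous_matrix_exp : Continuous (NormedSpace.exp : Matrix (Fin d) (Fin d) ℝ → _) := by
  let _ : NormedRing (Matrix (Fin d) (Fin d) ℝ) := Matrix.linftyOpNormedRing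
  let _ : NormedAlgebra ℝ (Matrix (Fin d) (Fin d) ℝ) := Matrix.linftyOpNormedAlgebra
  let _ : NormedAlgebra ℚ (Matrix (Fin d) (Fin d) ℝ) := NormedAlgebra.restrictScalars ℚ ℝ _
  exact NormedSpace.exp_continuous

lemma continuousOn_dil : ContinuousOn (dil E) (Set.Ioi 0) := by
  refine continuous_matrix_exp.comp_continuousOn ?_
  exact (Real.continuousOn_log.mono fun t ht => ne_of_gt ht).smul continuousOn_const

lemma continuousOn_dil_mulVec :
    ContinuousOn (fun p : ℝ × (Fin d → ℝ) => dil E p.1 *ᵥ p.2) (Set.Ioi 0 ×ˢ Set.univ) := by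
  have h1 : ContinuousOn (fun p : ℝ × (Fin d → ℝ) => (dil E p.1, p.2)) (Set.Ioi 0 ×ˢ Set.univ) :=
    (continuousOn_dil.comp continuousOn_fst fun p hp => hp.1).prodMk continuousOn_snd
  exact (continuous_fst.matrix_mulVec continuous_snd).comp_continuousOn h1

lemma continuousOn_dil_mulVec_const (ξ : Fin d → ℝ) :
    ContinuousOn (fun t => dil E t *ᵥ ξ) (Set.Ioi 0) :=
  (continuous_id.matrix_mulVec continuous_const).comp_continuousOn continuousOn_dil

end Dilations

/-! ### Compactness and homogeneity for positive-homogeneous polynomials. -/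

section Homogeneous

variable {d : ℕ} {P : MvPolynomial (Fin d) ℂ} {E : Matrix (Fin d) (Fin d) ℝ}

lemma continuous_toComplex : Continuous (toComplex (d := d)) := by
  unfold toComplex; fun_prop

lemma continuous_evalR : Continuous (evalR P) :=
  (MvPolynomial.continuous_eval P).comp continuous_toComplex

lemma continuous_rePart : Continuous (rePart P) := Complex.continuous_re.comp continuous_evalR

lemma rePart_dil (hE : E ∈ expSet P) {t : ℝ} (ht : 0 < t) (ξ : Fin d → ℝ) :
    rePart P (dil E t *ᵥ ξ) = t * rePart P ξ := by
  rw [rePart, ← hE t ht ξ, Complex.re_ofReal_mul, rePart]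

lemma evalR_zero (hE : E ∈ expSet P) : evalR P 0 = 0 := by
  have h := hE 2 two_pos 0
  rw [Matrix.mulVec_zero] at h
  push_cast at h
  linear_combination h

lemma rePart_zero (hE : E ∈ expSet P) : rePart P 0 = 0 := by
  rw [rePart, evalR_zero hE, Complex.zero_re]

lemma IsPosHom.rePart_pos (hP : IsPosHom P) {ξ : Fin d → ℝ} (hξ : ξ ≠ 0) : 0 < rePart P ξ :=
  lt_of_le_of_ne (hP.2.1 ξ) fun h => hξ (hP.2.2 ξ h.symm)

lemma IsPosHom.rePart_zero (hP : IsPosHom P) : rePart P 0 = 0 := by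
  obtain ⟨E, hE⟩ := hP.1
  exact ConvPow.rePart_zero hE

lemma IsPosHom.exists_pos_le_annulus (hP : IsPosHom P) {ε : ℝ} (hε : 0 < ε) (B : ℝ) :
    ∃ c > 0, ∀ u : Fin d → ℝ, ε ≤ ‖u‖ → ‖u‖ ≤ B → c ≤ rePart P u := by
  have hK : IsCompact {u : Fin d → ℝ | ε ≤ ‖u‖ ∧ ‖u‖ ≤ B} := by
    refine (isCompact_closedBall (0 : Fin d → ℝ) B).of_isClosed_subset ?_ ?_
    · exact (isClosed_le continuous_const continuous_norm).inter
        (isClosed_le continuous_norm continuous_const)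
    · intro u hu
      simpa using hu.2
  rcases Set.eq_empty_or_nonempty {u : Fin d → ℝ | ε ≤ ‖u‖ ∧ ‖u‖ ≤ B} with h | h
  · exact ⟨1, one_pos, fun u h1 h2 => absurd (show u ∈ {u : Fin d → ℝ | ε ≤ ‖u‖ ∧ ‖u‖ ≤ B} from
      ⟨h1, h2⟩) (by simp [h])⟩
  · obtain ⟨u, hu, hmin⟩ := hK.exists_isMinOn h (continuous_rePart (P := P)).continuousOn
    refine ⟨rePart P u, hP.rePart_pos ?_, fun v h1 h2 => hmin ⟨h1, h2⟩⟩
    rintro rfl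
    have := hu.1
    simp at this
    linarith

/-- An orbit starting near 0 cannot cross the unit sphere as t decreases from 1: there R ≥ c,
whereas R(t^E ξ) = tR(ξ) < c. Linearity turns this into an operator bound. -/
lemma IsPosHom.exists_dil_bound (hP : IsPosHom P) (hE : E ∈ expSet P) :
    ∃ C > 0, ∀ t : ℝ, 0 < t → t ≤ 1 → ∀ ξ : Fin d → ℝ, ‖dil E t *ᵥ ξ‖ ≤ C * ‖ξ‖ := by
  obtain ⟨c, hc, hmin⟩ := hP.exists_pos_le_annulus one_pos 1
  obtain ⟨δ, hδ, hsmall⟩ : ∃ δ > 0, ∀ ξ : Fin d → ℝ, ‖ξ‖ < δ → rePart P ξ < c := by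
    have h0 : ∀ᶠ ξ in 𝓝 (0 : Fin d → ℝ), rePart P ξ < c :=
      (continuous_rePart (P := P)).continuousAt.eventually_lt continuousAt_const
        (by rwa [hP.rePart_zero])
    obtain ⟨δ, hδ, h⟩ := Metric.eventually_nhds_iff.1 h0
    exact ⟨δ, hδ, fun ξ hξ => h (by simpa using hξ)⟩
  have key : ∀ ξ : Fin d → ℝ, ‖ξ‖ < min δ 1 → ∀ t : ℝ, 0 < t → t ≤ 1 → ‖dil E t *ᵥ ξ‖ ≤ 1 := by
    intro ξ hξ t ht ht1
    by_contra! hcon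
    have hcont : ContinuousOn (fun s => ‖dil E s *ᵥ ξ‖) (Set.Icc t 1) :=
      (continuousOn_dil_mulVec_const ξ).norm.mono fun s hs => lt_of_lt_of_le ht hs.1
    have hmem : (1 : ℝ) ∈ Set.Icc ‖dil E 1 *ᵥ ξ‖ ‖dil E t *ᵥ ξ‖ := by
      rw [dil_one, Matrix.one_mulVec]
      exact ⟨(hξ.trans_le (min_le_right _ _)).le, hcon.le⟩
    obtain ⟨s, hs, hs1⟩ := intermediate_value_Icc' ht1 hcont hmem
    have hs0 : 0 < s := ht.trans_le hs.1
    have h1 := hmin _ hs1.ge hs1.le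
    rw [rePart_dil hE hs0] at h1
    have h2 := hsmall ξ (hξ.trans_le (min_le_left _ _))
    have h3 := hP.2.1 ξ
    nlinarith [hs.2]
  have hm : 0 < min δ 1 := lt_min hδ one_pos
  refine ⟨2 / min δ 1, by positivity, fun t ht ht1 ξ => ?_⟩
  rcases eq_or_ne ξ 0 with rfl | hξ
  · simp
  have hn : 0 < ‖ξ‖ := norm_pos_iff.2 hξ
  have := key ((min δ 1 / 2 * ‖ξ‖⁻¹) • ξ) (by
    rw [norm_smul, norm_mul, norm_inv, norm_norm, mul_assoc, inv_mul_cancel₀ hn.ne', mul_one,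
      Real.norm_of_nonneg (by positivity)]
    linarith) t ht ht1
  rw [Matrix.mulVec_smul, norm_smul, Real.norm_of_nonneg (by positivity)] at this
  rw [div_mul_eq_mul_div, le_div_iff₀ hm]
  have h2 : min δ 1 / 2 * ‖ξ‖⁻¹ * ‖dil E t *ᵥ ξ‖ * (2 * ‖ξ‖) ≤ 1 * (2 * ‖ξ‖) :=
    mul_le_mul_of_nonneg_right this (by positivity)
  calc ‖dil E t *ᵥ ξ‖ * min δ 1 = min δ 1 / 2 * ‖ξ‖⁻¹ * ‖dil E t *ᵥ ξ‖ * (2 * ‖ξ‖) := by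
        field_simp
    _ ≤ 2 * ‖ξ‖ := by linarith

/-- The orbit stays bounded and R tends to 0 along it, while R is bounded below on every annulus
away from 0. -/
lemma IsPosHom.tendsto_dil_mulVec (hP : IsPosHom P) (hE : E ∈ expSet P) (ξ : Fin d → ℝ) :
    Tendsto (fun t => dil E t *ᵥ ξ) (𝓝[>] 0) (𝓝 0) := by
  obtain ⟨C, hC, hb⟩ := hP.exists_dil_bound hE
  rw [Metric.tendsto_nhds]
  intro ε hε
  obtain ⟨c, hc, hmin⟩ := hP.exists_pos_le_annulus hε (C * ‖ξ‖)
  have h1 : Tendsto (fun t : ℝ => t * rePart P ξ) (𝓝[>] 0) (𝓝 0) := by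
    have : Tendsto (fun t : ℝ => t * rePart P ξ) (𝓝 0) (𝓝 (0 * rePart P ξ)) :=
      (continuous_id.mul continuous_const).tendsto 0
    rw [zero_mul] at this
    exact this.mono_left nhdsWithin_le_nhds
  have h2 : ∀ᶠ t : ℝ in 𝓝[>] 0, t ∈ Set.Ioc (0 : ℝ) 1 := Ioc_mem_nhdsGT one_pos
  filter_upwards [h1.eventually (gt_mem_nhds hc), h2] with t ht ht1
  rw [dist_zero_right]
  by_contra! hcon
  have := hmin _ hcon (hb t ht1.1 ht1.2 ξ)
  rw [rePart_dil hE ht1.1] at this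
  linarith

/-- Contract a point of norm at least 1 until it meets the unit sphere, at parameter s. Then c ≤
R(s^E ξ) = sR(ξ) ≤ s, so ξ is recovered from the sphere by a dilation with parameter in [1, 1/c],
and such points form a compact set. -/
lemma IsPosHom.isCompact_sublevel (hP : IsPosHom P) : IsCompact {ξ | rePart P ξ ≤ 1} := by
  obtain ⟨E, hE⟩ := hP.1
  obtain ⟨c, hc, hmin⟩ := hP.exists_pos_le_annulus one_pos 1
  have hcpt : IsCompact ((fun p : ℝ × (Fin d → ℝ) => dil E p.1 *ᵥ p.2) ''
      (Set.Icc 1 c⁻¹ ×ˢ Metric.closedBall 0 1)) :=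
    (isCompact_Icc.prod (isCompact_closedBall 0 1)).image_of_continuousOn
      (continuousOn_dil_mulVec.mono fun p hp => ⟨lt_of_lt_of_le one_pos hp.1.1, trivial⟩)
  refine (hcpt.union (isCompact_closedBall (0 : Fin d → ℝ) 1)).of_isClosed_subset
    (isClosed_le continuous_rePart continuous_const) fun ξ hξ => ?_
  rcases le_total ‖ξ‖ 1 with h | h
  · exact Or.inr (by simpa using h)
  left
  have ht := (hP.tendsto_dil_mulVec hE ξ).norm
  rw [norm_zero] at ht
  have h2 : ∀ᶠ t : ℝ in 𝓝[>] 0, t ∈ Set.Ioc (0 : ℝ) 1 := Ioc_mem_nhdsGT one_pos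
  obtain ⟨t, ht1, ht2⟩ := ((ht.eventually (gt_mem_nhds one_pos)).and h2).exists
  have hcont : ContinuousOn (fun s => ‖dil E s *ᵥ ξ‖) (Set.Icc t 1) :=
    (continuousOn_dil_mulVec_const ξ).norm.mono fun s hs => lt_of_lt_of_le ht2.1 hs.1
  obtain ⟨s, hs, hs1⟩ := intermediate_value_Icc ht2.2 hcont
    (show (1 : ℝ) ∈ Set.Icc ‖dil E t *ᵥ ξ‖ ‖dil E 1 *ᵥ ξ‖ by
      rw [dil_one, Matrix.one_mulVec]; exact ⟨ht1.le, h⟩)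
  have hs0 : 0 < s := ht2.1.trans_le hs.1
  have h1 := hmin _ hs1.ge hs1.le
  rw [rePart_dil hE hs0] at h1
  have hcs : c ≤ s := by
    have : rePart P ξ ≤ 1 := hξ
    nlinarith
  exact ⟨(s⁻¹, dil E s *ᵥ ξ), ⟨⟨(one_le_inv₀ hs0).2 hs.2, inv_anti₀ hc hcs⟩,
    by simpa using hs1.le⟩, dil_inv_mulVec hs0 ξ⟩

/-- The unit sphere `R(ξ) + R(η) = 1` is compact. -/
lemma IsPosHom.isCompact_unit (hP : IsPosHom P) :
    IsCompact {p : (Fin d → ℝ) × (Fin d → ℝ) | rePart P p.1 + rePart P p.2 = 1} := by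
  refine (hP.isCompact_sublevel.prod hP.isCompact_sublevel).of_isClosed_subset ?_ ?_
  · exact isClosed_eq (((continuous_rePart (P := P)).comp continuous_fst).add
      ((continuous_rePart (P := P)).comp continuous_snd)) continuous_const
  · intro p hp
    have hp : rePart P p.1 + rePart P p.2 = 1 := hp
    have h1 := hP.2.1 p.1
    have h2 := hP.2.1 p.2
    exact ⟨by simp only [Set.mem_ofPred_eq]; linarith, by simp only [Set.mem_ofPred_eq]; linarith⟩

/-- Inequalities between functions homogeneous of degree one under (ξ, η) ↦ (t^E ξ, t^E η) need only
be checked on the compact set R(ξ) + R(η) = 1. The origin is separate: there f(0, 0) = 2f(0, 0). -/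
lemma IsPosHom.of_unit (hP : IsPosHom P) (hE : E ∈ expSet P)
    {f : (Fin d → ℝ) → (Fin d → ℝ) → ℝ}
    (hf : ∀ t : ℝ, 0 < t → ∀ ξ η, f (dil E t *ᵥ ξ) (dil E t *ᵥ η) = t * f ξ η)
    (h : ∀ ξ η, rePart P ξ + rePart P η = 1 → 0 ≤ f ξ η) (ξ η : Fin d → ℝ) : 0 ≤ f ξ η := by
  have h1 := hP.2.1 ξ
  have h2 := hP.2.1 η
  rcases eq_or_lt_of_le (add_nonneg h1 h2) with h0 | h0
  · obtain rfl : ξ = 0 := hP.2.2 _ (by linarith)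
    obtain rfl : η = 0 := hP.2.2 _ (by linarith)
    have := hf 2 two_pos 0 0
    simp only [Matrix.mulVec_zero] at this
    linarith
  · set r := rePart P ξ + rePart P η
    have := h (dil E r⁻¹ *ᵥ ξ) (dil E r⁻¹ *ᵥ η) (by
      rw [rePart_dil hE (inv_pos.2 h0), rePart_dil hE (inv_pos.2 h0), ← mul_add]
      exact inv_mul_cancel₀ h0.ne')
    rw [hf _ (inv_pos.2 h0)] at this
    exact nonneg_of_mul_nonneg_right this (inv_pos.2 h0)

lemma IsPosHom.exists_abs_le (hP : IsPosHom P) (hE : E ∈ expSet P)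
    {f : (Fin d → ℝ) → (Fin d → ℝ) → ℝ} (hc : Continuous fun p : (Fin d → ℝ) × (Fin d → ℝ) => f p.1 p.2)
    (hf : ∀ t : ℝ, 0 < t → ∀ ξ η, f (dil E t *ᵥ ξ) (dil E t *ᵥ η) = t * f ξ η) :
    ∃ C > 0, ∀ ξ η, |f ξ η| ≤ C * (rePart P ξ + rePart P η) := by
  obtain ⟨C, hC⟩ := hP.isCompact_unit.exists_bound_of_continuousOn hc.continuousOn
  refine ⟨max C 1, by positivity, fun ξ η => ?_⟩
  have := hP.of_unit hE (f := fun ξ η => max C 1 * (rePart P ξ + rePart P η) - |f ξ η|)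
    (fun t ht ξ η => by
      rw [hf t ht, rePart_dil hE ht, rePart_dil hE ht, abs_mul, abs_of_pos ht]; ring)
    (fun ξ η h => by
      have h1 := hC (ξ, η) h
      rw [Real.norm_eq_abs] at h1
      rw [h, mul_one, sub_nonneg]
      exact h1.trans (le_max_left _ _)) ξ η
  linarith

/-- On the unit set, f ≤ 0 forces η ≠ 0, so by compactness R(η) is bounded below by some m > 0 where
f ≤ 0, and a large multiple of R(η) compensates the bounded function f. -/
lemma IsPosHom.exists_add_nonneg (hP : IsPosHom P) (hE : E ∈ expSet P)
    {f : (Fin d → ℝ) → (Fin d → ℝ) → ℝ} (hc : Continuous fun p : (Fin d → ℝ) × (Fin d → ℝ) => f p.1 p.2)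
    (hf : ∀ t : ℝ, 0 < t → ∀ ξ η, f (dil E t *ᵥ ξ) (dil E t *ᵥ η) = t * f ξ η)
    (hpos : ∀ ξ, ξ ≠ 0 → 0 < f ξ 0) :
    ∃ C > 0, ∀ ξ η, 0 ≤ f ξ η + C * rePart P η := by
  obtain ⟨B, hB⟩ := hP.isCompact_unit.exists_bound_of_continuousOn hc.continuousOn
  have hK : IsCompact ({p : (Fin d → ℝ) × (Fin d → ℝ) | rePart P p.1 + rePart P p.2 = 1} ∩
      {p | f p.1 p.2 ≤ 0}) := hP.isCompact_unit.inter_right (isClosed_le hc continuous_const)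
  obtain ⟨m, hm, hmin⟩ : ∃ m > 0, ∀ ξ η, rePart P ξ + rePart P η = 1 → f ξ η ≤ 0 →
      m ≤ rePart P η := by
    rcases Set.eq_empty_or_nonempty ({p : (Fin d → ℝ) × (Fin d → ℝ) |
      rePart P p.1 + rePart P p.2 = 1} ∩ {p | f p.1 p.2 ≤ 0}) with h | h
    · refine ⟨1, one_pos, fun ξ η h1 h2 => ?_⟩
      have : (ξ, η) ∈ ({p : (Fin d → ℝ) × (Fin d → ℝ) |
        rePart P p.1 + rePart P p.2 = 1} ∩ {p | f p.1 p.2 ≤ 0}) := ⟨h1, h2⟩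
      simp [h] at this
    · obtain ⟨p, hp, hpm⟩ := hK.exists_isMinOn h
        ((continuous_rePart (P := P)).comp continuous_snd).continuousOn
      refine ⟨rePart P p.2, hP.rePart_pos fun h0 => ?_, fun ξ η h1 h2 => hpm (a := (ξ, η)) ⟨h1, h2⟩⟩
      have h1 : rePart P p.1 + rePart P p.2 = 1 := hp.1
      have h2 : f p.1 p.2 ≤ 0 := hp.2
      rw [h0] at h1 h2
      refine absurd (hpos p.1 ?_) (not_lt.2 h2)
      intro h3
      rw [h3, hP.rePart_zero] at h1
      norm_num at h1
  refine ⟨(|B| + 1) / m, by positivity, fun ξ η => ?_⟩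
  refine hP.of_unit hE (f := fun ξ η => f ξ η + (|B| + 1) / m * rePart P η)
    (fun t ht ξ η => by rw [hf t ht, rePart_dil hE ht]; ring) (fun ξ η h => ?_) ξ η
  have h1 := hB (ξ, η) h
  rw [Real.norm_eq_abs] at h1
  have h4 := hP.2.1 η
  rcases le_or_gt (f ξ η) 0 with h2 | h2
  · have h3 := hmin ξ η h h2
    have h5 : (|B| + 1) ≤ (|B| + 1) / m * rePart P η := by
      rw [div_mul_eq_mul_div, le_div_iff₀ hm]
      exact mul_le_mul_of_nonneg_left h3 (by positivity)
    have := neg_abs_le (f ξ η)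
    have := le_abs_self B
    dsimp only at h1
    linarith
  · positivity

lemma IsPosHom.quasi_triangle (hP : IsPosHom P) :
    ∃ C > 0, ∀ ξ η, rePart P (ξ + η) ≤ C * (rePart P ξ + rePart P η) := by
  obtain ⟨E, hE⟩ := hP.1
  obtain ⟨C, hC, h⟩ := hP.exists_abs_le hE (f := fun ξ η => rePart P (ξ + η))
    (continuous_rePart.comp (continuous_fst.add continuous_snd))
    (fun t ht ξ η => by rw [← Matrix.mulVec_add, rePart_dil hE ht])
  exact ⟨C, hC, fun ξ η => (le_abs_self _).trans (h ξ η)⟩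

/-- Since 0 is a minimum of R, the derivative there vanishes and R(θξ) = o(θ) uniformly on a compact
set; homogeneity carries this to all ν. The small factor ε is what lets y·ν win over the cost of a
contour shift. -/
lemma IsPosHom.rePart_smul_le (hP : IsPosHom P) {ε : ℝ} (hε : 0 < ε) :
    ∃ θ₀ > 0, ∀ θ : ℝ, 0 ≤ θ → θ ≤ θ₀ → ∀ ν, rePart P (θ • ν) ≤ ε * θ * rePart P ν := by
  obtain ⟨E, hE⟩ := hP.1
  obtain ⟨B, hB⟩ := hP.isCompact_sublevel.isBounded.exists_norm_le
  have hB' : ∀ ν, rePart P ν ≤ 1 → ‖ν‖ ≤ |B| + 1 := fun ν h =>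
    (hB ν h).trans ((le_abs_self B).trans (by linarith))
  have hdiff : DifferentiableAt ℝ (rePart P) 0 := by
    have h2 : Differentiable ℝ fun z : Fin d → ℂ => MvPolynomial.eval z P := fun z =>
      ((AnalyticOnNhd.eval_mvPolynomial P) z trivial).differentiableAt.restrictScalars ℝ
    have h3 : Differentiable ℝ (toComplex (d := d)) := by
      unfold toComplex
      exact differentiable_pi.2 fun i => Complex.ofRealCLM.differentiable.comp (differentiable_apply i)
    exact Complex.reCLM.differentiable.comp (h2.comp h3) 0
  have hmin : IsLocalMin (rePart P) 0 := Eventually.of_forall fun ξ => by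
    rw [hP.rePart_zero]; exact hP.2.1 ξ
  have hfd := hdiff.hasFDerivAt
  rw [hmin.fderiv_eq_zero, hasFDerivAt_iff_isLittleO_nhds_zero] at hfd
  have h1 := hfd.def (c := ε / (|B| + 1)) (by positivity)
  obtain ⟨δ, hδ, h2⟩ := Metric.eventually_nhds_iff.1 h1
  simp only [zero_add, hP.rePart_zero, sub_zero, zero_apply, dist_zero_right,
    Real.norm_eq_abs] at h2
  refine ⟨δ / (2 * (|B| + 1)), by positivity, fun θ h0 hθ ν => ?_⟩
  -- The second variable is a dummy, set to 0 at the end; on the unit set R(ξ) ≤ 1, so ξ is bounded.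
  have := hP.of_unit hE
    (f := fun ξ η => ε * θ * (rePart P ξ + rePart P η) - rePart P (θ • ξ))
    (fun t ht ξ η => by
      rw [rePart_dil hE ht, rePart_dil hE ht, ← Matrix.mulVec_smul, rePart_dil hE ht]; ring)
    (fun ξ η h => ?_) ν 0
  · rw [hP.rePart_zero] at this
    linarith
  have hη0 := hP.2.1 η
  have hξ := hB' ξ (by linarith)
  have hB0 : 0 < |B| + 1 := by positivity
  have h3 : ‖θ • ξ‖ ≤ θ * (|B| + 1) := by
    rw [norm_smul, Real.norm_of_nonneg h0]
    exact mul_le_mul_of_nonneg_left hξ h0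
  have h4 : θ * (|B| + 1) ≤ δ / 2 :=
    calc θ * (|B| + 1) ≤ δ / (2 * (|B| + 1)) * (|B| + 1) := mul_le_mul_of_nonneg_right hθ hB0.le
      _ = δ / 2 := by field_simp
  have h5 := h2 (show ‖θ • ξ‖ < δ by linarith)
  have h6 : ε / (|B| + 1) * ‖θ • ξ‖ ≤ ε * θ :=
    calc ε / (|B| + 1) * ‖θ • ξ‖ ≤ ε / (|B| + 1) * (θ * (|B| + 1)) :=
          mul_le_mul_of_nonneg_left h3 (by positivity)
      _ = ε * θ := by field_simp
  rw [h, mul_one]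
  linarith [le_abs_self (rePart P (θ • ξ))]

/-- `R` grows faster than any multiple of the norm. -/
lemma IsPosHom.exists_growth (hP : IsPosHom P) {A : ℝ} (hA : 0 < A) :
    ∃ K > 0, ∀ ν, K ≤ ‖ν‖ → A * ‖ν‖ ≤ rePart P ν := by
  obtain ⟨m, hm, hmin⟩ := hP.exists_pos_le_annulus one_pos 1
  -- With θ = 1/‖ν‖ this reads m ≤ R(ν/‖ν‖) ≤ (m/A) R(ν)/‖ν‖.
  obtain ⟨θ₀, hθ₀, h⟩ := hP.rePart_smul_le (ε := m / A) (by positivity)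
  refine ⟨θ₀⁻¹, inv_pos.2 hθ₀, fun ν hν => ?_⟩
  have hν0 : 0 < ‖ν‖ := (inv_pos.2 hθ₀).trans_le hν
  have h1 := h ‖ν‖⁻¹ (inv_nonneg.2 hν0.le) (inv_le_of_inv_le₀ hθ₀ hν) ν
  have hn : ‖‖ν‖⁻¹ • ν‖ = 1 := by
    rw [norm_smul, norm_inv, norm_norm, inv_mul_cancel₀ hν0.ne']
  have h2 := (hmin _ hn.ge hn.le).trans h1
  have h3 : m * (A * ‖ν‖) ≤ m * rePart P ν :=
    calc m * (A * ‖ν‖) ≤ (m / A * ‖ν‖⁻¹ * rePart P ν) * (A * ‖ν‖) :=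
          mul_le_mul_of_nonneg_right h2 (by positivity)
      _ = m * rePart P ν := by field_simp
  exact le_of_mul_le_mul_left h3 hm

/-- The complex point `ξ - i η`. -/
noncomputable def cpt (ξ η : Fin d → ℝ) : Fin d → ℂ := fun j => (ξ j : ℂ) - Complex.I * (η j : ℂ)

@[simp] lemma cpt_zero_right (ξ : Fin d → ℝ) : cpt ξ 0 = toComplex ξ := by
  ext j; simp [cpt, toComplex]

lemma continuous_cpt : Continuous fun p : (Fin d → ℝ) × (Fin d → ℝ) => cpt p.1 p.2 := by
  unfold cpt; fun_prop

/-- The values `P(ξ - i η)`. -/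
noncomputable def evalC (P : MvPolynomial (Fin d) ℂ) (ξ η : Fin d → ℝ) : ℂ := MvPolynomial.eval (cpt ξ η) P

lemma continuous_evalC : Continuous fun p : (Fin d → ℝ) × (Fin d → ℝ) => evalC P p.1 p.2 :=
  (MvPolynomial.continuous_eval P).comp continuous_cpt

lemma eq_of_eq_on_real {f g : ℂ → ℂ} (hf : Differentiable ℂ f) (hg : Differentiable ℂ g)
    (h : ∀ x : ℝ, f x = g x) : f = g := by
  have hfa : AnalyticOnNhd ℂ f Set.univ := fun z _ => hf.analyticAt z
  have hga : AnalyticOnNhd ℂ g Set.univ := fun z _ => hg.analyticAt z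
  refine hfa.eq_of_frequently_eq hga (z₀ := 0) ?_
  have ht : Tendsto (fun x : ℝ => (x : ℂ)) (𝓝[≠] 0) (𝓝[≠] 0) := by
    refine tendsto_nhdsWithin_iff.2 ⟨?_, ?_⟩
    · exact (Complex.continuous_ofReal.tendsto' 0 0 (by simp)).mono_left nhdsWithin_le_nhds
    · filter_upwards [self_mem_nhdsWithin] with x hx
      simpa using hx
  exact ht.frequently (Eventually.of_forall h).frequently

lemma differentiable_eval_comp {f : ℂ → Fin d → ℂ} (hf : Differentiable ℂ f) :
    Differentiable ℂ fun w => MvPolynomial.eval (f w) P := fun w =>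
  (((AnalyticOnNhd.eval_mvPolynomial P) (f w) trivial).differentiableAt).comp w (hf w)

/-- Both sides are polynomials in w along ξ + wη that agree for real w, hence also at w = -i. -/
lemma evalC_dil (hE : E ∈ expSet P) {t : ℝ} (ht : 0 < t) (ξ η : Fin d → ℝ) :
    evalC P (dil E t *ᵥ ξ) (dil E t *ᵥ η) = t * evalC P ξ η := by
  have key : (fun w : ℂ => MvPolynomial.eval
        (toComplex (dil E t *ᵥ ξ) + w • toComplex (dil E t *ᵥ η)) P) =
      fun w : ℂ => t * MvPolynomial.eval (toComplex ξ + w • toComplex η) P := by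
    refine eq_of_eq_on_real (differentiable_eval_comp (by fun_prop))
      ((differentiable_eval_comp (by fun_prop)).const_mul _) fun x => ?_
    have h1 : ∀ a b : Fin d → ℝ, toComplex a + (x : ℂ) • toComplex b = toComplex (a + x • b) := by
      intro a b; ext j; simp [toComplex]
    rw [h1, h1, ← Matrix.mulVec_smul, ← Matrix.mulVec_add]
    exact (hE t ht _).symm
  have h2 : ∀ a b : Fin d → ℝ, toComplex a + (-Complex.I) • toComplex b = cpt a b := by
    intro a b; ext j; simp [toComplex, cpt, sub_eq_add_neg]
  have := congrFun key (-Complex.I)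
  simp only [h2] at this
  exact this

/-- The real part of `P` on complex points is bounded below by half of `R` at the real part. -/
lemma IsPosHom.exists_re_evalC_ge (hP : IsPosHom P) :
    ∃ C > 0, ∀ ξ η, rePart P ξ / 2 - C * rePart P η ≤ (evalC P ξ η).re := by
  obtain ⟨E, hE⟩ := hP.1
  obtain ⟨C, hC, h⟩ := hP.exists_add_nonneg hE
    (f := fun ξ η => (evalC P ξ η).re - rePart P ξ / 2)
    ((Complex.continuous_re.comp continuous_evalC).sub
      (((continuous_rePart (P := P)).comp continuous_fst).div_const 2))
    (fun t ht ξ η => by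
      rw [evalC_dil hE ht, rePart_dil hE ht, Complex.re_ofReal_mul]; ring)
    (fun ξ hξ => by
      have h1 : (evalC P ξ 0).re = rePart P ξ := by rw [evalC, cpt_zero_right]; rfl
      rw [h1]
      linarith [hP.rePart_pos hξ])
  exact ⟨C, hC, fun ξ η => by linarith [h ξ η]⟩

end Homogeneous

/-! ### The trace of an exponent: determinant of t^E and scaling of Gaussian integrals. -/

section Trace

variable {d : ℕ}

lemma hasDerivAt_exp_smul_entry (E : Matrix (Fin d) (Fin d) ℝ) (i j : Fin d) :
    HasDerivAt (fun s : ℝ => (NormedSpace.exp (s • E)) i j) (E i j) 0 := by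
  let _ : NormedRing (Matrix (Fin d) (Fin d) ℝ) := Matrix.linftyOpNormedRing
  let _ : NormedAlgebra ℝ (Matrix (Fin d) (Fin d) ℝ) := Matrix.linftyOpNormedAlgebra
  have h1 := hasDerivAt_exp_smul_const (𝕂 := ℝ) E (0 : ℝ)
  rw [zero_smul, NormedSpace.exp_zero, one_mul] at h1
  let L : Matrix (Fin d) (Fin d) ℝ →ₗ[ℝ] ℝ := Matrix.entryLinearMap ℝ ℝ i j
  exact (LinearMap.toContinuousLinearMap L).hasFDerivAt.comp_hasDerivAt (0 : ℝ) h1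

/-- The exact value does not matter: it depends only on the entrywise derivative at the identity, so
exp(sE) and 1 + sE have determinants with the same derivative at s = 0. -/
lemma hasDerivAt_det_of_entries {A : ℝ → Matrix (Fin d) (Fin d) ℝ}
    {E : Matrix (Fin d) (Fin d) ℝ} (h1 : A 0 = 1)
    (hA : ∀ i j, HasDerivAt (fun s => A s i j) (E i j) 0) :
    HasDerivAt (fun s => (A s).det) (∑ σ : Equiv.Perm (Fin d), (Equiv.Perm.sign σ : ℝ) *
      ∑ i, (∏ j ∈ Finset.univ.erase i, (1 : Matrix (Fin d) (Fin d) ℝ) (σ j) j) • E (σ i) i) 0 := by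
  simp only [Matrix.det_apply']
  refine HasDerivAt.fun_sum fun σ _ => HasDerivAt.const_mul _ ?_
  have := HasDerivAt.fun_finsetProd (u := Finset.univ) (x := (0 : ℝ))
    (f := fun i s => A s (σ i) i) (f' := fun i => E (σ i) i) fun i _ => hA (σ i) i
  simpa only [h1] using this

/-- The derivative at 0 is tr E because det(1 + sE) = 1 + s tr E + O(s²). Multiplicativity then
gives the equation f' = f · tr E everywhere. -/
lemma det_exp_smul (E : Matrix (Fin d) (Fin d) ℝ) (s : ℝ) :
    (NormedSpace.exp (s • E)).det = Real.exp (s * E.trace) := by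
  have h0 : HasDerivAt (fun s : ℝ => (NormedSpace.exp (s • E)).det) E.trace 0 := by
    have h4 := hasDerivAt_det_of_entries (A := fun s => 1 + s • E) (E := E) (by simp) fun i j => by
      simpa using ((hasDerivAt_id (0 : ℝ)).mul_const (E i j)).const_add
        ((1 : Matrix (Fin d) (Fin d) ℝ) i j)
    have h5 : HasDerivAt (fun s : ℝ => (1 + s • E).det) E.trace 0 := by
      set p := (Matrix.det (1 + (Polynomial.X : Polynomial ℝ) •
        E.map Polynomial.C)).divX.divX
      have h6 : HasDerivAt (fun s : ℝ => 1 + E.trace * s + p.eval s * s ^ 2)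
          (E.trace * 1 + (p.derivative.eval 0 * 0 ^ 2 + p.eval 0 * (2 * 0 ^ 1))) 0 := by
        refine HasDerivAt.add (((hasDerivAt_id (0 : ℝ)).const_mul E.trace).const_add 1) ?_
        exact (p.hasDerivAt 0).mul (by simpa using hasDerivAt_pow 2 (0 : ℝ))
      convert! h6 using 1
      · ext s
        exact Matrix.det_one_add_smul s E
      · ring
    rw [← h4.unique h5]
    exact hasDerivAt_det_of_entries (by simp) (hasDerivAt_exp_smul_entry E)
  have hmul : ∀ s u : ℝ, (NormedSpace.exp ((s + u) • E)).det =
      (NormedSpace.exp (s • E)).det * (NormedSpace.exp (u • E)).det := fun s u => by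
    rw [add_smul, Matrix.exp_add_of_commute _ _ (((Commute.refl E).smul_left _).smul_right _),
      Matrix.det_mul]
  have hd : ∀ s : ℝ, HasDerivAt (fun s : ℝ => (NormedSpace.exp (s • E)).det)
      ((NormedSpace.exp (s • E)).det * E.trace) s := fun s => by
    have h1 : HasDerivAt (fun u : ℝ => (NormedSpace.exp (s • E)).det *
        (NormedSpace.exp ((u - s) • E)).det) ((NormedSpace.exp (s • E)).det * E.trace) s := by
      refine HasDerivAt.const_mul _ ?_
      have h2 : HasDerivAt (fun s : ℝ => (NormedSpace.exp (s • E)).det) E.trace (s - s) := by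
        rwa [sub_self]
      have h3 := HasDerivAt.comp s (h := fun u => u - s) h2 ((hasDerivAt_id s).sub_const s)
      rw [mul_one] at h3
      exact h3
    refine h1.congr_of_eventuallyEq (Eventually.of_forall fun u => ?_)
    simp only
    rw [← hmul, add_sub_cancel]
  have hconst : ∀ s : ℝ, HasDerivAt (fun s : ℝ => (NormedSpace.exp (s • E)).det *
      Real.exp (-(s * E.trace))) 0 s := fun s => by
    have h1 := (hd s).mul (((hasDerivAt_id s).mul_const E.trace).neg.exp)
    convert! h1 using 1
    simp only [id_eq]
    ring
  have h2 := is_const_of_deriv_eq_zero (fun s => (hconst s).differentiableAt)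
    (fun s => (hconst s).deriv) s 0
  simp only [zero_smul, NormedSpace.exp_zero, Matrix.det_one, zero_mul, neg_zero, Real.exp_zero,
    mul_one, Real.exp_neg] at h2
  field_simp at h2
  exact h2

lemma det_dil {E : Matrix (Fin d) (Fin d) ℝ} {t : ℝ} (ht : 0 < t) : (dil E t).det = t ^ E.trace := by
  rw [dil, det_exp_smul, Real.rpow_def_of_pos ht]

variable {P : MvPolynomial (Fin d) ℂ} {E : Matrix (Fin d) (Fin d) ℝ}

lemma IsPosHom.integrable_exp_neg (hP : IsPosHom P) {c : ℝ} (hc : 0 < c) :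
    Integrable fun ξ : Fin d → ℝ => Real.exp (-(c * rePart P ξ)) := by
  obtain ⟨K, hK, hg⟩ := hP.exists_growth (A := c⁻¹) (by positivity)
  have h1 : Integrable fun ξ : Fin d → ℝ => (1 + ‖ξ‖) ^ (-((d : ℝ) + 1)) :=
    integrable_one_add_norm (by simp)
  obtain ⟨B, hB, hexp⟩ : ∃ B > 0, ∀ x : ℝ, 0 ≤ x → Real.exp (-x) ≤ B * (1 + x) ^ (-((d : ℝ) + 1)) := by
    refine ⟨Real.exp 1 * (d + 1).factorial, by positivity, fun x hx => ?_⟩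
    have h2 := Real.pow_div_factorial_le_exp (1 + x) (by positivity) (d + 1)
    rw [Real.rpow_neg (by positivity), ← div_eq_mul_inv, le_div_iff₀ (by positivity)]
    rw [div_le_iff₀ (by positivity), Real.exp_add] at h2
    have h3 : ((1 + x : ℝ) ^ ((d : ℝ) + 1)) = (1 + x) ^ (d + 1) := by
      rw [← Real.rpow_natCast]; push_cast; rfl
    rw [h3, Real.exp_neg, inv_mul_le_iff₀ (Real.exp_pos x)]
    linarith
  refine (h1.const_mul (B * Real.exp K)).mono' (Real.continuous_exp.comp
    (continuous_const.mul continuous_rePart).neg).aestronglyMeasurable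
    (Eventually.of_forall fun ξ => ?_)
  rw [Real.norm_of_nonneg (Real.exp_pos _).le]
  have h4 : ‖ξ‖ - K ≤ c * rePart P ξ := by
    rcases le_total K ‖ξ‖ with h | h
    · have := mul_le_mul_of_nonneg_left (hg ξ h) hc.le
      rw [mul_inv_cancel_left₀ hc.ne'] at this
      linarith
    · have := mul_nonneg hc.le (hP.2.1 ξ)
      linarith
  calc Real.exp (-(c * rePart P ξ)) ≤ Real.exp (K + -‖ξ‖) := Real.exp_le_exp.2 (by linarith)
    _ = Real.exp K * Real.exp (-‖ξ‖) := Real.exp_add _ _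
    _ ≤ Real.exp K * (B * (1 + ‖ξ‖) ^ (-((d : ℝ) + 1))) :=
        mul_le_mul_of_nonneg_left (hexp _ (norm_nonneg _)) (Real.exp_pos _).le
    _ = _ := by ring

/-- The source of the power n^{-tr E}: substitute t^E ξ for ξ, with Jacobian t^{tr E}. -/
lemma integral_exp_neg_mul (hE : E ∈ expSet P) {t : ℝ} (ht : 0 < t) (c : ℝ) :
    ∫ ξ : Fin d → ℝ, Real.exp (-(t * c * rePart P ξ)) =
      t ^ (-E.trace) * ∫ ξ : Fin d → ℝ, Real.exp (-(c * rePart P ξ)) := by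
  have hdet : (dil E t).det ≠ 0 := by rw [det_dil ht]; positivity
  have h1 := Real.map_matrix_volume_pi_eq_smul_volume_pi hdet
  have h2 : ∫ ξ, Real.exp (-(c * rePart P ξ)) ∂(Measure.map (Matrix.toLin' (dil E t)) volume) =
      ∫ ξ : Fin d → ℝ, Real.exp (-(c * rePart P (dil E t *ᵥ ξ))) := by
    rw [integral_map]
    · rfl
    · exact (LinearMap.continuous_on_pi _).aemeasurable
    · exact (Real.continuous_exp.comp (continuous_const.mul continuous_rePart).neg).aestronglyMeasurable
  rw [h1, integral_smul_measure] at h2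
  rw [det_dil ht, ENNReal.toReal_ofReal (abs_nonneg _), abs_of_pos (by positivity),
    ← Real.rpow_neg ht.le, smul_eq_mul] at h2
  rw [h2]
  congr 1 with ξ
  rw [rePart_dil hE ht]
  ring_nf

lemma IsPosHom.integral_exp_neg_pos (hP : IsPosHom P) {c : ℝ} (hc : 0 < c) :
    0 < ∫ ξ : Fin d → ℝ, Real.exp (-(c * rePart P ξ)) :=
  integral_exp_pos (hP.integrable_exp_neg hc)

/-- The same positive integral scales by t^{-tr E} and by t^{-tr E'}; compare at t = e. -/
lemma IsPosHom.trace_eq (hP : IsPosHom P) {E' : Matrix (Fin d) (Fin d) ℝ} (hE : E ∈ expSet P)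
    (hE' : E' ∈ expSet P) : E.trace = E'.trace := by
  have h1 := integral_exp_neg_mul hE (t := Real.exp 1) (Real.exp_pos 1) 1
  rw [integral_exp_neg_mul hE' (Real.exp_pos 1) 1] at h1
  have h2 := mul_right_cancel₀ (hP.integral_exp_neg_pos one_pos).ne' h1
  rw [Real.exp_one_rpow, Real.exp_one_rpow] at h2
  have := Real.exp_injective h2
  linarith

/-- As t → 0 the matrices t^E tend to 0, hence so does det t^E = t^{tr E}. In dimension 0 the
determinant of the zero matrix is 1, which is why d > 0 enters. -/
lemma IsPosHom.trace_pos (hd : 0 < d) (hP : IsPosHom P) (hE : E ∈ expSet P) : 0 < E.trace := by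
  have h1 : Tendsto (fun t => dil E t) (𝓝[>] 0) (𝓝 0) := by
    refine tendsto_pi_nhds.2 fun i => tendsto_pi_nhds.2 fun j => ?_
    have := (tendsto_pi_nhds.1 (hP.tendsto_dil_mulVec hE (Pi.single j 1))) i
    simpa using this
  have h2 : Tendsto (fun t => (dil E t).det) (𝓝[>] 0) (𝓝 0) := by
    have : Tendsto (fun A : Matrix (Fin d) (Fin d) ℝ => A.det) (𝓝 0) (𝓝 0) := by
      have := (continuous_id.matrix_det (n := Fin d) (R := ℝ)).tendsto 0
      have hne : Nonempty (Fin d) := ⟨⟨0, hd⟩⟩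
      simpa using this
    exact this.comp h1
  by_contra! hcon
  have h3 : ∀ᶠ t : ℝ in 𝓝[>] 0, t ∈ Set.Ioc (0 : ℝ) 1 := Ioc_mem_nhdsGT one_pos
  obtain ⟨t, ht1, ht2⟩ := ((h2.eventually (gt_mem_nhds one_pos)).and h3).exists
  rw [det_dil ht2.1] at ht1
  exact absurd ht1 (not_lt.2 (Real.one_le_rpow_of_pos_of_le_one_of_nonpos ht2.1 ht2.2 hcon))

end Trace

/-! ### Linear coordinates adapted to R. -/

section AdaptedCoordinates

variable {d : ℕ} {P : MvPolynomial (Fin d) ℂ}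

lemma exists_polynomial_eval_rePart (u : Fin d → Polynomial ℝ) :
    ∃ p : Polynomial ℝ, (∀ N, (∀ i, (u i).natDegree ≤ N) → p.natDegree ≤ P.totalDegree * N) ∧
      ∀ s, p.eval s = rePart P fun i => (u i).eval s := by
  set Q : Polynomial ℂ := MvPolynomial.aeval (fun i => (u i).map Complex.ofRealHom) P
  refine ⟨∑ n ∈ Finset.range (Q.natDegree + 1), Polynomial.C (Q.coeff n).re * Polynomial.X ^ n,
    fun N hN => ?_, fun s => ?_⟩
  · have hQ : Q.natDegree ≤ P.totalDegree * N :=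
      MvPolynomial.aeval_natDegree_le P le_rfl _ fun i => (Polynomial.natDegree_map_le).trans (hN i)
    refine Polynomial.natDegree_sum_le_of_forall_le _ _ fun n hn => ?_
    refine (Polynomial.natDegree_C_mul_X_pow_le _ _).trans ?_
    have := Finset.mem_range.1 hn
    omega
  · have h1 : Q.eval (s : ℂ) = evalR P fun i => (u i).eval s := by
      have h2 : Q.eval (s : ℂ) = MvPolynomial.aeval
          (fun i => ((u i).map Complex.ofRealHom).eval (s : ℂ)) P := by
        have := MvPolynomial.comp_aeval_apply (fun i => (u i).map Complex.ofRealHom)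
          (Polynomial.aeval (s : ℂ)) P
        simpa only [Polynomial.coe_aeval_eq_eval] using this
      rw [h2, evalR, MvPolynomial.aeval_eq_eval]
      congr 1
      ext i
      · simp
      · rw [MvPolynomial.eval_X, MvPolynomial.eval_X, Polynomial.eval_map]
        exact Polynomial.eval₂_hom Complex.ofRealHom s
    rw [rePart, ← h1, Polynomial.eval_eq_sum_range (p := Q), Complex.re_sum, Polynomial.eval_finsetSum]
    refine Finset.sum_congr rfl fun n _ => ?_
    rw [← Complex.ofReal_pow, Complex.re_mul_ofReal]
    simp

/-- The order of vanishing of a polynomial at 0 is an integer, so failing to be O(s^{k+1}) already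
yields a lower bound of order s^k. -/
lemma polynomial_isBigO_or_ge (p : Polynomial ℝ) (k : ℕ) :
    (fun s => p.eval s) =O[𝓝[>] 0] (fun s : ℝ => s ^ (k + 1)) ∨
      ∃ c > 0, ∀ᶠ s : ℝ in 𝓝[>] 0, c * s ^ k ≤ |p.eval s| := by
  rcases eq_or_ne p 0 with rfl | hp
  · left
    simpa using isBigO_zero _ _
  obtain ⟨r, hr, hr0⟩ := Polynomial.exists_eq_pow_rootMultiplicity_mul_and_not_dvd p hp 0
  set n := p.rootMultiplicity 0
  have heval : ∀ s, p.eval s = s ^ n * r.eval s := fun s => by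
    conv_lhs => rw [hr]
    simp
  have hr1 : r.eval 0 ≠ 0 := by
    rwa [Polynomial.dvd_iff_isRoot] at hr0
  have hcont : Tendsto (fun s => r.eval s) (𝓝[>] 0) (𝓝 (r.eval 0)) :=
    (r.continuous.tendsto 0).mono_left nhdsWithin_le_nhds
  have hle : ∀ m l : ℕ, m ≤ l → (fun s : ℝ => s ^ l) =O[𝓝[>] 0] (fun s : ℝ => s ^ m) := fun m l h => by
    refine IsBigO.of_bound 1 ?_
    filter_upwards [Ioc_mem_nhdsGT (one_pos : (0 : ℝ) < 1)] with s hs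
    rw [one_mul, Real.norm_of_nonneg (pow_nonneg hs.1.le _),
      Real.norm_of_nonneg (pow_nonneg hs.1.le _)]
    exact pow_le_pow_of_le_one hs.1.le hs.2 h
  rcases Nat.lt_or_ge k n with h | h
  · left
    simp only [heval]
    simpa using (hle (k + 1) n h).mul (hcont.isBigO_one ℝ)
  · right
    refine ⟨|r.eval 0| / 2, by positivity, ?_⟩
    have h2 : ∀ᶠ s in 𝓝[>] (0 : ℝ), |r.eval 0| / 2 < |r.eval s| :=
      hcont.abs.eventually (lt_mem_nhds (by linarith [abs_pos.2 hr1]))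
    filter_upwards [h2, Ioc_mem_nhdsGT (one_pos : (0 : ℝ) < 1)] with s hs hs1
    rw [heval, abs_mul, abs_of_nonneg (pow_nonneg hs1.1.le _), mul_comm]
    exact mul_le_mul (pow_le_pow_of_le_one hs1.1.le hs1.2 h) hs.le (by positivity)
      (pow_nonneg hs1.1.le _)

lemma IsPosHom.exists_rePart_smul_le (hP : IsPosHom P) (a : ℝ) :
    ∃ C > 0, ∀ ξ, rePart P (a • ξ) ≤ C * rePart P ξ := by
  obtain ⟨E, hE⟩ := hP.1
  obtain ⟨C, hC, h⟩ := hP.exists_abs_le hE (f := fun ξ _ => rePart P (a • ξ))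
    (continuous_rePart.comp (continuous_fst.const_smul a))
    (fun t ht ξ η => by rw [← Matrix.mulVec_smul, rePart_dil hE ht])
  refine ⟨C, hC, fun ξ => ?_⟩
  have := h ξ 0
  rw [hP.rePart_zero, add_zero] at this
  exact (le_abs_self _).trans this

lemma IsPosHom.exists_rePart_sum_le (hP : IsPosHom P) {ι : Type*} (S : Finset ι) :
    ∃ C > 0, ∀ v : ι → Fin d → ℝ, rePart P (∑ j ∈ S, v j) ≤ C * ∑ j ∈ S, rePart P (v j) := by
  classical
  obtain ⟨C, hC, hq⟩ := hP.quasi_triangle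
  induction S using Finset.induction_on with
  | empty => exact ⟨1, one_pos, fun v => by simp [hP.rePart_zero]⟩
  | insert a S ha ih =>
    obtain ⟨B, hB, h⟩ := ih
    refine ⟨C * (1 + B), by positivity, fun v => ?_⟩
    rw [Finset.sum_insert ha, Finset.sum_insert ha]
    have h1 := hq (v a) (∑ j ∈ S, v j)
    have h2 := mul_le_mul_of_nonneg_left (h v) hC.le
    have h3 := mul_nonneg hC.le (hP.2.1 (v a))
    have h4 : 0 ≤ C * ∑ j ∈ S, rePart P (v j) :=
      mul_nonneg hC.le (Finset.sum_nonneg fun j _ => hP.2.1 (v j))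
    nlinarith [mul_nonneg hB.le h3]

/-- `R` vanishes at `0` to order at least `k` in the direction `v`. -/
def VanishesToOrder (P : MvPolynomial (Fin d) ℂ) (v : Fin d → ℝ) (k : ℕ) : Prop :=
  (fun s : ℝ => rePart P (s • v)) =O[𝓝[>] 0] (fun s : ℝ => s ^ k)

lemma exists_polynomial_eval_rePart_smul (v : Fin d → ℝ) :
    ∃ p : Polynomial ℝ, p.natDegree ≤ P.totalDegree ∧ ∀ s, p.eval s = rePart P (s • v) := by
  obtain ⟨p, h1, h2⟩ := exists_polynomial_eval_rePart (P := P)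
    fun i => Polynomial.C (v i) * Polynomial.X
  refine ⟨p, by simpa using h1 1 fun i => by simpa using Polynomial.natDegree_C_mul_X_pow_le (v i) 1,
    fun s => ?_⟩
  rw [h2]
  congr 1
  ext i
  rw [Polynomial.eval_mul, Polynomial.eval_C, Polynomial.eval_X, Pi.smul_apply, smul_eq_mul,
    mul_comm]

/-- Positivity of R makes its restriction to the line a nonzero polynomial, whose order at 0 is at
most its degree. This keeps the total orders of bases bounded. -/
lemma IsPosHom.order_le_totalDegree (hP : IsPosHom P) {v : Fin d → ℝ} (hv : v ≠ 0) {k : ℕ}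
    (h : VanishesToOrder P v k) : k ≤ P.totalDegree := by
  by_contra! hk
  obtain ⟨p, hp1, hp2⟩ := exists_polynomial_eval_rePart_smul (P := P) v
  have hp0 : p ≠ 0 := by
    rintro rfl
    have := hp2 1
    rw [one_smul, Polynomial.eval_zero] at this
    exact (hP.rePart_pos hv).ne this
  obtain ⟨r, hr, hr0⟩ := Polynomial.exists_eq_pow_rootMultiplicity_mul_and_not_dvd p hp0 0
  set n := p.rootMultiplicity 0
  have hn : n < k := by
    refine lt_of_le_of_lt ?_ hk
    refine le_trans ?_ hp1
    rw [hr, Polynomial.natDegree_mul]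
    · simp
    · simp [Polynomial.X_ne_zero]
    · rintro rfl; simp at hr0
  have hr1 : r.eval 0 ≠ 0 := by
    rwa [Polynomial.dvd_iff_isRoot] at hr0
  obtain ⟨C, hC⟩ := h.bound
  have hlim : Tendsto (fun s : ℝ => C * s ^ (k - n)) (𝓝[>] 0) (𝓝 0) := by
    have : Continuous fun s : ℝ => C * s ^ (k - n) := by fun_prop
    exact (this.tendsto' 0 0 (by simp [Nat.sub_ne_zero_of_lt hn])).mono_left nhdsWithin_le_nhds
  have hcont : Tendsto (fun s => r.eval s) (𝓝[>] 0) (𝓝 (r.eval 0)) :=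
    (r.continuous.tendsto 0).mono_left nhdsWithin_le_nhds
  have h3 : Tendsto (fun s => r.eval s) (𝓝[>] 0) (𝓝 0) := by
    refine squeeze_zero_norm' ?_ hlim
    filter_upwards [hC, self_mem_nhdsWithin] with s hs hs0
    have hs0 : 0 < s := hs0
    rw [← hp2, hr] at hs
    simp only [map_zero, sub_zero, Polynomial.eval_mul, Polynomial.eval_pow, Polynomial.eval_X,
      norm_mul, norm_pow] at hs
    rw [Real.norm_of_nonneg hs0.le] at hs
    refine le_of_mul_le_mul_left ?_ (pow_pos hs0 n)
    calc s ^ n * ‖r.eval s‖ ≤ C * s ^ k := hs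
      _ = s ^ n * (C * s ^ (k - n)) := by
        rw [mul_left_comm, ← pow_add, Nat.add_sub_cancel' hn.le]
  exact hr1 (tendsto_nhds_unique hcont h3)

/-- The anisotropic dilation `x ↦ (s^{e_j} x_j)_j`. -/
def anisoDil (e : Fin d → ℕ) (s : ℝ) (x : Fin d → ℝ) : Fin d → ℝ := fun j => s ^ e j * x j

lemma anisoDil_anisoDil (e : Fin d → ℕ) (s t : ℝ) (x : Fin d → ℝ) :
    anisoDil e s (anisoDil e t x) = anisoDil e (s * t) x := by
  ext j; simp [anisoDil, mul_pow, mul_assoc]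

lemma anisoDil_add (e : Fin d → ℕ) (s : ℝ) (x y : Fin d → ℝ) :
    anisoDil e s (x + y) = anisoDil e s x + anisoDil e s y := by
  ext j; simp [anisoDil, mul_add]

lemma anisoDil_smul (e : Fin d → ℕ) (s a : ℝ) (x : Fin d → ℝ) :
    anisoDil e s (a • x) = a • anisoDil e s x := by
  ext j; simp [anisoDil, mul_left_comm]

lemma norm_anisoDil_le (e : Fin d → ℕ) {s : ℝ} (hs : 0 ≤ s) (hs1 : s ≤ 1) (x : Fin d → ℝ) :
    ‖anisoDil e s x‖ ≤ ‖x‖ := by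
  refine (pi_norm_le_iff_of_nonneg (norm_nonneg _)).2 fun j => ?_
  rw [anisoDil, norm_mul, Real.norm_of_nonneg (pow_nonneg hs _)]
  exact (mul_le_of_le_one_left (norm_nonneg _) (pow_le_one₀ hs hs1)).trans (norm_le_pi_norm x j)

/-- The model gauge `∑ |x_j|^{k_j}`. -/
def gauge (k : Fin d → ℕ) (x : Fin d → ℝ) : ℝ := ∑ j, |x j| ^ k j

lemma gauge_nonneg (k : Fin d → ℕ) (x : Fin d → ℝ) : 0 ≤ gauge k x :=
  Finset.sum_nonneg fun _ _ => by positivity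

lemma continuous_gauge (k : Fin d → ℕ) : Continuous (gauge k) := by
  unfold gauge; fun_prop

lemma gauge_zero {k : Fin d → ℕ} (hk : ∀ j, 1 ≤ k j) : gauge k 0 = 0 := by
  simp [gauge, fun j => Nat.one_le_iff_ne_zero.1 (hk j)]

lemma gauge_anisoDil {k e : Fin d → ℕ} {q : ℕ} (hke : ∀ j, e j * k j = q) {s : ℝ} (hs : 0 ≤ s)
    (x : Fin d → ℝ) : gauge k (anisoDil e s x) = s ^ q * gauge k x := by
  rw [gauge, gauge, Finset.mul_sum]
  refine Finset.sum_congr rfl fun j _ => ?_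
  rw [anisoDil, abs_mul, abs_of_nonneg (pow_nonneg hs _), mul_pow, ← pow_mul, hke]

lemma abs_pow_le_gauge (k : Fin d → ℕ) (x : Fin d → ℝ) (j : Fin d) : |x j| ^ k j ≤ gauge k x :=
  Finset.single_le_sum (f := fun j => |x j| ^ k j) (fun _ _ => by positivity) (Finset.mem_univ j)

/-- The quasi-triangle inequality reduces to the coordinate axes, where the orders of the columns
apply; the negative half-axes are reached through R(-ξ) ≤ B R(ξ). -/
lemma IsPosHom.exists_rePart_mulVec_le (hP : IsPosHom P) {T : Matrix (Fin d) (Fin d) ℝ}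
    {k : Fin d → ℕ} (hT : ∀ j, VanishesToOrder P (T.col j) (k j)) :
    ∃ δ > 0, ∃ C > 0, ∀ x : Fin d → ℝ, ‖x‖ < δ → rePart P (T *ᵥ x) ≤ C * gauge k x := by
  obtain ⟨B, hB, hneg⟩ := hP.exists_rePart_smul_le (-1)
  obtain ⟨A, hA, hsum⟩ := hP.exists_rePart_sum_le (Finset.univ : Finset (Fin d))
  have h1 : ∀ j, ∃ D δ : ℝ, 0 < D ∧ 0 < δ ∧ ∀ s, |s| < δ → rePart P (s • T.col j) ≤ D * |s| ^ k j := by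
    intro j
    obtain ⟨D, hD, hb⟩ := (hT j).exists_pos
    obtain ⟨δ, hδ, hb'⟩ := (nhdsGT_basis (0 : ℝ)).eventually_iff.1 hb.bound
    have hpos : ∀ s, 0 < s → s < δ → rePart P (s • T.col j) ≤ D * s ^ k j := fun s h0 h1 => by
      have := hb' ⟨h0, h1⟩
      rw [Real.norm_of_nonneg (hP.2.1 _), Real.norm_of_nonneg (pow_nonneg h0.le _)] at this
      exact this
    refine ⟨max 1 B * D, δ, by positivity, hδ, fun s hs => ?_⟩
    rcases lt_trichotomy s 0 with h0 | rfl | h0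
    · rw [abs_of_neg h0] at hs ⊢
      have h2 := hneg ((-s) • T.col j)
      rw [smul_smul, neg_one_mul, neg_neg] at h2
      have h3 := hpos (-s) (by linarith) hs
      have h4 : 0 ≤ D * (-s) ^ k j := mul_nonneg hD.le (pow_nonneg (by linarith) _)
      calc rePart P (s • T.col j) ≤ B * (D * (-s) ^ k j) := h2.trans (mul_le_mul_of_nonneg_left h3 hB.le)
        _ ≤ max 1 B * (D * (-s) ^ k j) := mul_le_mul_of_nonneg_right (le_max_right _ _) h4
        _ = _ := by ring
    · rw [zero_smul, hP.rePart_zero]; positivity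
    · rw [abs_of_pos h0] at hs ⊢
      have h4 : 0 ≤ D * s ^ k j := by positivity
      calc rePart P (s • T.col j) ≤ 1 * (D * s ^ k j) := by rw [one_mul]; exact hpos s h0 hs
        _ ≤ max 1 B * (D * s ^ k j) := mul_le_mul_of_nonneg_right (le_max_left _ _) h4
        _ = _ := by ring
  choose D δ hD hδ hb using h1
  obtain ⟨δ', hδ', hδ''⟩ : ∃ δ' > 0, ∀ j, δ' ≤ δ j := by
    rcases isEmpty_or_nonempty (Fin d) with h | h
    · exact ⟨1, one_pos, fun j => h.elim j⟩
    · obtain ⟨j, hj⟩ := Finite.exists_min δ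
      exact ⟨δ j, hδ j, hj⟩
  refine ⟨δ', hδ', A * ∑ j, D j + 1,
    add_pos_of_nonneg_of_pos (mul_nonneg hA.le (Finset.sum_nonneg fun j _ => (hD j).le)) one_pos,
    fun x hx => ?_⟩
  have h2 : T *ᵥ x = ∑ j, x j • T.col j := by
    ext i
    simp [Matrix.mulVec, dotProduct, mul_comm]
  have h3 : ∑ j, rePart P (x j • T.col j) ≤ (∑ j, D j) * gauge k x := by
    rw [Finset.sum_mul]
    refine Finset.sum_le_sum fun j _ => ?_
    have h4 : |x j| < δ j := lt_of_le_of_lt (norm_le_pi_norm x j) (hx.trans_le (hδ'' j))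
    exact (hb j _ h4).trans (mul_le_mul_of_nonneg_left (abs_pow_le_gauge k x j) (hD j).le)
  rw [h2]
  have h5 := gauge_nonneg k x
  calc _ ≤ A * ∑ j, rePart P (x j • T.col j) := hsum _
    _ ≤ A * ((∑ j, D j) * gauge k x) := mul_le_mul_of_nonneg_left h3 hA.le
    _ ≤ _ := by nlinarith

lemma exists_polynomial_eval_anisoDil (T : Matrix (Fin d) (Fin d) ℝ) (e : Fin d → ℕ)
    (x : Fin d → ℝ) :
    ∃ p : Polynomial ℝ, ∀ s, p.eval s = rePart P (T *ᵥ anisoDil e s x) := by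
  obtain ⟨p, -, h2⟩ := exists_polynomial_eval_rePart (P := P)
    fun i => ∑ j, Polynomial.C (T i j * x j) * Polynomial.X ^ e j
  refine ⟨p, fun s => ?_⟩
  rw [h2]
  congr 1
  ext i
  rw [Polynomial.eval_finsetSum, Matrix.mulVec, dotProduct]
  refine Finset.sum_congr rfl fun j _ => ?_
  simp only [Polynomial.eval_mul, Polynomial.eval_C, Polynomial.eval_pow, Polynomial.eval_X, anisoDil]
  ring

/-- A basis whose vectors have the largest possible total order of vanishing. -/
lemma IsPosHom.exists_maximal_orders (hP : IsPosHom P) :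
    ∃ (T : Matrix (Fin d) (Fin d) ℝ) (k : Fin d → ℕ), T.det ≠ 0 ∧ (∀ j, 1 ≤ k j) ∧
      (∀ j, VanishesToOrder P (T.col j) (k j)) ∧
      ∀ (j : Fin d) (z : Fin d → ℝ), z j ≠ 0 → ¬ VanishesToOrder P (T *ᵥ z) (k j + 1) := by
  let G : Matrix (Fin d) (Fin d) ℝ → (Fin d → ℕ) → Prop := fun T k =>
    T.det ≠ 0 ∧ (∀ j, 1 ≤ k j) ∧ ∀ j, VanishesToOrder P (T.col j) (k j)
  let S : Set ℕ := {m | ∃ T k, G T k ∧ ∑ j, k j = m}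
  have hcol : ∀ T : Matrix (Fin d) (Fin d) ℝ, T.det ≠ 0 → ∀ j, T.col j ≠ 0 := fun T hT j h =>
    hT (Matrix.det_eq_zero_of_column_eq_zero j fun i => congrFun h i)
  have hne : S.Nonempty := by
    -- The standard basis qualifies with all orders equal to 1.
    refine ⟨∑ j : Fin d, 1, 1, fun _ => 1, ⟨by simp, fun _ => le_rfl, fun j => ?_⟩, rfl⟩
    obtain ⟨θ, hθ, h⟩ := hP.rePart_smul_le one_pos
    refine IsBigO.of_bound (rePart P ((1 : Matrix (Fin d) (Fin d) ℝ).col j)) ?_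
    filter_upwards [Ioc_mem_nhdsGT hθ] with s hs
    rw [Real.norm_of_nonneg (hP.2.1 _), Real.norm_of_nonneg (pow_nonneg hs.1.le _)]
    have := h s hs.1.le hs.2 ((1 : Matrix (Fin d) (Fin d) ℝ).col j)
    linarith
  have hbdd : BddAbove S := by
    refine ⟨∑ j : Fin d, P.totalDegree, ?_⟩
    rintro m ⟨T, k, ⟨h1, -, h3⟩, rfl⟩
    exact Finset.sum_le_sum fun j _ => hP.order_le_totalDegree (hcol T h1 j) (h3 j)
  obtain ⟨T, k, ⟨h1, h2, h3⟩, h4⟩ := Nat.sSup_mem hne hbdd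
  refine ⟨T, k, h1, h2, h3, fun j z hz hv => ?_⟩
  -- Replacing column j by T z multiplies the determinant by z_j ≠ 0, so it is still a basis, with
  -- total order larger by one; this contradicts maximality.
  have hmem : ∑ i, Function.update k j (k j + 1) i ∈ S := by
    refine ⟨T.updateCol j (T *ᵥ z), Function.update k j (k j + 1), ⟨?_, ?_, ?_⟩, rfl⟩
    · have h5 := Matrix.det_updateCol_sum T j z
      have h6 : T *ᵥ z = fun i => ∑ l, z l • T i l := by
        ext i; simp [Matrix.mulVec, dotProduct, mul_comm]
      rw [h6, h5, smul_eq_mul]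
      exact mul_ne_zero hz h1
    · intro i
      rcases eq_or_ne i j with rfl | h
      · simp
      · simpa [h] using h2 i
    · intro i
      rcases eq_or_ne i j with rfl | h
      · have : (T.updateCol i (T *ᵥ z)).col i = T *ᵥ z := by ext; simp [Matrix.col]
        simpa [this] using hv
      · have : (T.updateCol j (T *ᵥ z)).col i = T.col i := by ext; simp [Matrix.col, h]
        simpa [this, h] using h3 i
  have h7 := le_csSup hbdd hmem
  rw [← h4, Finset.sum_update_of_mem (Finset.mem_univ j),
    ← Finset.add_sum_erase _ k (Finset.mem_univ j), Finset.sdiff_singleton_eq_erase] at h7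
  omega

end AdaptedCoordinates

section AdaptedCoordinates

variable {d : ℕ} {P : MvPolynomial (Fin d) ℂ}

/-- In the coordinates of a basis of maximal orders, `R` does not degenerate along the
anisotropic dilations. -/
lemma IsPosHom.exists_anisoDil_ge (hP : IsPosHom P) {T : Matrix (Fin d) (Fin d) ℝ}
    {k e : Fin d → ℕ} {q : ℕ} (hk : ∀ j, 1 ≤ k j) (he : ∀ j, 1 ≤ e j) (hke : ∀ j, e j * k j = q)
    (hT : ∀ j, VanishesToOrder P (T.col j) (k j))
    (hmax : ∀ (j : Fin d) (z : Fin d → ℝ), z j ≠ 0 → ¬ VanishesToOrder P (T *ᵥ z) (k j + 1))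
    {x : Fin d → ℝ} (hx : x ≠ 0) :
    ∃ c > 0, ∀ᶠ s : ℝ in 𝓝[>] 0, c * s ^ q ≤ rePart P (T *ᵥ anisoDil e s x) := by
  obtain ⟨p, hp⟩ := exists_polynomial_eval_anisoDil (P := P) T e x
  rcases polynomial_isBigO_or_ge p q with h | ⟨c, hc, h⟩
  swap
  · refine ⟨c, hc, h.mono fun s hs => ?_⟩
    rwa [hp, abs_of_nonneg (hP.2.1 _)] at hs
  -- Suppose R decays like s^{q+1} along x. The part z of x of smallest weight moves along a
  -- straight line, so maximality gives R ≥ c s^q along z. A rescaled dilate y of x approximates z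
  -- and still decays like s^{q+1}, and the quasi-triangle inequality for z = y + (z - y) is
  -- violated for small s.
  exfalso
  obtain ⟨δ, hδ, B, hB, hup⟩ := hP.exists_rePart_mulVec_le hT
  obtain ⟨A, hA, hquasi⟩ := hP.quasi_triangle
  -- the smallest weight occurring in `x`
  obtain ⟨j₀, hj₀, hmin⟩ : ∃ j₀, x j₀ ≠ 0 ∧ ∀ j, x j ≠ 0 → e j₀ ≤ e j := by
    have hne : (Finset.univ.filter fun j => x j ≠ 0).Nonempty := by
      obtain ⟨j, hj⟩ := Function.ne_iff.1 hx
      exact ⟨j, by simpa using hj⟩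
    obtain ⟨j₀, h1, h2⟩ := Finset.exists_min_image _ e hne
    exact ⟨j₀, by simpa using h1, fun j hj => h2 j (by simpa using hj)⟩
  set z : Fin d → ℝ := fun j => if e j = e j₀ then x j else 0
  have hz0 : z j₀ ≠ 0 := by simpa [z] using hj₀
  refine hmax j₀ z hz0 ?_
  obtain ⟨p', -, hp'⟩ := exists_polynomial_eval_rePart_smul (P := P) (T *ᵥ z)
  rcases polynomial_isBigO_or_ge p' (k j₀) with h' | ⟨c, hc, h'⟩
  · simp only [hp'] at h'
    exact h'
  exfalso
  have hDz : ∀ s, anisoDil e s z = s ^ e j₀ • z := fun s => by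
    ext j
    by_cases hj : e j = e j₀ <;> simp [anisoDil, z, hj]
  -- the lower bound along `z`
  have hpow : Tendsto (fun s : ℝ => s ^ e j₀) (𝓝[>] 0) (𝓝[>] 0) := by
    refine tendsto_nhdsWithin_iff.2 ⟨?_, ?_⟩
    · exact ((continuous_pow (e j₀)).tendsto' 0 0
        (by simp [Nat.one_le_iff_ne_zero.1 (he j₀)])).mono_left nhdsWithin_le_nhds
    · filter_upwards [self_mem_nhdsWithin] with s hs
      exact pow_pos (Set.mem_Ioi.1 hs) _
  have hlow : ∀ᶠ s : ℝ in 𝓝[>] 0, c * s ^ q ≤ rePart P (T *ᵥ anisoDil e s z) := by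
    filter_upwards [hpow.eventually h'] with s hs
    rw [hp', abs_of_nonneg (hP.2.1 _), ← pow_mul, hke] at hs
    rwa [hDz, Matrix.mulVec_smul]
  -- approximate `z` by rescaled dilates of `x`
  have happrox : ∀ σ : ℝ, 0 < σ → z - (σ ^ e j₀)⁻¹ • anisoDil e σ x =
      fun j => if e j = e j₀ then 0 else - (σ ^ (e j - e j₀) * x j) := by
    intro σ hσ
    ext j
    have hσ' : σ ^ e j₀ ≠ 0 := (pow_pos hσ _).ne'
    by_cases hj : e j = e j₀
    · simp [z, hj, anisoDil, hσ']
    · by_cases hxj : x j = 0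
      · simp [z, anisoDil, hxj]
      · have := hmin j hxj
        simp only [z, hj, anisoDil, Pi.sub_apply, Pi.smul_apply, smul_eq_mul, if_false, zero_sub]
        rw [← mul_assoc, pow_sub₀ σ hσ.ne' this, mul_comm (σ ^ e j)]
  have hlim : Tendsto (fun σ : ℝ => fun j => if e j = e j₀ then 0 else - (σ ^ (e j - e j₀) * x j))
      (𝓝[>] 0) (𝓝 (0 : Fin d → ℝ)) := by
    refine tendsto_pi_nhds.2 fun j => ?_
    by_cases hj : e j = e j₀
    · simp [hj]
    · simp only [hj, if_false]
      by_cases hxj : x j = 0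
      · simp [hxj]
      · have h1 := hmin j hxj
        have h2 : e j - e j₀ ≠ 0 := by omega
        have : Continuous fun σ : ℝ => - (σ ^ (e j - e j₀) * x j) := by fun_prop
        exact (this.tendsto' 0 0 (by simp [h2])).mono_left nhdsWithin_le_nhds
  have hlimg : Tendsto (fun σ : ℝ => gauge k fun j =>
      if e j = e j₀ then 0 else - (σ ^ (e j - e j₀) * x j)) (𝓝[>] 0) (𝓝 0) := by
    have := ((continuous_gauge k).tendsto 0).comp hlim
    rwa [gauge_zero hk] at this
  -- The constant 4AB leaves each of the two quasi-triangle terms at most (c/4) s^q, against a lower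
  -- bound c s^q.
  obtain ⟨σ, ⟨hσ1, hσ2⟩, hσ⟩ := (((hlimg.eventually
    (gt_mem_nhds (show 0 < c / (4 * A * B) by positivity))).and
      (hlim.norm.eventually (gt_mem_nhds (show ‖(0 : Fin d → ℝ)‖ < δ by simpa using hδ)))).and
      self_mem_nhdsWithin).exists
  have hσ : 0 < σ := hσ
  rw [← happrox σ hσ] at hσ1 hσ2
  set y := (σ ^ e j₀)⁻¹ • anisoDil e σ x
  -- `y` still has the small growth of `x`
  obtain ⟨D, hD, hDle⟩ := hP.exists_rePart_smul_le (σ ^ e j₀)⁻¹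
  obtain ⟨K, hK, hKb⟩ := h.exists_pos
  have hscale : Tendsto (fun s : ℝ => s * σ) (𝓝[>] 0) (𝓝[>] 0) := by
    refine tendsto_nhdsWithin_iff.2 ⟨?_, ?_⟩
    · exact ((continuous_mul_const σ).tendsto' 0 0 (zero_mul _)).mono_left nhdsWithin_le_nhds
    · filter_upwards [self_mem_nhdsWithin] with s hs
      exact mul_pos hs hσ
  have hy : ∀ᶠ s : ℝ in 𝓝[>] 0, rePart P (T *ᵥ anisoDil e s y) ≤ D * (K * (s * σ) ^ (q + 1)) := by
    filter_upwards [hscale.eventually hKb.bound, self_mem_nhdsWithin] with s hs hs0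
    have hs0 : 0 < s := hs0
    rw [hp, Real.norm_of_nonneg (hP.2.1 _), Real.norm_of_nonneg (by positivity),
      ← anisoDil_anisoDil] at hs
    have h1 := hDle (T *ᵥ anisoDil e s (anisoDil e σ x))
    rw [← Matrix.mulVec_smul, ← anisoDil_smul] at h1
    exact h1.trans (mul_le_mul_of_nonneg_left hs hD.le)
  have hsmall : ∀ᶠ s : ℝ in 𝓝[>] 0, D * (K * (s * σ ^ (q + 1))) < c / (4 * A) := by
    have : Continuous fun s : ℝ => D * (K * (s * σ ^ (q + 1))) := by fun_prop
    exact ((this.tendsto' 0 0 (by simp)).mono_left nhdsWithin_le_nhds).eventually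
      (gt_mem_nhds (by positivity))
  obtain ⟨s, ⟨⟨h1, h2⟩, h3⟩, h4⟩ := (((hlow.and hy).and hsmall).and
    (Ioc_mem_nhdsGT (one_pos : (0 : ℝ) < 1))).exists
  have h5 := hquasi (T *ᵥ anisoDil e s y) (T *ᵥ anisoDil e s (z - y))
  rw [← Matrix.mulVec_add, ← anisoDil_add, add_sub_cancel] at h5
  have h6 := hup (anisoDil e s (z - y)) ((norm_anisoDil_le e h4.1.le h4.2 _).trans_lt hσ2)
  rw [gauge_anisoDil hke h4.1.le] at h6
  have hsq : 0 < s ^ q := pow_pos h4.1 q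
  have h7 : A * rePart P (T *ᵥ anisoDil e s (z - y)) ≤ c / 4 * s ^ q := by
    calc A * rePart P (T *ᵥ anisoDil e s (z - y)) ≤ A * (B * (s ^ q * gauge k (z - y))) :=
          mul_le_mul_of_nonneg_left h6 hA.le
      _ ≤ A * (B * (s ^ q * (c / (4 * A * B)))) := by gcongr
      _ = c / 4 * s ^ q := by field_simp
  have h8 : A * rePart P (T *ᵥ anisoDil e s y) ≤ c / 4 * s ^ q := by
    calc A * rePart P (T *ᵥ anisoDil e s y) ≤ A * (D * (K * (s * σ) ^ (q + 1))) :=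
          mul_le_mul_of_nonneg_left h2 hA.le
      _ = A * (D * (K * (s * σ ^ (q + 1)))) * s ^ q := by rw [mul_pow, pow_succ s]; ring
      _ ≤ A * (c / (4 * A)) * s ^ q := by gcongr
      _ = c / 4 * s ^ q := by field_simp
  nlinarith [mul_pos hc hsq]

/-- There are linear coordinates in which `R` is comparable near `0` with `∑ |x_j|^{k_j}`. -/
theorem IsPosHom.exists_adapted (hP : IsPosHom P) :
    ∃ (T : Matrix (Fin d) (Fin d) ℝ) (k : Fin d → ℕ), T.det ≠ 0 ∧ (∀ j, 1 ≤ k j) ∧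
      ∃ δ > 0, ∃ c > 0, ∃ C > 0, ∀ x : Fin d → ℝ, ‖x‖ < δ →
        c * gauge k x ≤ rePart P (T *ᵥ x) ∧ rePart P (T *ᵥ x) ≤ C * gauge k x := by
  obtain ⟨T, k, hdet, hk, hT, hmax⟩ := hP.exists_maximal_orders
  obtain ⟨δ, hδ, B, hB, hup⟩ := hP.exists_rePart_mulVec_le hT
  obtain ⟨A, hA, hquasi⟩ := hP.quasi_triangle
  -- With e_j = q / k_j the gauge is homogeneous of degree q under the anisotropic dilations, so its
  -- unit sphere serves as a compact cross-section.
  set q := ∏ j, k j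
  set e : Fin d → ℕ := fun j => q / k j
  have hq : 1 ≤ q := Finset.one_le_prod' fun j _ => hk j
  have hke : ∀ j, e j * k j = q := fun j => Nat.div_mul_cancel (Finset.dvd_prod_of_mem k (Finset.mem_univ j))
  have he : ∀ j, 1 ≤ e j := fun j => by
    by_contra! h
    have h1 := hke j
    rw [Nat.lt_one_iff.1 h, zero_mul] at h1
    omega
  have hq0 : q ≠ 0 := by omega
  set K : Set (Fin d → ℝ) := {u | gauge k u = 1}
  have hKle : ∀ u ∈ K, ‖u‖ ≤ 1 := fun u hu => by
    refine (pi_norm_le_iff_of_nonneg zero_le_one).2 fun j => ?_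
    have h1 := abs_pow_le_gauge k u j
    rw [show gauge k u = 1 from hu] at h1
    exact (pow_le_one_iff_of_nonneg (abs_nonneg _) (Nat.one_le_iff_ne_zero.1 (hk j))).1 h1
  have hK : IsCompact K := (isCompact_closedBall (0 : Fin d → ℝ) 1).of_isClosed_subset
    (isClosed_eq (continuous_gauge k) continuous_const) fun u hu => by simpa using hKle u hu
  -- The lower bound is so far known curve by curve. The quasi-triangle inequality spreads it from u
  -- to nearby v at the price of a smaller constant, and compactness makes it uniform.
  have hunif : ∃ c > 0, ∃ s₀ > 0, ∀ u ∈ K, ∀ s, 0 < s → s < s₀ →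
      c * s ^ q ≤ rePart P (T *ᵥ anisoDil e s u) := by
    refine hK.induction_on (p := fun S => ∃ c > 0, ∃ s₀ > 0, ∀ u ∈ S, ∀ s, 0 < s → s < s₀ →
      c * s ^ q ≤ rePart P (T *ᵥ anisoDil e s u)) ⟨1, one_pos, 1, one_pos, by simp⟩ ?_ ?_ ?_
    · rintro S S' hS ⟨c, hc, s₀, hs₀, h⟩
      exact ⟨c, hc, s₀, hs₀, fun u hu => h u (hS hu)⟩
    · rintro S S' ⟨c, hc, s₀, hs₀, h⟩ ⟨c', hc', s₀', hs₀', h'⟩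
      refine ⟨min c c', lt_min hc hc', min s₀ s₀', lt_min hs₀ hs₀', fun u hu s h0 h1 => ?_⟩
      have hsq := pow_nonneg h0.le q
      rcases hu with hu | hu
      · exact (mul_le_mul_of_nonneg_right (min_le_left _ _) hsq).trans
          (h u hu s h0 (h1.trans_le (min_le_left _ _)))
      · exact (mul_le_mul_of_nonneg_right (min_le_right _ _) hsq).trans
          (h' u hu s h0 (h1.trans_le (min_le_right _ _)))
    · intro u hu
      have hu0 : u ≠ 0 := by
        rintro rfl
        have : gauge k 0 = 1 := hu
        rw [gauge_zero hk] at this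
        norm_num at this
      obtain ⟨c, hc, hev⟩ := hP.exists_anisoDil_ge hk he hke hT hmax hu0
      obtain ⟨s₀, hs₀, hev⟩ := (nhdsGT_basis (0 : ℝ)).eventually_iff.1 hev
      have hnear : ∀ᶠ v in 𝓝 u, gauge k (u - v) < c / (2 * A * B) ∧ ‖u - v‖ < δ := by
        have h1 : Continuous fun v => gauge k (u - v) := (continuous_gauge k).comp (by fun_prop)
        have h2 : Continuous fun v => ‖u - v‖ := by fun_prop
        exact ((h1.tendsto' u 0 (by rw [sub_self, gauge_zero hk])).eventually
          (gt_mem_nhds (by positivity))).and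
          ((h2.tendsto' u 0 (by rw [sub_self, norm_zero])).eventually (gt_mem_nhds hδ))
      refine ⟨_, mem_nhdsWithin_of_mem_nhds hnear, c / (2 * A), by positivity, min s₀ 1,
        lt_min hs₀ one_pos, fun v hv s h0 h1 => ?_⟩
      have h2 := hev ⟨h0, h1.trans_le (min_le_left _ _)⟩
      have hs1 : s ≤ 1 := (h1.trans_le (min_le_right _ _)).le
      have h5 := hquasi (T *ᵥ anisoDil e s v) (T *ᵥ anisoDil e s (u - v))
      rw [← Matrix.mulVec_add, ← anisoDil_add, add_sub_cancel] at h5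
      have h6 := hup (anisoDil e s (u - v)) ((norm_anisoDil_le e h0.le hs1 _).trans_lt hv.2)
      rw [gauge_anisoDil hke h0.le] at h6
      have hsq : 0 < s ^ q := pow_pos h0 q
      have h7 : A * rePart P (T *ᵥ anisoDil e s (u - v)) ≤ c / 2 * s ^ q := by
        calc A * rePart P (T *ᵥ anisoDil e s (u - v)) ≤ A * (B * (s ^ q * gauge k (u - v))) :=
              mul_le_mul_of_nonneg_left h6 hA.le
          _ ≤ A * (B * (s ^ q * (c / (2 * A * B)))) := by
              gcongr
              exact hv.1.le
          _ = c / 2 * s ^ q := by field_simp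
      rw [div_mul_eq_mul_div, div_le_iff₀ (by positivity)]
      nlinarith
  obtain ⟨c, hc, s₀, hs₀, hlow⟩ := hunif
  have hnear : ∀ᶠ x in 𝓝 (0 : Fin d → ℝ), gauge k x < s₀ ^ q :=
    ((continuous_gauge k).tendsto' 0 0 (gauge_zero hk)).eventually (gt_mem_nhds (pow_pos hs₀ q))
  obtain ⟨δ', hδ', hnear⟩ := Metric.eventually_nhds_iff.1 hnear
  refine ⟨T, k, hdet, hk, min δ δ', lt_min hδ hδ', c, hc, B, hB, fun x hx =>
    ⟨?_, hup x (hx.trans_le (min_le_left _ _))⟩⟩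
  rcases eq_or_lt_of_le (gauge_nonneg k x) with h0 | h0
  · rw [← h0, mul_zero]; exact hP.2.1 _
  -- This s puts D_{1/s} x on the gauge sphere, where D denotes `anisoDil`.
  set s := (gauge k x) ^ ((q : ℝ)⁻¹)
  have hs0 : 0 < s := Real.rpow_pos_of_pos h0 _
  have hsq : s ^ q = gauge k x := Real.rpow_inv_natCast_pow h0.le hq0
  have hu : anisoDil e s⁻¹ x ∈ K := by
    show gauge k _ = 1
    rw [gauge_anisoDil hke (inv_nonneg.2 hs0.le), inv_pow, hsq, inv_mul_cancel₀ h0.ne']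
  have hss : s < s₀ := by
    refine lt_of_pow_lt_pow_left₀ q hs₀.le ?_
    rw [hsq]
    exact hnear (by simpa using hx.trans_le (min_le_right _ _))
  have := hlow _ hu s hs0 hss
  rw [anisoDil_anisoDil, mul_inv_cancel₀ hs0.ne', hsq] at this
  convert this using 4
  ext j; simp [anisoDil]

end AdaptedCoordinates

/-! ### Order of vanishing of a holomorphic function along anisotropic curves. -/

section Order

variable {d : ℕ}

/-- The complexified anisotropic dilation. -/
def cAnisoDil (e : Fin d → ℕ) (s : ℂ) (z : Fin d → ℂ) : Fin d → ℂ := fun j => s ^ e j * z j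

lemma cAnisoDil_mem_ball (e : Fin d → ℕ) {s : ℂ} (hs : s ∈ Metric.ball (0 : ℂ) 1) {ρ : ℝ}
    {z : Fin d → ℂ} (hz : z ∈ Metric.ball 0 ρ) : cAnisoDil e s z ∈ Metric.ball 0 ρ := by
  rw [mem_ball_zero_iff] at *
  refine lt_of_le_of_lt ((pi_norm_le_iff_of_nonneg (norm_nonneg _)).2 fun j => ?_) hz
  rw [cAnisoDil, norm_mul, norm_pow]
  exact (mul_le_of_le_one_left (norm_nonneg _) (pow_le_one₀ (norm_nonneg _) hs.le)).trans
    (norm_le_pi_norm z j)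

lemma cAnisoDil_toComplex (e : Fin d → ℕ) (s : ℝ) (x : Fin d → ℝ) :
    cAnisoDil e s (toComplex x) = toComplex (anisoDil e s x) := by
  ext j; simp [cAnisoDil, toComplex, anisoDil]

/-- `V` vanishes at `0` to order `m` along all anisotropic curves `s ↦ (s^{e_j} w_j)_j`. -/
def VanishesAlong (V : (Fin d → ℂ) → ℂ) (e : Fin d → ℕ) (ρ B : ℝ) (m : ℕ) : Prop :=
  ∀ w ∈ Metric.ball (0 : Fin d → ℂ) ρ, ∃ h : ℂ → ℂ, DifferentiableOn ℂ h (Metric.ball 0 1) ∧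
    ∀ s ∈ Metric.ball (0 : ℂ) 1, V (cAnisoDil e s w) = s ^ m * h s ∧ ‖h s‖ ≤ B

variable {V : (Fin d → ℂ) → ℂ} {e : Fin d → ℕ} {ρ B : ℝ}

lemma vanishesAlong_zero (hV : DifferentiableOn ℂ V (Metric.ball 0 ρ))
    (hB : ∀ z ∈ Metric.ball (0 : Fin d → ℂ) ρ, ‖V z‖ ≤ B) : VanishesAlong V e ρ B 0 := by
  intro w hw
  refine ⟨fun s => V (cAnisoDil e s w), ?_, fun s hs => ⟨by simp, hB _ (cAnisoDil_mem_ball e hs hw)⟩⟩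
  refine hV.comp (f := fun s => cAnisoDil e s w) ?_ fun s hs => cAnisoDil_mem_ball e hs hw
  unfold cAnisoDil
  fun_prop

/-- For s < 1 close to 1 the point D_{1/s} w is still in the ball, so |V(w)| ≤ s^m B for every
admissible m; as s^m → 0 this bounds m. -/
lemma vanishesAlong_bddAbove {w : Fin d → ℂ} (hw : w ∈ Metric.ball 0 ρ)
    (hVw : V w ≠ 0) : BddAbove {m | VanishesAlong V e ρ B m} := by
  have hcont : ContinuousAt (fun s : ℝ => cAnisoDil e ((s : ℂ)⁻¹) w) 1 := by
    unfold cAnisoDil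
    refine continuousAt_pi.2 fun j => ?_
    have : ContinuousAt (fun s : ℝ => (s : ℂ)⁻¹) 1 :=
      Complex.continuous_ofReal.continuousAt.inv₀ (by simp)
    exact (this.pow _).mul continuousAt_const
  have h1 : cAnisoDil e (((1 : ℝ) : ℂ)⁻¹) w = w := by ext j; simp [cAnisoDil]
  have h2 : ∀ᶠ s : ℝ in 𝓝[<] (1 : ℝ), cAnisoDil e ((s : ℂ)⁻¹) w ∈ Metric.ball 0 ρ :=
    (hcont.mono_left nhdsWithin_le_nhds).eventually
      (Metric.isOpen_ball.mem_nhds (by beta_reduce; rwa [h1]))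
  obtain ⟨s, hs, hs0, hs1⟩ := (h2.and (Ioo_mem_nhdsLT (one_pos : (0 : ℝ) < 1))).exists
  have hlim : Tendsto (fun m : ℕ => s ^ m * B) atTop (𝓝 0) := by
    simpa using (tendsto_pow_atTop_nhds_zero_of_lt_one hs0.le hs1).mul_const B
  obtain ⟨m₀, hm₀⟩ := (hlim.eventually (gt_mem_nhds (norm_pos_iff.2 hVw))).exists_forall_of_atTop
  refine ⟨m₀, fun m hm => ?_⟩
  by_contra! hlt
  obtain ⟨h, -, hh⟩ := hm _ hs
  obtain ⟨h3, h4⟩ := hh (s : ℂ) (by simpa [abs_of_pos hs0] using hs1)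
  have h5 : cAnisoDil e s (cAnisoDil e ((s : ℂ)⁻¹) w) = w := by
    ext j
    have : (s : ℂ) ≠ 0 := by exact_mod_cast hs0.ne'
    simp [cAnisoDil, this]
  rw [h5] at h3
  have h6 := hm₀ m hlt.le
  rw [h3, norm_mul, norm_pow, Complex.norm_real, Real.norm_of_nonneg hs0.le] at h6
  exact absurd h6 (not_lt.2 (mul_le_mul_of_nonneg_left h4 (pow_nonneg hs0.le _)))

/-- By the Schwarz lemma, dividing h by s when h(0) = 0 does not increase the bound B, so one
constant serves all orders. -/
lemma vanishesAlong_succ {m : ℕ} (hm : VanishesAlong V e ρ B m)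
    (h0 : ∀ w ∈ Metric.ball (0 : Fin d → ℂ) ρ, ∀ h : ℂ → ℂ,
      DifferentiableOn ℂ h (Metric.ball 0 1) →
      (∀ s ∈ Metric.ball (0 : ℂ) 1, V (cAnisoDil e s w) = s ^ m * h s ∧ ‖h s‖ ≤ B) → h 0 = 0) :
    VanishesAlong V e ρ B (m + 1) := by
  intro w hw
  obtain ⟨h, hd, hh⟩ := hm w hw
  have hz := h0 w hw h hd hh
  refine ⟨dslope h 0, (Complex.differentiableOn_dslope (Metric.ball_mem_nhds 0 one_pos)).2 hd,
    fun s hs => ⟨?_, ?_⟩⟩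
  · have := sub_smul_dslope h 0 s
    rw [hz, sub_zero, sub_zero, smul_eq_mul] at this
    rw [(hh s hs).1, ← this]
    ring
  · have := Complex.norm_dslope_le_div_of_mapsTo_ball (R₂ := B) hd (fun s hs => ?_) hs
    · simpa using this
    · rw [hz]
      simpa using (hh s hs).2

lemma toComplex_add_I_smul (w : Fin d → ℂ) :
    toComplex (fun j => (w j).re) + Complex.I • toComplex (fun j => (w j).im) = w := by
  ext j
  simp [toComplex, mul_comm Complex.I]

/-- If the leading coefficient along anisotropic curves does not vanish identically, then it does
not vanish at some real point. -/
lemma exists_real_leading_ne_zero {m : ℕ} (hV : DifferentiableOn ℂ V (Metric.ball 0 ρ))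
    (hm : VanishesAlong V e ρ B m) (hm' : ¬ VanishesAlong V e ρ B (m + 1)) :
    ∃ ξ : Fin d → ℝ, ‖ξ‖ < ρ ∧ ∃ h : ℂ → ℂ, DifferentiableOn ℂ h (Metric.ball 0 1) ∧
      (∀ s ∈ Metric.ball (0 : ℂ) 1, V (cAnisoDil e s (toComplex ξ)) = s ^ m * h s) ∧ h 0 ≠ 0 := by
  classical
  by_contra! hcon
  refine hm' (vanishesAlong_succ hm fun w hw h hd hh => ?_)
  set ξ : Fin d → ℝ := fun j => (w j).re
  set η : Fin d → ℝ := fun j => (w j).im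
  -- A complex line that is real for real u and passes through w at u = i. The leading coefficient
  -- along it is holomorphic and vanishes at real u, hence also at u = i.
  set p : ℂ → Fin d → ℂ := fun u => toComplex ξ + u • toComplex η
  have hp : Differentiable ℂ p := by fun_prop
  set U : Set ℂ := p ⁻¹' Metric.ball 0 ρ
  have hUo : IsOpen U := Metric.isOpen_ball.preimage hp.continuous
  have hUc : Convex ℝ U := by
    have h1 : Convex ℝ (Metric.ball (0 : Fin d → ℂ) ρ) := convex_ball _ _
    intro x hx y hy a b ha hb hab
    have : p (a • x + b • y) = a • p x + b • p y := by
      ext j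
      simp only [p, Pi.add_apply, Pi.smul_apply, smul_eq_mul, Complex.real_smul]
      have : (a : ℂ) + b = 1 := by exact_mod_cast hab
      linear_combination (- toComplex ξ j) * this
    show p _ ∈ Metric.ball 0 ρ
    rw [this]
    exact h1 hx hy ha hb hab
  have hpI : p Complex.I = w := toComplex_add_I_smul w
  have hIU : Complex.I ∈ U := by show p _ ∈ Metric.ball 0 ρ; rwa [hpI]
  have h0U : (0 : ℂ) ∈ U := by
    show p 0 ∈ Metric.ball 0 ρ
    rw [mem_ball_zero_iff] at hw ⊢
    refine lt_of_le_of_lt ((pi_norm_le_iff_of_nonneg (norm_nonneg _)).2 fun j => ?_) hw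
    simp only [p, zero_smul, add_zero, toComplex, Complex.norm_real, Real.norm_eq_abs]
    exact (Complex.abs_re_le_norm (w j)).trans (norm_le_pi_norm w j)
  choose! H hHd hHH using hm
  have hdist : ∀ w ∈ Metric.ball (0 : Fin d → ℂ) ρ, ∀ s ∈ Metric.ball (0 : ℂ) 1,
      dist (H w s) (H w 0) ≤ 2 * B * ‖s‖ := by
    intro w hw s hs
    have := Complex.dist_le_div_mul_dist_of_mapsTo_ball (R₂ := 2 * B) (hHd w hw) (fun s hs => ?_) hs
    · simpa using this
    · rw [Metric.mem_closedBall]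
      refine (dist_le_norm_add_norm _ _).trans ?_
      linarith [(hHH w hw s hs).2, (hHH w hw 0 (Metric.mem_ball_self one_pos)).2]
  -- The shift by 2 keeps every t_n strictly inside the unit disc, n = 0 included.
  set t : ℕ → ℂ := fun n => ((1 / ((n : ℝ) + 2) : ℝ) : ℂ)
  have htn : ∀ n, ‖t n‖ = 1 / ((n : ℝ) + 2) := fun n => by
    simp only [t]; rw [Complex.norm_real, Real.norm_of_nonneg (by positivity)]
  have ht1 : ∀ n, t n ∈ Metric.ball (0 : ℂ) 1 := fun n => by
    rw [mem_ball_zero_iff, htn, div_lt_one (by positivity)]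
    have : (0 : ℝ) ≤ n := n.cast_nonneg
    linarith
  have ht0 : ∀ n, t n ≠ 0 := fun n => by
    rw [← norm_pos_iff, htn]; positivity
  have htlim : Tendsto (fun n => 2 * B * ‖t n‖) atTop (𝓝 0) := by
    simp only [htn]
    have h1 : Tendsto (fun n : ℕ => (n : ℝ) + 2) atTop atTop :=
      tendsto_atTop_add_const_right _ _ tendsto_natCast_atTop_atTop
    simpa using (tendsto_const_nhds.div_atTop h1 : Tendsto (fun n : ℕ => (1 : ℝ) / ((n : ℝ) + 2)) _ _).const_mul (2 * B)
  -- The quotients H were chosen point by point, with no regularity in the base point. Holomorphy of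
  -- the leading coefficient comes from its being the uniform limit of t_n^{-m} V(D_{t_n} p(u)).
  have hdiff : DifferentiableOn ℂ (fun u => H (p u) 0) U := by
    refine TendstoLocallyUniformlyOn.differentiableOn (φ := atTop)
      (F := fun n u => (t n ^ m)⁻¹ * V (cAnisoDil e (t n) (p u))) ?_ (Eventually.of_forall fun n => ?_) hUo
    · refine TendstoUniformlyOn.tendstoLocallyUniformlyOn ?_
      rw [Metric.tendstoUniformlyOn_iff]
      intro ε hε
      filter_upwards [htlim.eventually (gt_mem_nhds hε)] with n hn u hu
      rw [(hHH (p u) hu (t n) (ht1 n)).1, inv_mul_cancel_left₀ (pow_ne_zero _ (ht0 n)), dist_comm]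
      exact (hdist _ hu _ (ht1 n)).trans_lt hn
    · refine DifferentiableOn.const_mul ?_ _
      refine hV.comp (f := fun u => cAnisoDil e (t n) (p u)) ?_ fun u hu => cAnisoDil_mem_ball e (ht1 n) hu
      have : Differentiable ℂ fun u => cAnisoDil e (t n) (p u) := by
        unfold cAnisoDil
        exact differentiable_pi.2 fun j => ((differentiable_apply j).comp hp).const_mul _
      exact this.differentiableOn
  have hreal : ∀ u : ℝ, (u : ℂ) ∈ U → H (p u) 0 = 0 := by
    intro u hu
    have hpu : p u = toComplex (ξ + u • η) := by ext j; simp [p, toComplex]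
    have hu' : p u ∈ Metric.ball 0 ρ := hu
    refine hcon (ξ + u • η) ?_ (H (p u)) (hHd _ hu') fun s hs => ?_
    · rw [hpu, mem_ball_zero_iff] at hu'
      refine lt_of_le_of_lt ((pi_norm_le_iff_of_nonneg (norm_nonneg _)).2 fun j => ?_) hu'
      have := norm_le_pi_norm (toComplex (ξ + u • η)) j
      rwa [toComplex, Complex.norm_real] at this
    · rw [← hpu]
      exact (hHH _ hu' s hs).1
  have hzero : Set.EqOn (fun u => H (p u) 0) 0 U := by
    refine (hdiff.analyticOnNhd hUo).eqOn_zero_of_preconnected_of_frequently_eq_zero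
      hUc.isPreconnected h0U ?_
    have ht : Tendsto (fun x : ℝ => (x : ℂ)) (𝓝[≠] 0) (𝓝[≠] 0) := by
      refine tendsto_nhdsWithin_iff.2 ⟨?_, ?_⟩
      · exact (Complex.continuous_ofReal.tendsto' 0 0 (by simp)).mono_left nhdsWithin_le_nhds
      · filter_upwards [self_mem_nhdsWithin] with x hx
        simpa using hx
    refine ht.frequently (Eventually.frequently ?_)
    have : ∀ᶠ x : ℝ in 𝓝 0, (x : ℂ) ∈ U :=
      (Complex.continuous_ofReal.tendsto' 0 0 (by simp)).eventually (hUo.mem_nhds h0U)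
    filter_upwards [this.filter_mono nhdsWithin_le_nhds] with x hx using hreal x hx
  have hfin : H w 0 = 0 := by
    have := hzero hIU
    rw [← hpI]
    exact this
  -- the quotient is unique
  have hball : Metric.ball (0 : ℂ) 1 ∈ 𝓝 0 := Metric.ball_mem_nhds 0 one_pos
  have hcont : Tendsto h (𝓝[≠] 0) (𝓝 (h 0)) :=
    ((hd.differentiableAt hball).continuousAt.tendsto).mono_left nhdsWithin_le_nhds
  have hcont' : Tendsto (H w) (𝓝[≠] 0) (𝓝 (H w 0)) :=
    (((hHd w hw).differentiableAt hball).continuousAt.tendsto).mono_left nhdsWithin_le_nhds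
  refine Eq.trans ?_ hfin
  refine tendsto_nhds_unique hcont (hcont'.congr' ?_)
  filter_upwards [mem_nhdsWithin_of_mem_nhds hball, self_mem_nhdsWithin] with s hs hs0
  have h1 := (hh s hs).1
  rw [(hHH w hw s hs).1] at h1
  exact mul_left_cancel₀ (pow_ne_zero m (by simpa using hs0)) h1

/-- The exact order of vanishing at `0` of a holomorphic function along anisotropic curves. -/
theorem exists_order (hV : DifferentiableOn ℂ V (Metric.ball 0 ρ))
    (hB : ∀ z ∈ Metric.ball (0 : Fin d → ℂ) ρ, ‖V z‖ ≤ B)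
    (hne : ∃ w ∈ Metric.ball (0 : Fin d → ℂ) ρ, V w ≠ 0) :
    ∃ m : ℕ, (∀ w ∈ Metric.ball (0 : Fin d → ℂ) ρ, ∀ s ∈ Metric.ball (0 : ℂ) 1,
      ‖V (cAnisoDil e s w)‖ ≤ B * ‖s‖ ^ m) ∧
      ∃ ξ : Fin d → ℝ, ‖ξ‖ < ρ ∧ ∃ c > 0, ∀ᶠ s : ℝ in 𝓝[>] 0,
        c * s ^ m ≤ ‖V (toComplex (anisoDil e s ξ))‖ := by
  obtain ⟨w, hw, hVw⟩ := hne
  have hbdd := vanishesAlong_bddAbove (e := e) (B := B) hw hVw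
  have hmem := Nat.sSup_mem ⟨0, vanishesAlong_zero (e := e) hV hB⟩ hbdd
  set m := sSup {m | VanishesAlong V e ρ B m}
  have hm : VanishesAlong V e ρ B m := hmem
  have hm' : ¬ VanishesAlong V e ρ B (m + 1) := fun h => by
    have := le_csSup hbdd h
    omega
  refine ⟨m, fun w hw s hs => ?_, ?_⟩
  · obtain ⟨h, -, hh⟩ := hm w hw
    rw [(hh s hs).1, norm_mul, norm_pow, mul_comm]
    exact mul_le_mul_of_nonneg_right (hh s hs).2 (by positivity)
  · obtain ⟨ξ, hξ, h, hd, hh, h0⟩ := exists_real_leading_ne_zero hV hm hm'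
    refine ⟨ξ, hξ, ‖h 0‖ / 2, by positivity, ?_⟩
    have hball : Metric.ball (0 : ℂ) 1 ∈ 𝓝 0 := Metric.ball_mem_nhds 0 one_pos
    have hof : Tendsto (fun s : ℝ => (s : ℂ)) (𝓝[>] 0) (𝓝 0) :=
      (Complex.continuous_ofReal.tendsto' 0 0 (by simp)).mono_left nhdsWithin_le_nhds
    have hlim := ((hd.differentiableAt hball).continuousAt.tendsto.comp hof).norm
    filter_upwards [hlim.eventually (lt_mem_nhds (show ‖h 0‖ / 2 < ‖h 0‖ by
      linarith [norm_pos_iff.2 h0])), hof.eventually hball, self_mem_nhdsWithin] with s h1 h2 h3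
    have h3 : 0 < s := h3
    rw [← cAnisoDil_toComplex, hh _ h2, norm_mul, norm_pow, Complex.norm_real,
      Real.norm_of_nonneg h3.le, mul_comm]
    exact mul_le_mul_of_nonneg_left h1.le (pow_nonneg h3.le _)

end Order

/-! ### The exponent 1 + λ as a quotient of orders. -/

section Order

variable {d : ℕ} {P : MvPolynomial (Fin d) ℂ}

lemma map_mulVec_cpt (T : Matrix (Fin d) (Fin d) ℝ) (x y : Fin d → ℝ) :
    T.map Complex.ofReal *ᵥ cpt x y = cpt (T *ᵥ x) (T *ᵥ y) := by
  ext i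
  simp only [Matrix.mulVec, dotProduct, Matrix.map_apply, cpt, Complex.ofReal_sum,
    Complex.ofReal_mul, Finset.mul_sum, ← Finset.sum_sub_distrib]
  exact Finset.sum_congr rfl fun j _ => by ring

lemma map_mulVec_toComplex (T : Matrix (Fin d) (Fin d) ℝ) (x : Fin d → ℝ) :
    T.map Complex.ofReal *ᵥ toComplex x = toComplex (T *ᵥ x) := by
  have := map_mulVec_cpt T x 0
  rwa [Matrix.mulVec_zero, cpt_zero_right, cpt_zero_right] at this

lemma abs_le_gauge_rpow {k e : Fin d → ℕ} {q : ℕ} (hk : ∀ j, 1 ≤ k j) (hq : q ≠ 0)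
    (hke : ∀ j, e j * k j = q) {x : Fin d → ℝ} {N : ℝ} (hN : gauge k x ≤ N) (j : Fin d) :
    |x j| ≤ (N ^ ((q : ℝ)⁻¹)) ^ e j := by
  have hN0 : 0 ≤ N := (gauge_nonneg k x).trans hN
  refine le_of_pow_le_pow_left₀ (Nat.one_le_iff_ne_zero.1 (hk j))
    (pow_nonneg (Real.rpow_nonneg hN0 _) _) ?_
  rw [← pow_mul, hke, Real.rpow_inv_natCast_pow hN0 hq]
  exact (abs_pow_le_gauge k x j).trans hN

/-- The anisotropic bound in adapted coordinates. -/
lemma norm_le_gauge_rpow {V : (Fin d → ℂ) → ℂ} {k e : Fin d → ℕ} {q m : ℕ} {ρ B : ℝ} (hρ : 0 < ρ)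
    (hB0 : 0 < B) (hk : ∀ j, 1 ≤ k j) (he : ∀ j, 1 ≤ e j) (hq : q ≠ 0) (hke : ∀ j, e j * k j = q)
    (hV : ∀ w ∈ Metric.ball (0 : Fin d → ℂ) ρ, ∀ s ∈ Metric.ball (0 : ℂ) 1,
      ‖V (cAnisoDil e s w)‖ ≤ B * ‖s‖ ^ m) :
    ∃ C > 0, ∃ N₀ > 0, ∀ x y : Fin d → ℝ, gauge k x + gauge k y < N₀ →
      ‖V (cpt x y)‖ ≤ C * (gauge k x + gauge k y) ^ ((m : ℝ) / q) := by
  -- A point of gauge at most N = τ^q is D_s w with s = aτ and |w_j| ≤ 2a^{-e_j} ≤ 2/a < ρ; this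
  -- fixes a.
  set a : ℝ := max 1 (4 / ρ)
  have ha1 : 1 ≤ a := le_max_left _ _
  have ha0 : 0 < a := by linarith
  have haρ : 2 / a < ρ := by
    have h1 : 4 / ρ ≤ a := le_max_right _ _
    rw [div_le_iff₀ hρ] at h1
    rw [div_lt_iff₀ ha0]
    linarith
  refine ⟨B * a ^ m, by positivity, (1 / a) ^ q, by positivity, fun x y hN => ?_⟩
  set N := gauge k x + gauge k y
  have hx : gauge k x ≤ N := le_add_of_nonneg_right (gauge_nonneg k y)
  have hy : gauge k y ≤ N := le_add_of_nonneg_left (gauge_nonneg k x)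
  have hN0 : 0 ≤ N := (gauge_nonneg k x).trans hx
  set τ := N ^ ((q : ℝ)⁻¹)
  have hτ0 : 0 ≤ τ := Real.rpow_nonneg hN0 _
  have hτq : τ ^ q = N := Real.rpow_inv_natCast_pow hN0 hq
  have hτm : τ ^ m = N ^ ((m : ℝ) / q) := by
    rw [← Real.rpow_natCast, ← Real.rpow_mul hN0]
    congr 1; ring
  have hτ1 : a * τ < 1 := by
    have : τ < 1 / a := lt_of_pow_lt_pow_left₀ q (by positivity) (by rwa [hτq])
    rwa [lt_div_iff₀ ha0, mul_comm] at this
  set s : ℂ := ((a * τ : ℝ) : ℂ)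
  have hs : ‖s‖ = a * τ := by
    rw [Complex.norm_real, Real.norm_of_nonneg (by positivity)]
  have hcomp : ∀ j, ‖cpt x y j‖ ≤ 2 * τ ^ e j := fun j => by
    calc ‖cpt x y j‖ ≤ |x j| + |y j| := by
          refine (norm_sub_le _ _).trans ?_
          simp [Complex.norm_real]
      _ ≤ 2 * τ ^ e j := by
          linarith [abs_le_gauge_rpow hk hq hke hx j, abs_le_gauge_rpow hk hq hke hy j]
  obtain ⟨w, hw, hsw⟩ : ∃ w ∈ Metric.ball (0 : Fin d → ℂ) ρ, cAnisoDil e s w = cpt x y := by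
    rcases eq_or_lt_of_le hτ0 with h0 | h0
    · refine ⟨0, Metric.mem_ball_self hρ, ?_⟩
      ext j
      have := hcomp j
      rw [← h0, zero_pow (Nat.one_le_iff_ne_zero.1 (he j)), mul_zero] at this
      rw [norm_le_zero_iff.1 this]
      simp [cAnisoDil]
    · have hs0 : s ≠ 0 := by
        rw [← norm_pos_iff, hs]; positivity
      refine ⟨fun j => (s ^ e j)⁻¹ * cpt x y j, ?_, ?_⟩
      · rw [mem_ball_zero_iff]
        refine lt_of_le_of_lt ((pi_norm_le_iff_of_nonneg (by positivity)).2 fun j => ?_) haρ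
        rw [norm_mul, norm_inv, norm_pow, hs, inv_mul_le_iff₀ (by positivity)]
        refine (hcomp j).trans ?_
        have h2 : a ≤ a ^ e j := le_self_pow₀ ha1 (Nat.one_le_iff_ne_zero.1 (he j))
        rw [mul_pow]
        calc 2 * τ ^ e j = a * τ ^ e j * (2 / a) := by field_simp
          _ ≤ a ^ e j * τ ^ e j * (2 / a) := by gcongr
      · ext j
        simp [cAnisoDil, hs0]
  have h1 := hV w hw s (by rw [mem_ball_zero_iff, hs]; exact hτ1)
  rw [hsw, hs, mul_pow, hτm] at h1
  linarith

/-- The order of a holomorphic function that is small compared to `R` on the real points: it is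
bounded by a power `R^{1+λ}`, also on complex points, and this power is sharp on real points. -/
theorem IsPosHom.exists_order (hP : IsPosHom P) {W : (Fin d → ℂ) → ℂ} {r : ℝ} (hr : 0 < r)
    (hW : DifferentiableOn ℂ W (Metric.ball 0 r))
    (hne : ∀ r' > 0, ∃ z ∈ Metric.ball (0 : Fin d → ℂ) r', W z ≠ 0)
    (ho : (fun ξ => W (toComplex ξ)) =o[𝓝 0] rePart P) :
    ∃ lam : ℝ, 0 < lam ∧ (∃ C > 0, ∃ r' > 0, ∀ ξ η : Fin d → ℝ, ‖ξ‖ < r' → ‖η‖ < r' →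
        ‖W (cpt ξ η)‖ ≤ C * (rePart P ξ + rePart P η) ^ (1 + lam)) ∧
      ∃ c > 0, ∀ᶠ t : ℝ in 𝓝[>] 0, ∃ ξ, rePart P ξ ≤ t ∧ c * t ^ (1 + lam) ≤ ‖W (toComplex ξ)‖ := by
  obtain ⟨T, k, hdet, hk, δ, hδ, c, hc, C, hC, hTk⟩ := hP.exists_adapted
  set q := ∏ j, k j
  set e : Fin d → ℕ := fun j => q / k j
  have hq1 : 1 ≤ q := Finset.one_le_prod' fun j _ => hk j
  have hke : ∀ j, e j * k j = q := fun j => Nat.div_mul_cancel (Finset.dvd_prod_of_mem k (Finset.mem_univ j))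
  have he : ∀ j, 1 ≤ e j := fun j => by
    by_contra! h
    have h1 := hke j
    rw [Nat.lt_one_iff.1 h, zero_mul] at h1
    omega
  have hq : q ≠ 0 := by omega
  have hq0 : (0 : ℝ) < q := by exact_mod_cast hq1
  set Tc : Matrix (Fin d) (Fin d) ℂ := T.map Complex.ofReal
  have hTc : Continuous fun z : Fin d → ℂ => Tc *ᵥ z := continuous_const.matrix_mulVec continuous_id
  have hTcd : Differentiable ℂ fun z : Fin d → ℂ => Tc *ᵥ z :=
    (LinearMap.toContinuousLinearMap (Matrix.mulVecLin Tc)).differentiable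
  -- a ball on which everything is bounded
  have hcW : ContinuousAt W 0 := (hW.differentiableAt (Metric.ball_mem_nhds 0 hr)).continuousAt
  have hev : ∀ᶠ z in 𝓝 (0 : Fin d → ℂ), ‖W (Tc *ᵥ z)‖ ≤ ‖W 0‖ + 1 ∧ Tc *ᵥ z ∈ Metric.ball 0 r := by
    have h0 : Tendsto (fun z : Fin d → ℂ => Tc *ᵥ z) (𝓝 0) (𝓝 0) := hTc.tendsto' 0 0 (by simp)
    refine (h0.eventually (p := fun z => ‖W z‖ ≤ ‖W 0‖ + 1) ?_).and
      (h0.eventually (p := fun z => z ∈ Metric.ball 0 r) (Metric.ball_mem_nhds 0 hr))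
    filter_upwards [hcW.norm.eventually (gt_mem_nhds (lt_add_one ‖W 0‖))] with z hz using le_of_lt hz
  obtain ⟨ρ, hρ, hρev⟩ := Metric.eventually_nhds_iff_ball.1 hev
  set V : (Fin d → ℂ) → ℂ := fun z => W (Tc *ᵥ z)
  have hV : DifferentiableOn ℂ V (Metric.ball 0 ρ) :=
    hW.comp hTcd.differentiableOn fun z hz => (hρev z hz).2
  have hinv : ∀ ξ : Fin d → ℝ, T *ᵥ T⁻¹ *ᵥ ξ = ξ := fun ξ => by
    rw [Matrix.mulVec_mulVec, Matrix.mul_nonsing_inv _ (isUnit_iff_ne_zero.2 hdet), Matrix.one_mulVec]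
  have hVne : ∃ w ∈ Metric.ball (0 : Fin d → ℂ) ρ, V w ≠ 0 := by
    have hdetc : Tc.det ≠ 0 := by
      have : Tc.det = ((T.det : ℝ) : ℂ) := (RingHom.map_det Complex.ofRealHom T).symm
      rw [this]
      exact_mod_cast hdet
    have hcont : Continuous fun z : Fin d → ℂ => Tc⁻¹ *ᵥ z :=
      continuous_const.matrix_mulVec continuous_id
    obtain ⟨r', hr', h'⟩ := Metric.eventually_nhds_iff_ball.1
      ((hcont.tendsto' 0 0 (by simp)).eventually (Metric.ball_mem_nhds 0 hρ))
    obtain ⟨z, hz, hWz⟩ := hne r' hr'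
    refine ⟨Tc⁻¹ *ᵥ z, h' z hz, ?_⟩
    show W (Tc *ᵥ _) ≠ 0
    rwa [Matrix.mulVec_mulVec, Matrix.mul_nonsing_inv _ (isUnit_iff_ne_zero.2 hdetc),
      Matrix.one_mulVec]
  obtain ⟨m, hup, ξ₀, hξ₀, b, hb, hlow⟩ := ConvPow.exists_order (e := e) hV (fun z hz => (hρev z hz).1) hVne
  have hVr : ∀ x : Fin d → ℝ, V (toComplex x) = W (toComplex (T *ᵥ x)) := fun x => by
    show W (Tc *ᵥ _) = _
    rw [map_mulVec_toComplex]
  -- `s ↦ D_s ξ₀` tends to `0`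
  have hDlim : Tendsto (fun s : ℝ => anisoDil e s ξ₀) (𝓝[>] 0) (𝓝 0) := by
    have : Continuous fun s : ℝ => anisoDil e s ξ₀ := by unfold anisoDil; fun_prop
    refine (this.tendsto' 0 0 ?_).mono_left nhdsWithin_le_nhds
    ext j
    simp [anisoDil, Nat.one_le_iff_ne_zero.1 (he j)]
  have hRup : ∀ᶠ s : ℝ in 𝓝[>] 0, rePart P (T *ᵥ anisoDil e s ξ₀) ≤ C * (s ^ q * gauge k ξ₀) := by
    have h1 := hDlim.norm
    rw [norm_zero] at h1
    filter_upwards [h1.eventually (gt_mem_nhds hδ), self_mem_nhdsWithin] with s hs hs0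
    have := (hTk _ hs).2
    rwa [gauge_anisoDil hke (le_of_lt (Set.mem_Ioi.1 hs0))] at this
  have hg0 := gauge_nonneg k ξ₀
  -- Along the sharp real curve W has size at least b s^m, while R is at most a constant times s^q.
  -- If m ≤ q this contradicts W = o(R).
  have hqm : q < m := by
    by_contra! hmq
    have hTlim : Tendsto (fun s : ℝ => T *ᵥ anisoDil e s ξ₀) (𝓝[>] 0) (𝓝 0) := by
      have h1 : Continuous fun x : Fin d → ℝ => T *ᵥ x := continuous_const.matrix_mulVec continuous_id
      exact (h1.tendsto' 0 0 (by simp)).comp hDlim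
    have h1 := hTlim.eventually (ho.def (c := b / (2 * (C * (gauge k ξ₀ + 1)))) (by positivity))
    obtain ⟨s, ⟨⟨h2, h3⟩, h4⟩, h5⟩ := (((h1.and hlow).and hRup).and
      (Ioc_mem_nhdsGT (one_pos : (0 : ℝ) < 1))).exists
    rw [hVr] at h3
    rw [Real.norm_of_nonneg (hP.2.1 _)] at h2
    have hsq := pow_pos h5.1 q
    have h6 : s ^ q ≤ s ^ m := pow_le_pow_of_le_one h5.1.le h5.2 hmq
    have h7 : b / (2 * (C * (gauge k ξ₀ + 1))) * rePart P (T *ᵥ anisoDil e s ξ₀) ≤ b / 2 * s ^ q := by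
      calc _ ≤ b / (2 * (C * (gauge k ξ₀ + 1))) * (C * (s ^ q * (gauge k ξ₀ + 1))) := by
            gcongr
            exact h4.trans (by gcongr; linarith)
        _ = b / 2 * s ^ q := by field_simp
    nlinarith [mul_pos hb hsq, mul_le_mul_of_nonneg_left h6 hb.le]
  have hexp : 1 + ((m : ℝ) / q - 1) = m / q := by ring
  have hlam : 0 < (m : ℝ) / q - 1 := by
    rw [sub_pos, one_lt_div hq0]
    exact_mod_cast hqm
  -- W has weighted order m and R weighted order q, so W compares with R^{m/q}.
  refine ⟨(m : ℝ) / q - 1, hlam, ?_, ?_⟩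
  · obtain ⟨A, hA, N₀, hN₀, hVg⟩ := norm_le_gauge_rpow hρ (by positivity) hk he hq hke hup
    have hcont : Continuous fun ξ : Fin d → ℝ => T⁻¹ *ᵥ ξ := continuous_const.matrix_mulVec continuous_id
    have hev1 : ∀ᶠ ξ in 𝓝 (0 : Fin d → ℝ), ‖T⁻¹ *ᵥ ξ‖ < δ ∧ gauge k (T⁻¹ *ᵥ ξ) < N₀ / 2 := by
      refine ((hcont.norm.tendsto' 0 0 (by simp)).eventually (gt_mem_nhds hδ)).and
        ((((continuous_gauge k).comp hcont).tendsto' 0 0 ?_).eventually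
          (gt_mem_nhds (by positivity)))
      simp [gauge_zero hk]
    obtain ⟨r', hr', h'⟩ := Metric.eventually_nhds_iff.1 hev1
    refine ⟨A * (1 / c) ^ ((m : ℝ) / q), by positivity, r', hr', fun ξ η hξ hη => ?_⟩
    obtain ⟨h1, h2⟩ := h' (y := ξ) (by simpa using hξ)
    obtain ⟨h3, h4⟩ := h' (y := η) (by simpa using hη)
    have h5 := hVg (T⁻¹ *ᵥ ξ) (T⁻¹ *ᵥ η) (by linarith)
    have h6 : V (cpt (T⁻¹ *ᵥ ξ) (T⁻¹ *ᵥ η)) = W (cpt ξ η) := by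
      show W (Tc *ᵥ _) = _
      rw [map_mulVec_cpt, hinv, hinv]
    have h7 := (hTk _ h1).1
    have h8 := (hTk _ h3).1
    rw [hinv] at h7 h8
    rw [h6] at h5
    rw [hexp]
    have hR := add_nonneg (hP.2.1 ξ) (hP.2.1 η)
    have hg := add_nonneg (gauge_nonneg k (T⁻¹ *ᵥ ξ)) (gauge_nonneg k (T⁻¹ *ᵥ η))
    calc ‖W (cpt ξ η)‖ ≤ A * (gauge k (T⁻¹ *ᵥ ξ) + gauge k (T⁻¹ *ᵥ η)) ^ ((m : ℝ) / q) := h5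
      _ ≤ A * (1 / c * (rePart P ξ + rePart P η)) ^ ((m : ℝ) / q) := by
          gcongr
          rw [one_div, le_inv_mul_iff₀ hc]
          linarith
      _ = _ := by rw [Real.mul_rpow (by positivity) hR]; ring
  · set A := C * (gauge k ξ₀ + 1)
    have hA : 0 < A := by positivity
    refine ⟨b * (1 / A) ^ ((m : ℝ) / q), by positivity, ?_⟩
    -- With s = (t/A)^{1/q} the point of the sharp curve satisfies R ≤ t, and s^m is a constant
    -- times t^{m/q}.
    have hlim : Tendsto (fun t : ℝ => (1 / A * t) ^ ((q : ℝ)⁻¹)) (𝓝[>] 0) (𝓝[>] 0) := by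
      refine tendsto_nhdsWithin_iff.2 ⟨?_, ?_⟩
      · have : Continuous fun t : ℝ => (1 / A * t) ^ ((q : ℝ)⁻¹) :=
          (continuous_const.mul continuous_id).rpow_const fun _ => Or.inr (by positivity)
        exact (this.tendsto' 0 0 (by simp [hq])).mono_left nhdsWithin_le_nhds
      · filter_upwards [self_mem_nhdsWithin] with t ht
        have ht : 0 < t := ht
        exact Set.mem_Ioi.2 (by positivity)
    filter_upwards [hlim.eventually hRup, hlim.eventually hlow, self_mem_nhdsWithin] with t h1 h2 ht
    have ht : 0 < t := ht
    refine ⟨_, h1.trans ?_, ?_⟩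
    · rw [Real.rpow_inv_natCast_pow (by positivity) hq]
      calc C * (1 / A * t * gauge k ξ₀) ≤ C * (1 / A * t * (gauge k ξ₀ + 1)) := by gcongr; linarith
        _ = t := by simp only [A]; field_simp
    · rw [hVr] at h2
      refine le_trans (le_of_eq ?_) h2
      rw [hexp, ← Real.rpow_natCast _ m, ← Real.rpow_mul (by positivity), Real.mul_rpow (by positivity) ht.le]
      have : (q : ℝ)⁻¹ * m = m / q := by ring
      rw [this]; ring

end Order

/-! ### Contour shift in several variables with a cutoff. -/

section Shift

variable {d : ℕ}

/-- The Cauchy estimate, applied to w ↦ f(z + w) - f(z₀ + w), bounds the difference of derivatives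
by the oscillation of f, which is small by uniform continuity. -/
lemma continuousOn_fderiv_of_differentiableOn {f : (Fin d → ℂ) → ℂ} {U : Set (Fin d → ℂ)}
    (hU : IsOpen U) (hf : DifferentiableOn ℂ f U) : ContinuousOn (fderiv ℂ f) U := by
  intro z₀ hz₀
  refine ContinuousAt.continuousWithinAt ?_
  obtain ⟨r, hr, hrU⟩ := Metric.nhds_basis_closedBall.mem_iff.1 (hU.mem_nhds hz₀)
  have hK : IsCompact (Metric.closedBall z₀ r) := isCompact_closedBall z₀ r
  have huc := hK.uniformContinuousOn_of_continuous (hf.continuousOn.mono hrU)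
  rw [Metric.continuousAt_iff]
  intro ε hε
  obtain ⟨δ, hδ, h⟩ := Metric.uniformContinuousOn_iff.1 huc (ε * r / 8) (by positivity)
  refine ⟨min δ (r / 2), by positivity, fun {z} hz => ?_⟩
  have hz1 := hz.trans_le (min_le_left _ _)
  have hz2 := hz.trans_le (min_le_right _ _)
  have hmem : ∀ w ∈ Metric.ball (0 : Fin d → ℂ) (r / 2), z + w ∈ Metric.closedBall z₀ r ∧
      z₀ + w ∈ Metric.closedBall z₀ r := fun w hw => by
    rw [mem_ball_zero_iff] at hw
    rw [Metric.mem_closedBall, Metric.mem_closedBall, dist_eq_norm, dist_eq_norm, add_sub_cancel_left]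
    rw [dist_eq_norm] at hz2
    refine ⟨?_, by linarith⟩
    calc ‖z + w - z₀‖ = ‖(z - z₀) + w‖ := by congr 1; abel
      _ ≤ r := (norm_add_le _ _).trans (by linarith)
  set g : (Fin d → ℂ) → ℂ := fun w => f (z + w) - f (z₀ + w)
  have hdf : ∀ w ∈ Metric.closedBall z₀ r, DifferentiableAt ℂ f w := fun w hw =>
    hf.differentiableAt (hU.mem_nhds (hrU hw))
  have hgd : DifferentiableOn ℂ g (Metric.ball 0 (r / 2)) := fun w hw => by
    refine DifferentiableAt.differentiableWithinAt ?_
    exact ((hdf _ (hmem w hw).1).comp w (by fun_prop)).sub ((hdf _ (hmem w hw).2).comp w (by fun_prop))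
  have hgb : ∀ w ∈ Metric.ball (0 : Fin d → ℂ) (r / 2), ‖g w‖ ≤ ε * r / 8 := fun w hw => by
    have := h (z + w) (hmem w hw).1 (z₀ + w) (hmem w hw).2 (by simpa using hz1)
    rw [dist_eq_norm] at this
    exact this.le
  have h0 : (0 : Fin d → ℂ) ∈ Metric.ball 0 (r / 2) := Metric.mem_ball_self (by positivity)
  have hmaps : Set.MapsTo g (Metric.ball 0 (r / 2)) (Metric.closedBall (g 0) (ε * r / 4)) :=
    fun w hw => by
      rw [Metric.mem_closedBall]
      refine (dist_le_norm_add_norm _ _).trans ?_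
      linarith [hgb w hw, hgb 0 h0]
  have hfin := Complex.norm_fderiv_le_div_of_mapsTo_ball hgd hmaps (by positivity)
  have hfd : fderiv ℂ g 0 = fderiv ℂ f z - fderiv ℂ f z₀ := by
    have h1 := hmem 0 h0
    rw [add_zero, add_zero] at h1
    have h2 : DifferentiableAt ℂ (fun w => f (z + w)) 0 :=
      DifferentiableAt.comp (g := f) (f := fun w => z + w) 0
        (by simpa using hdf _ h1.1) (by fun_prop)
    have h3 : DifferentiableAt ℂ (fun w => f (z₀ + w)) 0 :=
      DifferentiableAt.comp (g := f) (f := fun w => z₀ + w) 0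
        (by simpa using hdf _ h1.2) (by fun_prop)
    rw [fderiv_fun_sub h2 h3, fderiv_comp_add_left, fderiv_comp_add_left, add_zero, add_zero]
  rw [dist_eq_norm, ← hfd]
  refine hfin.trans_lt ?_
  rw [div_lt_iff₀ (by positivity)]
  nlinarith [mul_pos hε hr]

lemma continuous_smul_of_tsupport {χ : (Fin d → ℝ) → ℝ} (hχ : Continuous χ) {G : (Fin d → ℝ) → ℂ}
    (hG : ∀ ξ ∈ tsupport χ, ContinuousAt G ξ) : Continuous fun ξ => χ ξ • G ξ := by
  refine continuous_of_tsupport fun ξ hξ => ?_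
  exact hχ.continuousAt.smul (hG ξ (tsupport_smul_subset_left χ G hξ))

lemma integrable_smul_of_tsupport {χ : (Fin d → ℝ) → ℝ} (hχ : Continuous χ)
    (hcs : HasCompactSupport χ) {G : (Fin d → ℝ) → ℂ}
    (hG : ∀ ξ ∈ tsupport χ, ContinuousAt G ξ) : Integrable fun ξ => χ ξ • G ξ :=
  (continuous_smul_of_tsupport hχ hG).integrable_of_hasCompactSupport hcs.smul_right

/-- The inclusion of real into complex points, as a continuous linear map. -/
noncomputable def toComplexCLM (d : ℕ) : (Fin d → ℝ) →L[ℝ] (Fin d → ℂ) :=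
  ContinuousLinearMap.pi fun j => Complex.ofRealCLM.comp (ContinuousLinearMap.proj j)

lemma hasFDerivAt_cpt_left (η ξ : Fin d → ℝ) :
    HasFDerivAt (fun ξ => cpt ξ η) (toComplexCLM d) ξ := by
  refine hasFDerivAt_pi.2 fun j => ?_
  exact ((Complex.ofRealCLM.comp (ContinuousLinearMap.proj j)).hasFDerivAt (x := ξ)).sub_const _

lemma hasDerivAt_cpt_right (ξ η : Fin d → ℝ) (τ : ℝ) :
    HasDerivAt (fun τ : ℝ => cpt ξ (τ • η)) ((-Complex.I) • toComplex η) τ := by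
  refine hasDerivAt_pi.2 fun j => ?_
  have h1 : HasDerivAt (fun τ : ℝ => (τ : ℂ)) 1 τ := Complex.ofRealCLM.hasDerivAt
  have h2 := ((h1.mul_const (η j : ℂ)).const_mul Complex.I).const_sub (ξ j : ℂ)
  simpa [cpt, toComplex] using h2

/-- Shifting the domain of integration into the complex domain: the error comes from the region
where the cutoff `χ` varies. -/
theorem norm_integral_shift_le {f : (Fin d → ℂ) → ℂ} {U : Set (Fin d → ℂ)} (hU : IsOpen U)
    (hf : DifferentiableOn ℂ f U) {χ : (Fin d → ℝ) → ℝ} (hχ : ContDiff ℝ 1 χ)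
    (hcs : HasCompactSupport χ) (η : Fin d → ℝ)
    (hmem : ∀ ξ ∈ tsupport χ, ∀ τ ∈ Set.Icc (0 : ℝ) 1, cpt ξ (τ • η) ∈ U)
    {g : (Fin d → ℝ) → ℝ}
    (hg : ∀ ξ ∈ tsupport χ, fderiv ℝ χ ξ η ≠ 0 → ∀ τ ∈ Set.Icc (0 : ℝ) 1, ‖f (cpt ξ (τ • η))‖ ≤ g ξ)
    (hgi : Integrable fun ξ => |fderiv ℝ χ ξ η| * g ξ) :
    ‖(∫ ξ, χ ξ • f (cpt ξ η)) - ∫ ξ, χ ξ • f (toComplex ξ)‖ ≤ ∫ ξ, |fderiv ℝ χ ξ η| * g ξ := by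
  have hK : IsCompact (tsupport χ) := hcs
  have hfd := continuousOn_fderiv_of_differentiableOn hU hf
  have hcpt : Continuous fun p : ℝ × (Fin d → ℝ) => cpt p.2 (p.1 • η) :=
    continuous_cpt.comp (continuous_snd.prodMk (continuous_fst.smul continuous_const))
  have hcptτ : ∀ τ : ℝ, Continuous fun ξ => cpt ξ (τ • η) := fun τ =>
    continuous_cpt.comp (continuous_id.prodMk continuous_const)
  -- The integral is deformed along ξ - iτη, 0 ≤ τ ≤ 1, and its τ-derivative is bounded.
  set c : ℝ → ℂ := fun τ => ∫ ξ, χ ξ • f (cpt ξ (τ • η))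
  set c' : ℝ → ℂ := fun τ => ∫ ξ, χ ξ • fderiv ℂ f (cpt ξ (τ • η)) ((-Complex.I) • toComplex η)
  have hderiv : ∀ τ ∈ Set.Icc (0 : ℝ) 1, HasDerivAt c (c' τ) τ := by
    intro τ₀ hτ₀
    obtain ⟨s, hs, hsK⟩ : ∃ s : Set ℝ, s ∈ 𝓝 τ₀ ∧ ∀ τ ∈ s, ∀ ξ ∈ tsupport χ, cpt ξ (τ • η) ∈ U := by
      have := hK.eventually_forall_of_forall_eventually (x₀ := τ₀)
        (P := fun τ ξ => cpt ξ (τ • η) ∈ U) fun ξ hξ =>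
          hcpt.continuousAt.eventually (hU.mem_nhds (hmem ξ hξ τ₀ hτ₀))
      exact ⟨_, this, fun τ h => h⟩
    obtain ⟨r, hr, hrs⟩ := Metric.nhds_basis_closedBall.mem_iff.1 hs
    have hcont : ContinuousOn (fun p : ℝ × (Fin d → ℝ) =>
        χ p.2 • fderiv ℂ f (cpt p.2 (p.1 • η)) ((-Complex.I) • toComplex η))
        (Metric.closedBall τ₀ r ×ˢ tsupport χ) := by
      refine (hχ.continuous.comp continuous_snd).continuousOn.smul ?_
      refine (hfd.comp hcpt.continuousOn ?_).clm_apply continuousOn_const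
      exact fun p hp => hsK p.1 (hrs hp.1) p.2 hp.2
    obtain ⟨B, hB⟩ := ((isCompact_closedBall τ₀ r).prod hK).exists_bound_of_continuousOn hcont
    have hG : ∀ τ ∈ s, ∀ ξ ∈ tsupport χ, ContinuousAt (fun ξ => f (cpt ξ (τ • η))) ξ :=
      fun τ hτ ξ hξ => ((hf.continuousOn.continuousAt (hU.mem_nhds (hsK τ hτ ξ hξ))).comp
        (f := fun ξ => cpt ξ (τ • η)) (hcptτ τ).continuousAt)
    have hG' : ∀ τ ∈ s, ∀ ξ ∈ tsupport χ, ContinuousAt (fun ξ =>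
        fderiv ℂ f (cpt ξ (τ • η)) ((-Complex.I) • toComplex η)) ξ := fun τ hτ ξ hξ => by
      have h1 : ContinuousAt (fun ξ => fderiv ℂ f (cpt ξ (τ • η))) ξ :=
        (hfd.continuousAt (hU.mem_nhds (hsK τ hτ ξ hξ))).comp
          (f := fun ξ => cpt ξ (τ • η)) (hcptτ τ).continuousAt
      exact h1.clm_apply continuousAt_const
    refine (hasDerivAt_integral_of_dominated_loc_of_deriv_le (𝕜 := ℝ)
      (bound := (tsupport χ).indicator fun _ => B)
      (F' := fun τ ξ => χ ξ • fderiv ℂ f (cpt ξ (τ • η)) ((-Complex.I) • toComplex η))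
      (Metric.closedBall_mem_nhds τ₀ hr) ?_ ?_ ?_ ?_ ?_ ?_).2
    · filter_upwards [hs] with τ hτ
      exact (continuous_smul_of_tsupport hχ.continuous (hG τ hτ)).aestronglyMeasurable
    · exact integrable_smul_of_tsupport hχ.continuous hcs (hG τ₀ (mem_of_mem_nhds hs))
    · exact (continuous_smul_of_tsupport hχ.continuous
        (hG' τ₀ (mem_of_mem_nhds hs))).aestronglyMeasurable
    · refine Eventually.of_forall fun ξ τ hτ => ?_
      by_cases hξ : ξ ∈ tsupport χ
      · rw [Set.indicator_of_mem hξ]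
        exact hB (τ, ξ) ⟨hτ, hξ⟩
      · rw [Set.indicator_of_notMem hξ, image_eq_zero_of_notMem_tsupport hξ, zero_smul, norm_zero]
    · exact (integrable_indicator_iff hK.isClosed.measurableSet).2
        (integrableOn_const hK.measure_lt_top.ne)
    · refine Eventually.of_forall fun ξ τ hτ => ?_
      by_cases hξ : ξ ∈ tsupport χ
      · have h1 := (hf.differentiableAt (hU.mem_nhds (hsK τ (hrs hτ) ξ hξ))).hasFDerivAt
        have h2 := (h1.restrictScalars ℝ).comp_hasDerivAt τ (hasDerivAt_cpt_right ξ η τ)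
        exact HasDerivAt.const_smul (χ ξ) h2
      · simp only [image_eq_zero_of_notMem_tsupport hξ, zero_smul]
        exact hasDerivAt_const _ _
  have hbound : ∀ τ ∈ Set.Icc (0 : ℝ) 1, ‖c' τ‖ ≤ ∫ ξ, |fderiv ℝ χ ξ η| * g ξ := by
    intro τ hτ
    set G : (Fin d → ℝ) → ℂ := fun ξ => f (cpt ξ (τ • η))
    have hGd : ∀ ξ ∈ tsupport χ, HasFDerivAt G (((fderiv ℂ f (cpt ξ (τ • η))).restrictScalars ℝ).comp
        (toComplexCLM d)) ξ := fun ξ hξ =>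
      ((hf.differentiableAt (hU.mem_nhds (hmem ξ hξ τ hτ))).hasFDerivAt.restrictScalars ℝ).comp ξ
        (hasFDerivAt_cpt_left (τ • η) ξ)
    have hGe : ∀ ξ ∈ tsupport χ, fderiv ℝ G ξ η = fderiv ℂ f (cpt ξ (τ • η)) (toComplex η) := fun ξ hξ => by
      rw [(hGd ξ hξ).fderiv]
      rfl
    have hGc : ∀ ξ ∈ tsupport χ, ContinuousAt G ξ := fun ξ hξ => (hGd ξ hξ).continuousAt
    have hGc' : ∀ ξ ∈ tsupport χ, ContinuousAt (fun ξ => fderiv ℂ f (cpt ξ (τ • η)) (toComplex η)) ξ :=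
      fun ξ hξ => by
        have h1 : ContinuousAt (fun ξ => fderiv ℂ f (cpt ξ (τ • η))) ξ :=
          (hfd.continuousAt (hU.mem_nhds (hmem ξ hξ τ hτ))).comp
            (f := fun ξ => cpt ξ (τ • η)) (hcptτ τ).continuousAt
        exact h1.clm_apply continuousAt_const
    have heq : ∀ ξ, χ ξ • fderiv ℝ G ξ η = χ ξ • fderiv ℂ f (cpt ξ (τ • η)) (toComplex η) := fun ξ => by
      by_cases hξ : ξ ∈ tsupport χ
      · rw [hGe ξ hξ]
      · simp [image_eq_zero_of_notMem_tsupport hξ]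
    have hχ' : Continuous fun ξ => fderiv ℝ χ ξ η :=
      (hχ.continuous_fderiv one_ne_zero).clm_apply continuous_const
    have hsub : tsupport (fun ξ => fderiv ℝ χ ξ η) ⊆ tsupport χ := tsupport_fderiv_apply_subset ℝ η
    have hcs' : HasCompactSupport fun ξ => fderiv ℝ χ ξ η := hcs.fderiv_apply ℝ η
    -- By complex linearity of the derivative, moving in direction -iη is -i times moving in the
    -- real direction η, which can be integrated by parts onto the cutoff.
    have hibp : ∫ ξ, χ ξ • fderiv ℝ G ξ η = - ∫ ξ, fderiv ℝ χ ξ η • G ξ := by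
      refine integral_smul_fderiv_eq_neg_fderiv_smul_of_integrable ?_ ?_ ?_ ?_ ?_
      · exact integrable_smul_of_tsupport hχ' hcs' fun ξ hξ => hGc ξ (hsub hξ)
      · simp only [heq]
        exact integrable_smul_of_tsupport hχ.continuous hcs hGc'
      · exact integrable_smul_of_tsupport hχ.continuous hcs hGc
      · exact fun ξ _ => (hχ.differentiable one_ne_zero) ξ
      · exact fun ξ hξ => (hGd ξ hξ).differentiableAt
    have hc' : c' τ = Complex.I * ∫ ξ, fderiv ℝ χ ξ η • G ξ := by
      have h1 : c' τ = (-Complex.I) * ∫ ξ, χ ξ • fderiv ℝ G ξ η := by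
        rw [← integral_const_mul]
        refine integral_congr_ae (Eventually.of_forall fun ξ => ?_)
        simp only [heq, map_smul, smul_eq_mul, Complex.real_smul]
        ring
      rw [h1, hibp]; ring
    rw [hc', norm_mul, Complex.norm_I, one_mul]
    refine norm_integral_le_of_norm_le hgi (Eventually.of_forall fun ξ => ?_)
    rw [norm_smul, Real.norm_eq_abs]
    by_cases h0 : fderiv ℝ χ ξ η = 0
    · simp [h0]
    · exact mul_le_mul_of_nonneg_left (hg ξ (hsub (subset_tsupport _ h0)) h0 τ hτ) (abs_nonneg _)
  have hfin := norm_image_sub_le_of_norm_deriv_le_segment_01'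
    (fun τ hτ => (hderiv τ hτ).hasDerivWithinAt) (fun τ hτ => hbound τ ⟨hτ.1, hτ.2.le⟩)
  simpa [c] using hfin

end Shift

/-! ### The Legendre-Fenchel transform of R. -/

section Legendre

variable {d : ℕ} {P : MvPolynomial (Fin d) ℂ}

lemma abs_dotProduct_le (x y : Fin d → ℝ) : |x ⬝ᵥ y| ≤ d * ‖x‖ * ‖y‖ := by
  calc |x ⬝ᵥ y| ≤ ∑ j, |x j * y j| := Finset.abs_sum_le_sum_abs _ _
    _ ≤ ∑ _j : Fin d, ‖x‖ * ‖y‖ := Finset.sum_le_sum fun j _ => by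
        rw [abs_mul]
        exact mul_le_mul (norm_le_pi_norm x j) (norm_le_pi_norm y j) (abs_nonneg _) (norm_nonneg _)
    _ = d * ‖x‖ * ‖y‖ := by simp [mul_assoc]

/-- R outgrows linear functions, so for bounded y only bounded ν can make y·ν - R(ν) positive. This
keeps the contour shifts small. -/
lemma IsPosHom.exists_dotProduct_le (hP : IsPosHom P) (L : ℝ) :
    ∃ K > 0, ∀ y ν : Fin d → ℝ, ‖y‖ ≤ L → K ≤ ‖ν‖ → y ⬝ᵥ ν ≤ rePart P ν := by
  obtain ⟨K, hK, h⟩ := hP.exists_growth (A := d * |L| + 1) (by positivity)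
  refine ⟨K, hK, fun y ν hy hν => ((le_abs_self _).trans (abs_dotProduct_le y ν)).trans
    (le_trans ?_ (h ν hν))⟩
  have h1 : (d : ℝ) * ‖y‖ ≤ d * |L| + 1 := by
    have := mul_le_mul_of_nonneg_left (hy.trans (le_abs_self L)) (Nat.cast_nonneg (α := ℝ) d)
    linarith
  exact mul_le_mul_of_nonneg_right h1 (norm_nonneg _)

lemma IsPosHom.exists_sub_le (hP : IsPosHom P) (L : ℝ) :
    ∃ S > 0, ∀ y ν : Fin d → ℝ, ‖y‖ ≤ L → y ⬝ᵥ ν - rePart P ν ≤ S := by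
  obtain ⟨K, hK, h⟩ := hP.exists_dotProduct_le L
  refine ⟨d * |L| * K + 1, by positivity, fun y ν hy => ?_⟩
  rcases le_total K ‖ν‖ with h1 | h1
  · have := h y ν hy h1
    have h2 : (0 : ℝ) ≤ d * |L| * K := by positivity
    linarith
  · have h2 := (le_abs_self _).trans (abs_dotProduct_le y ν)
    have h3 := hP.2.1 ν
    have h4 : (d : ℝ) * ‖y‖ * ‖ν‖ ≤ d * |L| * K := by
      gcongr
      exact hy.trans (le_abs_self L)
    linarith

lemma IsPosHom.legendre_bddAbove (hP : IsPosHom P) (y : Fin d → ℝ) :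
    BddAbove (Set.range fun ξ : Fin d → ℝ => y ⬝ᵥ ξ - rePart P ξ) := by
  obtain ⟨S, -, h⟩ := hP.exists_sub_le ‖y‖
  exact ⟨S, by rintro _ ⟨ν, rfl⟩; exact h y ν le_rfl⟩

lemma IsPosHom.le_legendre (hP : IsPosHom P) (y ν : Fin d → ℝ) :
    y ⬝ᵥ ν - rePart P ν ≤ legendre P y := le_ciSup (hP.legendre_bddAbove y) ν

lemma IsPosHom.legendre_nonneg (hP : IsPosHom P) (y : Fin d → ℝ) : 0 ≤ legendre P y := by
  have := hP.le_legendre y 0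
  simpa [hP.rePart_zero] using this

lemma IsPosHom.exists_legendre_le (hP : IsPosHom P) (L : ℝ) :
    ∃ S > 0, ∀ y : Fin d → ℝ, ‖y‖ ≤ L → legendre P y ≤ S := by
  obtain ⟨S, hS, h⟩ := hP.exists_sub_le L
  exact ⟨S, hS, fun y hy => ciSup_le fun ν => h y ν hy⟩

/-- Test with ν a signed coordinate vector at the largest coordinate of y: then y·ν = ‖y‖, while
R(ν) stays bounded. -/
lemma IsPosHom.exists_one_le_legendre (hd : 0 < d) (hP : IsPosHom P) :
    ∃ L > 0, ∀ y : Fin d → ℝ, L ≤ ‖y‖ → 1 ≤ legendre P y := by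
  obtain ⟨B, hB⟩ := (isCompact_closedBall (0 : Fin d → ℝ) 1).exists_bound_of_continuousOn
    (continuous_rePart (P := P)).continuousOn
  refine ⟨|B| + 1, by positivity, fun y hy => ?_⟩
  have : Nonempty (Fin d) := ⟨⟨0, hd⟩⟩
  obtain ⟨j, hj⟩ := Finite.exists_max fun j => ‖y j‖
  have hyj : ‖y‖ ≤ |y j| := (pi_norm_le_iff_of_nonneg (abs_nonneg _)).2 hj
  set ν : Fin d → ℝ := Pi.single j (SignType.sign (y j) : ℝ)
  have hν : ‖ν‖ ≤ 1 := by
    refine (pi_norm_le_iff_of_nonneg zero_le_one).2 fun i => ?_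
    rcases eq_or_ne i j with rfl | h
    · simp only [ν, Pi.single_eq_same]
      rcases lt_trichotomy (y i) 0 with h | h | h <;> simp [h]
    · simp [ν, h]
  have h1 : y ⬝ᵥ ν = |y j| := by
    rw [dotProduct_single, mul_comm, sign_mul_self]
  have h2 := hB ν (by simpa using hν)
  rw [Real.norm_eq_abs] at h2
  have h3 := hP.le_legendre y ν
  linarith [le_abs_self (rePart P ν), le_abs_self B]

/-- An exponential bound that holds for all `ν` passes to the supremum. -/
lemma le_mul_exp_legendre {A B m : ℝ} (hB : 0 ≤ B) (hm : 0 < m) {y : Fin d → ℝ}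
    (h : ∀ ν : Fin d → ℝ, A ≤ B * Real.exp (-(m * (y ⬝ᵥ ν - rePart P ν)))) :
    A ≤ B * Real.exp (-(m * legendre P y)) := by
  rcases le_or_gt A 0 with hA | hA
  · exact hA.trans (by positivity)
  have hB' : 0 < B := by
    rcases eq_or_lt_of_le hB with h0 | h0
    · have := h 0
      rw [← h0, zero_mul] at this
      linarith
    · exact h0
  have h1 : ∀ ν : Fin d → ℝ, y ⬝ᵥ ν - rePart P ν ≤ Real.log (B / A) / m := fun ν => by
    rw [le_div_iff₀ hm, Real.le_log_iff_exp_le (by positivity), le_div_iff₀ hA]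
    have := h ν
    rw [Real.exp_neg, ← div_eq_mul_inv, le_div_iff₀ (Real.exp_pos _)] at this
    rwa [mul_comm _ m, mul_comm _ A]
  have h2 : legendre P y ≤ Real.log (B / A) / m := ciSup_le h1
  rw [le_div_iff₀ hm, Real.le_log_iff_exp_le (by positivity), le_div_iff₀ hA] at h2
  rw [Real.exp_neg, ← div_eq_mul_inv, le_div_iff₀ (Real.exp_pos _)]
  rwa [mul_comm _ m, mul_comm _ A] at h2

end Legendre

/-! ### Contour shift and Gaussian bound for the heat kernel. -/

section HeatKernel

variable {d : ℕ} {P : MvPolynomial (Fin d) ℂ}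

/-- The integrand of the heat kernel at complex points. -/
noncomputable def kernelFn (P : MvPolynomial (Fin d) ℂ) (t : ℝ) (x : Fin d → ℝ) (z : Fin d → ℂ) : ℂ :=
  Complex.exp (-(t : ℂ) * MvPolynomial.eval z P - Complex.I * ∑ j, (x j : ℂ) * z j)

lemma differentiable_kernelFn (t : ℝ) (x : Fin d → ℝ) : Differentiable ℂ (kernelFn P t x) := by
  have h1 : Differentiable ℂ fun z : Fin d → ℂ => MvPolynomial.eval z P := fun z =>
    ((AnalyticOnNhd.eval_mvPolynomial P) z trivial).differentiableAt
  unfold kernelFn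
  fun_prop

lemma sum_mul_cpt (x ξ η : Fin d → ℝ) :
    ∑ j, (x j : ℂ) * cpt ξ η j = ((x ⬝ᵥ ξ : ℝ) : ℂ) - Complex.I * ((x ⬝ᵥ η : ℝ) : ℂ) := by
  simp only [cpt, dotProduct, Complex.ofReal_sum, Complex.ofReal_mul, Finset.mul_sum,
    ← Finset.sum_sub_distrib]
  exact Finset.sum_congr rfl fun j _ => by ring

lemma sum_mul_toComplex (x ξ : Fin d → ℝ) :
    ∑ j, (x j : ℂ) * toComplex ξ j = ((x ⬝ᵥ ξ : ℝ) : ℂ) := by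
  have := sum_mul_cpt x ξ 0
  simpa using this

lemma norm_kernelFn_cpt (t : ℝ) (x ξ η : Fin d → ℝ) :
    ‖kernelFn P t x (cpt ξ η)‖ = Real.exp (-(t * (evalC P ξ η).re) - x ⬝ᵥ η) := by
  rw [kernelFn, Complex.norm_exp, sum_mul_cpt]
  congr 1
  simp [evalC, mul_sub, Complex.mul_re]

lemma heatKernel_eq (t : ℝ) (x : Fin d → ℝ) :
    heatKernel P t x = (((2 * Real.pi) ^ d : ℝ) : ℂ)⁻¹ * ∫ ξ, kernelFn P t x (toComplex ξ) := by
  rw [heatKernel]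
  congr 2 with ξ
  rw [kernelFn, sum_mul_toComplex, ← Complex.exp_add, evalR]
  congr 1
  ring

/-- A smooth cutoff which is `1` near the closed ball of radius `1` and vanishes off the ball of radius `2`. -/
noncomputable def stdBump (d : ℕ) : ContDiffBump (0 : Fin d → ℝ) := ⟨1, 2, one_pos, one_lt_two⟩

/-- The bump function at scale `δ`. -/
noncomputable def scaledBump (d : ℕ) (δ : ℝ) (ξ : Fin d → ℝ) : ℝ := stdBump d (δ⁻¹ • ξ)

lemma contDiff_scaledBump (δ : ℝ) : ContDiff ℝ 1 (scaledBump d δ) :=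
  (stdBump d).contDiff.comp (contDiff_const_smul _)

lemma scaledBump_nonneg (δ : ℝ) (ξ : Fin d → ℝ) : 0 ≤ scaledBump d δ ξ := (stdBump d).nonneg

lemma scaledBump_le_one (δ : ℝ) (ξ : Fin d → ℝ) : scaledBump d δ ξ ≤ 1 := (stdBump d).le_one

lemma scaledBump_eq_one {δ : ℝ} (hδ : 0 < δ) {ξ : Fin d → ℝ} (h : ‖ξ‖ ≤ δ) :
    scaledBump d δ ξ = 1 := by
  refine (stdBump d).one_of_mem_closedBall ?_
  rw [mem_closedBall_zero_iff, norm_smul, norm_inv, Real.norm_of_nonneg hδ.le]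
  exact (inv_mul_le_iff₀ hδ).2 (by simpa [stdBump] using h)

lemma scaledBump_eq_zero {δ : ℝ} (hδ : 0 < δ) {ξ : Fin d → ℝ} (h : 2 * δ ≤ ‖ξ‖) :
    scaledBump d δ ξ = 0 := by
  refine (stdBump d).zero_of_le_dist ?_
  rw [dist_zero_right, norm_smul, norm_inv, Real.norm_of_nonneg hδ.le]
  have : (stdBump d).rOut = 2 := rfl
  rw [this, le_inv_mul_iff₀ hδ]
  linarith

lemma tsupport_scaledBump_subset {δ : ℝ} (hδ : 0 < δ) :
    tsupport (scaledBump d δ) ⊆ Metric.closedBall 0 (2 * δ) := by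
  refine closure_minimal (fun ξ hξ => ?_) Metric.isClosed_closedBall
  by_contra hcon
  rw [mem_closedBall_zero_iff, not_le] at hcon
  exact hξ (scaledBump_eq_zero hδ hcon.le)

lemma hasCompactSupport_scaledBump {δ : ℝ} (hδ : 0 < δ) : HasCompactSupport (scaledBump d δ) :=
  (isCompact_closedBall _ _).of_isClosed_subset (isClosed_tsupport _) (tsupport_scaledBump_subset hδ)

lemma fderiv_scaledBump (δ : ℝ) (ξ η : Fin d → ℝ) :
    fderiv ℝ (scaledBump d δ) ξ η = δ⁻¹ * fderiv ℝ (stdBump d) (δ⁻¹ • ξ) η := by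
  have h1 : HasFDerivAt (fun ξ : Fin d → ℝ => δ⁻¹ • ξ) (δ⁻¹ • ContinuousLinearMap.id ℝ (Fin d → ℝ)) ξ :=
    (δ⁻¹ • ContinuousLinearMap.id ℝ (Fin d → ℝ)).hasFDerivAt
  have h2 : HasFDerivAt (stdBump d) (fderiv ℝ (stdBump d) (δ⁻¹ • ξ)) (δ⁻¹ • ξ) :=
    (((stdBump d).contDiff (n := 1)).differentiable one_ne_zero _).hasFDerivAt
  have h3 := h2.comp ξ h1
  have h4 : fderiv ℝ (scaledBump d δ) ξ = _ := h3.fderiv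
  rw [h4]
  simp

lemma fderiv_scaledBump_eq_zero {δ : ℝ} (hδ : 0 < δ) {ξ : Fin d → ℝ} (h : ‖ξ‖ < δ) (η : Fin d → ℝ) :
    fderiv ℝ (scaledBump d δ) ξ η = 0 := by
  have : scaledBump d δ =ᶠ[𝓝 ξ] fun _ => 1 := by
    have hb : Metric.ball (0 : Fin d → ℝ) δ ∈ 𝓝 ξ := Metric.isOpen_ball.mem_nhds (by simpa using h)
    filter_upwards [hb] with v hv
    exact scaledBump_eq_one hδ ((mem_ball_zero_iff.1 hv).le)
  rw [this.fderiv_eq]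
  simp

lemma exists_fderiv_stdBump_bound (η : Fin d → ℝ) :
    ∃ D > 0, ∀ ξ, |fderiv ℝ (stdBump d) ξ η| ≤ D := by
  have hc : Continuous fun ξ => fderiv ℝ (stdBump d) ξ η :=
    (((stdBump d).contDiff (n := 1)).continuous_fderiv one_ne_zero).clm_apply continuous_const
  have hcs : HasCompactSupport fun ξ => fderiv ℝ (stdBump d) ξ η :=
    (stdBump d).hasCompactSupport.fderiv_apply ℝ η
  obtain ⟨D, hD⟩ := hc.bounded_above_of_compact_support hcs
  exact ⟨|D| + 1, by positivity, fun ξ => (hD ξ).trans ((le_abs_self D).trans (by linarith))⟩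

/-- The heat kernel integral may be shifted into the complex domain. -/
lemma IsPosHom.integral_kernelFn_shift (hP : IsPosHom P) {t : ℝ} (ht : 0 < t) (x η : Fin d → ℝ) :
    ∫ ξ, kernelFn P t x (cpt ξ η) = ∫ ξ, kernelFn P t x (toComplex ξ) := by
  obtain ⟨C, hC, hre⟩ := hP.exists_re_evalC_ge
  obtain ⟨B, hB⟩ := (isCompact_Icc (a := (0 : ℝ)) (b := 1)).exists_bound_of_continuousOn
    (f := fun τ => rePart P (τ • η)) (by
      exact ((continuous_rePart (P := P)).comp (continuous_id.smul continuous_const)).continuousOn)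
  obtain ⟨D, hD, hDb⟩ := exists_fderiv_stdBump_bound η
  set A := Real.exp (t * C * B + |x ⬝ᵥ η|)
  set g : (Fin d → ℝ) → ℝ := fun ξ => A * Real.exp (-(t / 2 * rePart P ξ))
  have hg : ∀ ξ, ∀ τ ∈ Set.Icc (0 : ℝ) 1, ‖kernelFn P t x (cpt ξ (τ • η))‖ ≤ g ξ := fun ξ τ hτ => by
    simp only [g, A]
    rw [norm_kernelFn_cpt, ← Real.exp_add]
    refine Real.exp_le_exp.2 ?_
    have h1 := hre ξ (τ • η)
    have h2 := hB τ hτ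
    rw [Real.norm_of_nonneg (hP.2.1 _)] at h2
    have h3 : |x ⬝ᵥ (τ • η)| ≤ |x ⬝ᵥ η| := by
      rw [dotProduct_smul, smul_eq_mul, abs_mul, abs_of_nonneg hτ.1]
      exact mul_le_of_le_one_left (abs_nonneg _) hτ.2
    have h4 := mul_le_mul_of_nonneg_left h1 ht.le
    have h5 := mul_le_mul_of_nonneg_left h2 (mul_nonneg ht.le hC.le)
    have h6 := neg_abs_le (x ⬝ᵥ (τ • η))
    nlinarith
  have hgi : Integrable g := (hP.integrable_exp_neg (half_pos ht)).const_mul A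
  have hlim : ∀ τ ∈ Set.Icc (0 : ℝ) 1, Tendsto (fun n : ℕ => ∫ ξ, scaledBump d (n + 1) ξ •
      kernelFn P t x (cpt ξ (τ • η))) atTop (𝓝 (∫ ξ, kernelFn P t x (cpt ξ (τ • η)))) := by
    intro τ hτ
    have hk : Continuous fun ξ => kernelFn P t x (cpt ξ (τ • η)) :=
      (differentiable_kernelFn t x).continuous.comp (continuous_cpt.comp (continuous_id.prodMk continuous_const))
    refine tendsto_integral_of_dominated_convergence g (fun n => ?_) hgi (fun n => ?_) ?_
    · exact ((contDiff_scaledBump _).continuous.smul hk).aestronglyMeasurable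
    · refine Eventually.of_forall fun ξ => ?_
      rw [norm_smul, Real.norm_of_nonneg (scaledBump_nonneg _ _)]
      exact (mul_le_of_le_one_left (norm_nonneg _) (scaledBump_le_one _ _)).trans (hg ξ τ hτ)
    · refine Eventually.of_forall fun ξ => tendsto_const_nhds.congr' ?_
      obtain ⟨N, hN⟩ := exists_nat_ge ‖ξ‖
      filter_upwards [eventually_ge_atTop N] with n hn
      rw [scaledBump_eq_one (by positivity), one_smul]
      have : (N : ℝ) ≤ n := by exact_mod_cast hn
      linarith
  have h0 := hlim 0 ⟨le_rfl, zero_le_one⟩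
  have h1 := hlim 1 ⟨zero_le_one, le_rfl⟩
  simp only [zero_smul, one_smul, cpt_zero_right] at h0 h1
  have hdiff := h1.sub h0
  refine sub_eq_zero.1 (tendsto_nhds_unique hdiff ?_)
  -- The cutoff at scale n + 1 has gradient of size 1/(n + 1), so the shift error vanishes in the
  -- limit.
  have hz : Tendsto (fun n : ℕ => D * (∫ ξ, g ξ) / ((n : ℝ) + 1)) atTop (𝓝 0) :=
    tendsto_const_nhds.div_atTop (tendsto_atTop_add_const_right _ _ tendsto_natCast_atTop_atTop)
  refine squeeze_zero_norm (fun n => ?_) hz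
  have hn : (0 : ℝ) < n + 1 := by positivity
  have hpt : ∀ ξ, |fderiv ℝ (scaledBump d (n + 1)) ξ η| * g ξ ≤ D / (n + 1) * g ξ := fun ξ => by
    refine mul_le_mul_of_nonneg_right ?_ (by positivity)
    rw [fderiv_scaledBump, abs_mul, abs_of_pos (inv_pos.2 hn), inv_mul_eq_div]
    gcongr
    exact hDb _
  have hint : Integrable fun ξ => |fderiv ℝ (scaledBump d (n + 1)) ξ η| * g ξ := by
    have hc : Continuous fun ξ => fderiv ℝ (scaledBump d (n + 1)) ξ η :=
      ((contDiff_scaledBump _).continuous_fderiv one_ne_zero).clm_apply continuous_const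
    refine (hgi.const_mul (D / (n + 1))).mono' (hc.abs.aestronglyMeasurable.mul hgi.aestronglyMeasurable)
      (Eventually.of_forall fun ξ => ?_)
    rw [Real.norm_of_nonneg (by positivity)]
    exact hpt ξ
  refine (norm_integral_shift_le isOpen_univ (differentiable_kernelFn t x).differentiableOn
    (contDiff_scaledBump _) (hasCompactSupport_scaledBump hn) η (fun _ _ _ _ => trivial)
    (fun ξ _ _ => hg ξ) hint).trans ?_
  refine (integral_mono hint (hgi.const_mul _) hpt).trans (le_of_eq ?_)
  rw [integral_const_mul]
  ring

/-- The Gaussian bound for the heat kernel. -/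
theorem IsPosHom.exists_heatKernel_le (hP : IsPosHom P) {E : Matrix (Fin d) (Fin d) ℝ}
    (hE : E ∈ expSet P) :
    ∃ C > 0, ∃ M > 0, ∀ t : ℝ, 0 < t → ∀ y : Fin d → ℝ,
      ‖heatKernel P t (t • y)‖ ≤ C * t ^ (-E.trace) * Real.exp (-(t * M * legendre P y)) := by
  obtain ⟨A, hA, hre⟩ := hP.exists_re_evalC_ge
  -- The choice ε = 1/A gives A R(θν) ≤ θR(ν), so shifting by θν yields the exponent -tθ(y·ν - R(ν))
  -- for every ν, and M = θ.
  obtain ⟨θ, hθ, hsm⟩ := hP.rePart_smul_le (ε := 1 / A) (by positivity)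
  have hI := hP.integral_exp_neg_pos (c := 1 / 2) (by norm_num)
  refine ⟨((2 * Real.pi) ^ d)⁻¹ * ∫ ξ, Real.exp (-(1 / 2 * rePart P ξ)), by positivity, θ, hθ,
    fun t ht y => ?_⟩
  refine le_mul_exp_legendre (by positivity) (by positivity) fun ν => ?_
  rw [heatKernel_eq, ← hP.integral_kernelFn_shift ht _ (θ • ν), norm_mul, norm_inv,
    Complex.norm_real, Real.norm_of_nonneg (by positivity)]
  have hsc := integral_exp_neg_mul hE ht (1 / 2)
  have h1 : ∀ ξ, ‖kernelFn P t (t • y) (cpt ξ (θ • ν))‖ ≤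
      Real.exp (-(t * θ * (y ⬝ᵥ ν - rePart P ν))) * Real.exp (-(t * (1 / 2) * rePart P ξ)) := fun ξ => by
    rw [norm_kernelFn_cpt, ← Real.exp_add]
    refine Real.exp_le_exp.2 ?_
    have h2 := mul_le_mul_of_nonneg_left (hre ξ (θ • ν)) ht.le
    have h3 : t * A * rePart P (θ • ν) ≤ t * A * (1 / A * θ * rePart P ν) :=
      mul_le_mul_of_nonneg_left (hsm θ hθ.le le_rfl ν) (by positivity)
    have h4 : t * A * (1 / A * θ * rePart P ν) = t * θ * rePart P ν := by field_simp
    rw [dotProduct_smul, smul_dotProduct, smul_eq_mul, smul_eq_mul]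
    nlinarith
  have h2 := norm_integral_le_of_norm_le ((hP.integrable_exp_neg
    (c := t * (1 / 2)) (by positivity)).const_mul _) (Eventually.of_forall h1)
  rw [integral_const_mul, hsc] at h2
  calc _ ≤ ((2 * Real.pi) ^ d)⁻¹ * (Real.exp (-(t * θ * (y ⬝ᵥ ν - rePart P ν))) *
        (t ^ (-E.trace) * ∫ ξ, Real.exp (-(1 / 2 * rePart P ξ)))) := by gcongr
    _ = _ := by ring

end HeatKernel

/-! ### The error near one maximizer. -/

section LocalEstimate

variable {d : ℕ} {P : MvPolynomial (Fin d) ℂ}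

lemma exists_rpow_le_exp {a c : ℝ} (ha : 0 ≤ a) (hc : 0 < c) :
    ∃ K > 0, ∀ x : ℝ, 0 ≤ x → x ^ a ≤ K * Real.exp (c * x) := by
  obtain ⟨m, hm⟩ := exists_nat_ge a
  refine ⟨1 + m.factorial / c ^ m, by positivity, fun x hx => ?_⟩
  have h1 : x ^ a ≤ 1 + x ^ m := by
    rcases le_total x 1 with h | h
    · linarith [Real.rpow_le_one hx h ha, pow_nonneg hx m]
    · have := Real.rpow_le_rpow_of_exponent_le h hm
      rw [Real.rpow_natCast] at this
      linarith
  have h2 := Real.pow_div_factorial_le_exp (c * x) (by positivity) m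
  have h3 : x ^ m ≤ m.factorial / c ^ m * Real.exp (c * x) := by
    rw [div_le_iff₀ (by positivity), mul_pow] at h2
    rw [div_mul_eq_mul_div, le_div_iff₀ (by positivity)]
    linarith
  have h4 : 1 ≤ Real.exp (c * x) := Real.one_le_exp (by positivity)
  linarith

/-- Half of an exponentially small error pays for the power of t; the other half remains to dominate
the Legendre factor. -/
lemma exists_exp_neg_le_rpow (a : ℝ) {c : ℝ} (hc : 0 < c) :
    ∃ K > 0, ∀ t : ℝ, 1 ≤ t → Real.exp (-(2 * c * t)) ≤ K * t ^ (-a) * Real.exp (-(c * t)) := by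
  obtain ⟨K, hK, h⟩ := exists_rpow_le_exp (abs_nonneg a) hc
  refine ⟨K, hK, fun t ht => ?_⟩
  have ht0 : 0 < t := by linarith
  have h1 : t ^ a ≤ K * Real.exp (c * t) :=
    (Real.rpow_le_rpow_of_exponent_le ht (le_abs_self a)).trans (h t ht0.le)
  have h2 : 1 ≤ K * t ^ (-a) * Real.exp (c * t) := by
    rw [Real.rpow_neg ht0.le]
    have := Real.rpow_pos_of_pos ht0 a
    rw [mul_assoc, mul_left_comm, ← div_eq_inv_mul, le_div_iff₀ this]
    linarith
  calc Real.exp (-(2 * c * t)) = 1 * Real.exp (-(2 * c * t)) := (one_mul _).symm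
    _ ≤ K * t ^ (-a) * Real.exp (c * t) * Real.exp (-(2 * c * t)) := by gcongr
    _ = _ := by rw [mul_assoc, ← Real.exp_add]; ring_nf

/-- The difference between the local exponential of the characteristic function and the heat
kernel integrand. -/
noncomputable def localFn (P : MvPolynomial (Fin d) ℂ) (W : (Fin d → ℂ) → ℂ) (t : ℝ)
    (y : Fin d → ℝ) (z : Fin d → ℂ) : ℂ :=
  kernelFn P t (t • y) z * (Complex.exp (t * W z) - 1)

lemma differentiableOn_localFn {W : (Fin d → ℂ) → ℂ} {U : Set (Fin d → ℂ)}
    (hW : DifferentiableOn ℂ W U) (t : ℝ) (y : Fin d → ℝ) :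
    DifferentiableOn ℂ (localFn P W t y) U :=
  (differentiable_kernelFn t _).differentiableOn.mul ((hW.const_mul _).cexp.sub_const 1)

lemma norm_exp_sub_one_le_mul_exp (w : ℂ) : ‖Complex.exp w - 1‖ ≤ ‖w‖ * Real.exp ‖w‖ := by
  simpa using Complex.norm_exp_sub_sum_le_norm_mul_exp w 1

/-- Put N = R(ξ) + R(η). Then |e^{tW} - 1| ≤ t|W|e^{t|W|}, where |W| ≤ N/8 near 0 and t N^{1+λ} =
t^{-λ}(tN)^{1+λ} ≤ K t^{-λ}e^{tN/8}. The two eighths use half of the decay e^{-tR(ξ)/2} of the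
kernel; their share in R(η) raises A to A + 1. -/
lemma IsPosHom.exists_localFn_le (hP : IsPosHom P) {W : (Fin d → ℂ) → ℂ} {lam C r : ℝ}
    (hlam : 0 < lam) (hC : 0 < C) (hr : 0 < r)
    (hW : ∀ ξ η : Fin d → ℝ, ‖ξ‖ < r → ‖η‖ < r →
      ‖W (cpt ξ η)‖ ≤ C * (rePart P ξ + rePart P η) ^ (1 + lam)) :
    ∃ r₀ > 0, r₀ ≤ r ∧ ∃ B > 0, ∃ A > 0, ∀ t : ℝ, 0 < t → ∀ y ξ η : Fin d → ℝ, ‖ξ‖ < r₀ → ‖η‖ < r₀ →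
      ‖localFn P W t y (cpt ξ η)‖ ≤ B * t ^ (-lam) *
        Real.exp (-(t * (y ⬝ᵥ η - A * rePart P η))) * Real.exp (-(t * (1 / 4) * rePart P ξ)) := by
  obtain ⟨A, hA, hre⟩ := hP.exists_re_evalC_ge
  obtain ⟨K, hK, hKe⟩ := exists_rpow_le_exp (a := 1 + lam) (c := 1 / 8) (by positivity) (by norm_num)
  obtain ⟨r₁, hr₁, hsmall⟩ : ∃ r₁ > 0, ∀ ξ η : Fin d → ℝ, ‖ξ‖ < r₁ → ‖η‖ < r₁ →
      C * (rePart P ξ + rePart P η) ^ lam ≤ 1 / 8 := by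
    have hc : Continuous fun p : (Fin d → ℝ) × (Fin d → ℝ) =>
        C * (rePart P p.1 + rePart P p.2) ^ lam :=
      continuous_const.mul ((((continuous_rePart (P := P)).comp continuous_fst).add
        ((continuous_rePart (P := P)).comp continuous_snd)).rpow_const fun _ => Or.inr hlam.le)
    have h0 : Tendsto (fun p : (Fin d → ℝ) × (Fin d → ℝ) =>
        C * (rePart P p.1 + rePart P p.2) ^ lam) (𝓝 0) (𝓝 0) :=
      hc.tendsto' 0 0 (by simp [hP.rePart_zero, hlam.ne'])
    obtain ⟨r₁, hr₁, h⟩ := Metric.eventually_nhds_iff.1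
      (h0.eventually (gt_mem_nhds (show (0 : ℝ) < 1 / 8 by norm_num)))
    refine ⟨r₁, hr₁, fun ξ η hξ hη => (h (y := (ξ, η)) ?_).le⟩
    rw [dist_zero_right, Prod.norm_def]
    exact max_lt hξ hη
  refine ⟨min r r₁, lt_min hr hr₁, min_le_left _ _, C * K, by positivity, A + 1, by positivity,
    fun t ht y ξ η hξ hη => ?_⟩
  have hWb := hW ξ η (hξ.trans_le (min_le_left _ _)) (hη.trans_le (min_le_left _ _))
  have hs := hsmall ξ η (hξ.trans_le (min_le_right _ _)) (hη.trans_le (min_le_right _ _))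
  have hRξ := hP.2.1 ξ
  have hRη := hP.2.1 η
  set N := rePart P ξ + rePart P η
  have hN : 0 ≤ N := add_nonneg hRξ hRη
  have hW8 : ‖W (cpt ξ η)‖ ≤ N / 8 := by
    rcases eq_or_lt_of_le hN with h0 | h0
    · rw [← h0, Real.zero_rpow (by positivity)] at hWb
      linarith
    · rw [Real.rpow_add h0, Real.rpow_one] at hWb
      nlinarith
  have htW : ‖(t : ℂ) * W (cpt ξ η)‖ = t * ‖W (cpt ξ η)‖ := by
    rw [norm_mul, Complex.norm_real, Real.norm_of_nonneg ht.le]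
  have h1 : t * ‖W (cpt ξ η)‖ ≤ C * K * t ^ (-lam) * Real.exp (1 / 8 * (t * N)) := by
    have h2 := hKe (t * N) (by positivity)
    rw [Real.mul_rpow ht.le hN, Real.rpow_add ht, Real.rpow_one] at h2
    have htl := Real.rpow_pos_of_pos ht lam
    calc t * ‖W (cpt ξ η)‖ ≤ t * (C * N ^ (1 + lam)) := by gcongr
      _ = C * t ^ (-lam) * (t * t ^ lam * N ^ (1 + lam)) := by
          rw [Real.rpow_neg ht.le]; field_simp
      _ ≤ C * t ^ (-lam) * (K * Real.exp (1 / 8 * (t * N))) := by gcongr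
      _ = _ := by ring
  have h2 : Real.exp (t * ‖W (cpt ξ η)‖) ≤ Real.exp (1 / 8 * (t * N)) :=
    Real.exp_le_exp.2 (by nlinarith)
  rw [localFn, norm_mul, norm_kernelFn_cpt]
  calc Real.exp (-(t * (evalC P ξ η).re) - (t • y) ⬝ᵥ η) * ‖Complex.exp (t * W (cpt ξ η)) - 1‖
      ≤ Real.exp (-(t * (rePart P ξ / 2 - A * rePart P η)) - t * (y ⬝ᵥ η)) *
        (C * K * t ^ (-lam) * Real.exp (1 / 8 * (t * N)) * Real.exp (1 / 8 * (t * N))) := by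
        gcongr
        · exact hre ξ η
        · rw [smul_dotProduct, smul_eq_mul]
        · refine (norm_exp_sub_one_le_mul_exp _).trans ?_
          rw [htW]
          gcongr
    _ = C * K * t ^ (-lam) * Real.exp (-(t * (rePart P ξ / 2 - A * rePart P η)) - t * (y ⬝ᵥ η) +
          1 / 8 * (t * N) + 1 / 8 * (t * N)) := by
        rw [Real.exp_add, Real.exp_add]; ring
    _ ≤ C * K * t ^ (-lam) * Real.exp (-(t * (y ⬝ᵥ η - (A + 1) * rePart P η)) +
          -(t * (1 / 4) * rePart P ξ)) := by
        refine mul_le_mul_of_nonneg_left (Real.exp_le_exp.2 ?_) (by positivity)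
        have := mul_nonneg ht.le hRη
        simp only [N]
        nlinarith
    _ = _ := by rw [Real.exp_add]; ring

lemma norm_cpt_lt {ξ η : Fin d → ℝ} {r : ℝ} (hr : 0 < r) (hξ : ‖ξ‖ < r / 2) (hη : ‖η‖ < r / 2) :
    ‖cpt ξ η‖ < r := by
  refine (pi_norm_lt_iff hr).2 fun j => ?_
  calc ‖cpt ξ η j‖ ≤ |ξ j| + |η j| := (norm_sub_le _ _).trans (by simp [Complex.norm_real])
    _ ≤ ‖ξ‖ + ‖η‖ := add_le_add (norm_le_pi_norm ξ j) (norm_le_pi_norm η j)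
    _ < r := by linarith

/-- The local error, after shifting the contour by a small vector. -/
lemma IsPosHom.exists_shifted_le (hP : IsPosHom P) {E : Matrix (Fin d) (Fin d) ℝ}
    (hE : E ∈ expSet P) {W : (Fin d → ℂ) → ℂ} {lam C r : ℝ}
    (hlam : 0 < lam) (hC : 0 < C) (hr : 0 < r) (hWd : DifferentiableOn ℂ W (Metric.ball 0 r))
    (hW : ∀ ξ η : Fin d → ℝ, ‖ξ‖ < r → ‖η‖ < r →
      ‖W (cpt ξ η)‖ ≤ C * (rePart P ξ + rePart P η) ^ (1 + lam)) :
    ∃ δ₀ > 0, ∃ B > 0, ∃ A > 0, ∀ δ : ℝ, 0 < δ → δ ≤ δ₀ → ∀ L : ℝ, ∃ c > 0, ∃ D > 0, ∃ η₀ > 0,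
      ∀ t : ℝ, 1 ≤ t → ∀ y η : Fin d → ℝ, ‖y‖ ≤ L → ‖η‖ ≤ η₀ →
      ‖∫ ξ, scaledBump d δ ξ • localFn P W t y (toComplex ξ)‖ ≤
        B * t ^ (-(E.trace + lam)) * Real.exp (-(t * (y ⬝ᵥ η - A * rePart P η))) +
          D * Real.exp (-(c * t)) := by
  obtain ⟨r₀, hr₀, hr₀r, B, hB, A, hA, hloc⟩ := hP.exists_localFn_le hlam hC hr hW
  have hI := hP.integral_exp_neg_pos (c := 1 / 4) (by norm_num)
  refine ⟨r₀ / 8, by positivity, B * ∫ ξ, Real.exp (-(1 / 4 * rePart P ξ)), by positivity, A, hA,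
    fun δ hδ hδ₀ L => ?_⟩
  obtain ⟨m, hm, hmin⟩ := hP.exists_pos_le_annulus hδ (2 * δ)
  -- the size of the admissible shifts
  obtain ⟨η₀, hη₀, hη₀r, hη₀L, hη₀R⟩ : ∃ η₀ > 0, η₀ ≤ r₀ / 4 ∧ d * |L| * η₀ ≤ m / 16 ∧
      ∀ η : Fin d → ℝ, ‖η‖ ≤ η₀ → A * rePart P η ≤ m / 16 := by
    have h0 : Tendsto (fun η => A * rePart P η) (𝓝 0) (𝓝 0) :=
      (continuous_const.mul (continuous_rePart (P := P))).tendsto' 0 0 (by simp [hP.rePart_zero])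
    obtain ⟨s, hs, h⟩ := Metric.eventually_nhds_iff.1
      (h0.eventually (gt_mem_nhds (show 0 < m / 16 by positivity)))
    refine ⟨min (min (r₀ / 4) (s / 2)) (m / (16 * (d * |L| + 1))), by positivity,
      (min_le_left _ _).trans (min_le_left _ _), ?_, fun η hη => (h ?_).le⟩
    · calc (d : ℝ) * |L| * min (min (r₀ / 4) (s / 2)) (m / (16 * (d * |L| + 1)))
          ≤ (d * |L| + 1) * (m / (16 * (d * |L| + 1))) := by
            gcongr
            · linarith
            · exact min_le_right _ _
        _ = m / 16 := by field_simp
    · rw [dist_zero_right]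
      have := hη.trans ((min_le_left _ _).trans (min_le_right _ _))
      linarith
  have hcs := hasCompactSupport_scaledBump (d := d) hδ
  have hDc : Continuous fun ξ => fderiv ℝ (scaledBump d δ) ξ :=
    (contDiff_scaledBump _).continuous_fderiv one_ne_zero
  have hDi : Integrable fun ξ => ‖fderiv ℝ (scaledBump d δ) ξ‖ :=
    hDc.norm.integrable_of_hasCompactSupport (hcs.fderiv ℝ).norm
  have hD0 : 0 ≤ ∫ ξ, ‖fderiv ℝ (scaledBump d δ) ξ‖ := integral_nonneg fun _ => norm_nonneg _
  refine ⟨m / 8, by positivity, (∫ ξ, ‖fderiv ℝ (scaledBump d δ) ξ‖) * η₀ * B + 1, by positivity,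
    η₀, hη₀, fun t ht y η hy hη => ?_⟩
  have ht0 : 0 < t := by linarith
  have htl : t ^ (-lam) ≤ 1 := Real.rpow_le_one_of_one_le_of_nonpos ht (by linarith)
  have hsupp : ∀ ξ ∈ tsupport (scaledBump d δ), ‖ξ‖ < r₀ / 2 ∧ ‖ξ‖ ≤ 2 * δ := fun ξ hξ => by
    have := mem_closedBall_zero_iff.1 (tsupport_scaledBump_subset hδ hξ)
    exact ⟨by linarith, this⟩
  have hητ : ∀ τ ∈ Set.Icc (0 : ℝ) 1, ‖τ • η‖ ≤ ‖η‖ := fun τ hτ => by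
    rw [norm_smul, Real.norm_of_nonneg hτ.1]
    exact mul_le_of_le_one_left (norm_nonneg _) hτ.2
  have hDη : ∀ ξ, |fderiv ℝ (scaledBump d δ) ξ η| ≤ ‖fderiv ℝ (scaledBump d δ) ξ‖ * η₀ := fun ξ =>
    ((fderiv ℝ (scaledBump d δ) ξ).le_opNorm η).trans (by gcongr)
  -- Where the cutoff varies, R ≥ m, so the decay e^{-tm/4} meets a shift cost of at most e^{t(m/16
  -- + m/16)}.
  set G : ℝ := B * Real.exp (-(m / 8 * t))
  have hshift := norm_integral_shift_le (f := localFn P W t y) Metric.isOpen_ball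
    (differentiableOn_localFn hWd t y) (contDiff_scaledBump δ) hcs η
    (fun ξ hξ τ hτ => by
      rw [mem_ball_zero_iff]
      exact norm_cpt_lt hr (by linarith [(hsupp ξ hξ).1]) (by linarith [hητ τ hτ]))
    (g := fun _ => G)
    (fun ξ hξ hne τ hτ => by
      have h1 : δ ≤ ‖ξ‖ := by
        by_contra! h
        exact hne (fderiv_scaledBump_eq_zero hδ h η)
      have h2 := hmin ξ h1 (hsupp ξ hξ).2
      have h3 := hητ τ hτ
      refine (hloc t ht0 y ξ (τ • η) (by linarith [(hsupp ξ hξ).1]) (by linarith)).trans ?_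
      have h4 : -(m / 16) ≤ y ⬝ᵥ (τ • η) := by
        have h5 := abs_dotProduct_le y (τ • η)
        have h6 : (d : ℝ) * ‖y‖ * ‖τ • η‖ ≤ d * |L| * η₀ := by
          gcongr
          · exact hy.trans (le_abs_self L)
          · exact h3.trans hη
        linarith [neg_abs_le (y ⬝ᵥ (τ • η))]
      have h7 := hη₀R (τ • η) (h3.trans hη)
      calc B * t ^ (-lam) * Real.exp (-(t * (y ⬝ᵥ (τ • η) - A * rePart P (τ • η)))) *
            Real.exp (-(t * (1 / 4) * rePart P ξ))
          ≤ B * 1 * Real.exp (-(t * (-(m / 16) - m / 16))) * Real.exp (-(t * (1 / 4) * m)) := by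
            gcongr
        _ = G := by
            rw [mul_one, mul_assoc, ← Real.exp_add]
            simp only [G]
            ring_nf)
    (((hDc.clm_apply continuous_const).abs.integrable_of_hasCompactSupport
      (hcs.fderiv_apply ℝ η).norm).mul_const G)
  have hGi : ∫ ξ, |fderiv ℝ (scaledBump d δ) ξ η| * G ≤
      (∫ ξ, ‖fderiv ℝ (scaledBump d δ) ξ‖) * η₀ * B * Real.exp (-(m / 8 * t)) := by
    calc ∫ ξ, |fderiv ℝ (scaledBump d δ) ξ η| * G ≤ ∫ ξ, ‖fderiv ℝ (scaledBump d δ) ξ‖ * (η₀ * G) := by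
          refine integral_mono (((hDc.clm_apply continuous_const).abs.integrable_of_hasCompactSupport
            (hcs.fderiv_apply ℝ η).norm).mul_const G) (hDi.mul_const _) fun ξ => ?_
          have := mul_le_mul_of_nonneg_right (hDη ξ) (show 0 ≤ G by positivity)
          simp only
          linarith
      _ = _ := by rw [integral_mul_const]; simp only [G]; ring
  have hmain : ‖∫ ξ, scaledBump d δ ξ • localFn P W t y (cpt ξ η)‖ ≤
      B * t ^ (-lam) * Real.exp (-(t * (y ⬝ᵥ η - A * rePart P η))) *
        (t ^ (-E.trace) * ∫ ξ, Real.exp (-(1 / 4 * rePart P ξ))) := by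
    rw [← integral_exp_neg_mul hE ht0, ← integral_const_mul]
    refine norm_integral_le_of_norm_le ((hP.integrable_exp_neg (by positivity)).const_mul _)
      (Eventually.of_forall fun ξ => ?_)
    rw [norm_smul, Real.norm_of_nonneg (scaledBump_nonneg _ _)]
    by_cases hξ : ξ ∈ tsupport (scaledBump d δ)
    · exact (mul_le_of_le_one_left (norm_nonneg _) (scaledBump_le_one _ _)).trans
        (hloc t ht0 y ξ η (by linarith [(hsupp ξ hξ).1]) (by linarith))
    · rw [image_eq_zero_of_notMem_tsupport hξ, zero_mul]
      positivity
  have htr : t ^ (-(E.trace + lam)) = t ^ (-E.trace) * t ^ (-lam) := by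
    rw [← Real.rpow_add ht0]; ring_nf
  have htri := norm_sub_norm_le (∫ ξ, scaledBump d δ ξ • localFn P W t y (toComplex ξ))
    (∫ ξ, scaledBump d δ ξ • localFn P W t y (cpt ξ η))
  rw [norm_sub_rev] at htri
  rw [htr]
  have hexp := Real.exp_pos (-(m / 8 * t))
  calc _ ≤ _ := by linarith
    _ ≤ B * t ^ (-lam) * Real.exp (-(t * (y ⬝ᵥ η - A * rePart P η))) *
        (t ^ (-E.trace) * ∫ ξ, Real.exp (-(1 / 4 * rePart P ξ))) +
        ((∫ ξ, ‖fderiv ℝ (scaledBump d δ) ξ‖) * η₀ * B * Real.exp (-(m / 8 * t)) +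
          Real.exp (-(m / 8 * t))) := by
      have := hshift.trans hGi
      linarith
    _ = _ := by ring

/-- The local error estimate. -/
theorem IsPosHom.exists_local_le (hP : IsPosHom P) {E : Matrix (Fin d) (Fin d) ℝ}
    (hE : E ∈ expSet P) {W : (Fin d → ℂ) → ℂ} {lam C r : ℝ}
    (hlam : 0 < lam) (hC : 0 < C) (hr : 0 < r) (hWd : DifferentiableOn ℂ W (Metric.ball 0 r))
    (hW : ∀ ξ η : Fin d → ℝ, ‖ξ‖ < r → ‖η‖ < r →
      ‖W (cpt ξ η)‖ ≤ C * (rePart P ξ + rePart P η) ^ (1 + lam)) :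
    ∃ δ₀ > 0, ∀ δ : ℝ, 0 < δ → δ ≤ δ₀ → ∀ L : ℝ, ∃ K > 0, ∃ M > 0,
      ∀ t : ℝ, 1 ≤ t → ∀ y : Fin d → ℝ, ‖y‖ ≤ L →
      ‖∫ ξ, scaledBump d δ ξ • localFn P W t y (toComplex ξ)‖ ≤
        K * t ^ (-(E.trace + lam)) * Real.exp (-(t * M * legendre P y)) := by
  obtain ⟨δ₀, hδ₀, B, hB, A, hA, h⟩ := hP.exists_shifted_le hE hlam hC hr hWd hW
  refine ⟨δ₀, hδ₀, fun δ hδ hδδ L => ?_⟩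
  obtain ⟨c, hc, D, hD, η₀, hη₀, h⟩ := h δ hδ hδδ L
  obtain ⟨K', hK', hdot⟩ := hP.exists_dotProduct_le L
  obtain ⟨S, hS, hSle⟩ := hP.exists_sub_le L
  obtain ⟨θ₁, hθ₁, hsm⟩ := hP.rePart_smul_le (ε := 1 / A) (by positivity)
  obtain ⟨Q, hQ, hQle⟩ := exists_exp_neg_le_rpow (E.trace + lam) (half_pos hc)
  -- The first bound makes A R(θν) ≤ θR(ν); the second keeps θν an admissible shift for all ‖ν‖ ≤
  -- K'.
  set θ := min θ₁ (η₀ / K')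
  have hθ : 0 < θ := by positivity
  -- Since y·ν - R(ν) ≤ S, the second bound lets half of e^{-ct} dominate the Legendre factor.
  set M := min θ (c / 2 / S)
  have hM : 0 < M := by positivity
  refine ⟨B + D * Q, by positivity, M, hM, fun t ht y hy => ?_⟩
  have ht0 : 0 < t := by linarith
  have hta : 0 < t ^ (-(E.trace + lam)) := Real.rpow_pos_of_pos ht0 _
  refine le_mul_exp_legendre (by positivity) (by positivity) fun ν => ?_
  have key : ∀ ν : Fin d → ℝ, ‖ν‖ ≤ K' → 0 ≤ y ⬝ᵥ ν - rePart P ν →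
      ‖∫ ξ, scaledBump d δ ξ • localFn P W t y (toComplex ξ)‖ ≤
        (B + D * Q) * t ^ (-(E.trace + lam)) * Real.exp (-(t * M * (y ⬝ᵥ ν - rePart P ν))) := by
    intro ν hν h0
    set v := y ⬝ᵥ ν - rePart P ν
    have h1 := h t ht y (θ • ν) hy (by
      rw [norm_smul, Real.norm_of_nonneg hθ.le]
      calc θ * ‖ν‖ ≤ η₀ / K' * K' := by gcongr; exact min_le_right _ _
        _ = η₀ := by field_simp)
    have h2 : θ * v ≤ y ⬝ᵥ (θ • ν) - A * rePart P (θ • ν) := by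
      have h3 : A * rePart P (θ • ν) ≤ A * (1 / A * θ * rePart P ν) :=
        mul_le_mul_of_nonneg_left (hsm θ hθ.le (min_le_left _ _) ν) hA.le
      have h4 : A * (1 / A * θ * rePart P ν) = θ * rePart P ν := by field_simp
      rw [dotProduct_smul, smul_eq_mul]
      simp only [v]
      linarith
    have h5 : M * v ≤ θ * v := mul_le_mul_of_nonneg_right (min_le_left _ _) h0
    have h6 : M * v ≤ c / 2 := by
      calc M * v ≤ c / 2 / S * S := by
            gcongr
            · exact min_le_right _ _
            · exact hSle y ν hy
        _ = c / 2 := by field_simp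
    have h7 : Real.exp (-(t * (y ⬝ᵥ (θ • ν) - A * rePart P (θ • ν)))) ≤ Real.exp (-(t * M * v)) := by
      refine Real.exp_le_exp.2 ?_
      have := mul_le_mul_of_nonneg_left (h5.trans h2) ht0.le
      linarith
    have h8 : Real.exp (-(c * t)) ≤ Q * t ^ (-(E.trace + lam)) * Real.exp (-(t * M * v)) := by
      have h9 := hQle t ht
      rw [mul_div_cancel₀ c two_ne_zero] at h9
      refine h9.trans (mul_le_mul_of_nonneg_left (Real.exp_le_exp.2 ?_) (by positivity))
      have := mul_le_mul_of_nonneg_left h6 ht0.le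
      linarith
    calc _ ≤ _ := h1
      _ ≤ B * t ^ (-(E.trace + lam)) * Real.exp (-(t * M * v)) +
          D * (Q * t ^ (-(E.trace + lam)) * Real.exp (-(t * M * v))) := by gcongr
      _ = _ := by ring
  -- For a nonpositive value the unshifted bound ν = 0 suffices; a positive value forces ‖ν‖ < K'.
  rcases le_or_gt (y ⬝ᵥ ν - rePart P ν) 0 with h0 | h0
  · have h1 := key 0 (by simpa using hK'.le) (by simp [hP.rePart_zero])
    rw [dotProduct_zero, hP.rePart_zero, sub_zero, mul_zero, neg_zero, Real.exp_zero] at h1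
    refine h1.trans ?_
    refine mul_le_mul_of_nonneg_left (Real.one_le_exp ?_) (by positivity)
    linarith [mul_nonpos_of_nonneg_of_nonpos (mul_nonneg ht0.le hM.le) h0]
  · refine key ν ?_ h0.le
    by_contra! hcon
    have := hdot y ν hy hcon.le
    linarith

lemma IsPosHom.exists_le_of_le_norm (hP : IsPosHom P) {δ : ℝ} (hδ : 0 < δ) :
    ∃ c > 0, ∀ ξ : Fin d → ℝ, δ ≤ ‖ξ‖ → c ≤ rePart P ξ := by
  obtain ⟨K, hK, hgr⟩ := hP.exists_growth one_pos
  obtain ⟨m, hm, hmin⟩ := hP.exists_pos_le_annulus hδ K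
  refine ⟨min m K, lt_min hm hK, fun ξ hξ => ?_⟩
  rcases le_total ‖ξ‖ K with h | h
  · exact (min_le_left _ _).trans (hmin ξ hξ h)
  · have := hgr ξ h
    exact (min_le_right _ _).trans (by linarith)

/-- The part of the heat kernel integral away from the origin is exponentially small. -/
lemma IsPosHom.exists_tail_le (hP : IsPosHom P) {δ : ℝ} (hδ : 0 < δ) :
    ∃ c > 0, ∃ D > 0, ∀ t : ℝ, 1 ≤ t → ∀ x : Fin d → ℝ,
      ‖(∫ ξ, kernelFn P t x (toComplex ξ)) -
        ∫ ξ, scaledBump d δ ξ • kernelFn P t x (toComplex ξ)‖ ≤ D * Real.exp (-(c * t)) := by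
  obtain ⟨c, hc, hlow⟩ := hP.exists_le_of_le_norm hδ
  have hI := hP.integral_exp_neg_pos one_pos
  refine ⟨c, hc, Real.exp c * ∫ ξ, Real.exp (-(1 * rePart P ξ)), by positivity, fun t ht x => ?_⟩
  have ht0 : 0 < t := by linarith
  have hk : Continuous fun ξ => kernelFn P t x (toComplex ξ) :=
    (differentiable_kernelFn t x).continuous.comp continuous_toComplex
  have hn : ∀ ξ, ‖kernelFn P t x (toComplex ξ)‖ = Real.exp (-(t * rePart P ξ)) := fun ξ => by
    have := norm_kernelFn_cpt (P := P) t x ξ 0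
    rw [cpt_zero_right, dotProduct_zero, sub_zero, evalC, cpt_zero_right] at this
    exact this
  have hki : Integrable fun ξ => kernelFn P t x (toComplex ξ) :=
    (hP.integrable_exp_neg ht0).mono' hk.aestronglyMeasurable (Eventually.of_forall fun ξ => (hn ξ).le)
  have hki' : Integrable fun ξ => scaledBump d δ ξ • kernelFn P t x (toComplex ξ) :=
    (hP.integrable_exp_neg ht0).mono' ((contDiff_scaledBump δ).continuous.smul hk).aestronglyMeasurable
      (Eventually.of_forall fun ξ => by
        rw [norm_smul, Real.norm_of_nonneg (scaledBump_nonneg _ _)]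
        exact (mul_le_of_le_one_left (norm_nonneg _) (scaledBump_le_one _ _)).trans (hn ξ).le)
  rw [← integral_sub hki hki']
  refine (norm_integral_le_of_norm_le ((hP.integrable_exp_neg one_pos).const_mul
    (Real.exp c * Real.exp (-(c * t)))) (Eventually.of_forall fun ξ => ?_)).trans (le_of_eq ?_)
  · rcases le_or_gt δ ‖ξ‖ with h | h
    · have h1 : kernelFn P t x (toComplex ξ) - scaledBump d δ ξ • kernelFn P t x (toComplex ξ) =
          (1 - scaledBump d δ ξ) • kernelFn P t x (toComplex ξ) := by rw [sub_smul, one_smul]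
      rw [h1, norm_smul, Real.norm_of_nonneg (by linarith [scaledBump_le_one δ ξ]), hn]
      refine (mul_le_of_le_one_left (Real.exp_pos _).le
        (by linarith [scaledBump_nonneg δ ξ])).trans ?_
      rw [← Real.exp_add, ← Real.exp_add]
      refine Real.exp_le_exp.2 ?_
      have := hlow ξ h
      nlinarith
    · rw [scaledBump_eq_one hδ h.le, one_smul, sub_self, norm_zero]
      positivity
  · rw [integral_const_mul]; ring

end LocalEstimate

/-! ### Local structure of φ̂ and the order of the remainder. -/

section FourierTransform

variable {d : ℕ} {φ : (Fin d → ℤ) → ℂ} {P : MvPolynomial (Fin d) ℂ}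

lemma norm_toComplex (ξ : Fin d → ℝ) : ‖toComplex ξ‖ = ‖ξ‖ := by
  simp [Pi.norm_def, toComplex, Complex.nnnorm_real]

lemma norm_exp_I_mul (a : ℝ) : ‖Complex.exp (Complex.I * (a : ℂ))‖ = 1 := by
  rw [mul_comm, Complex.norm_exp_ofReal_mul_I]

lemma continuous_fourierT (h : Summable fun x => ‖φ x‖) : Continuous (fourierT φ) := by
  refine continuous_tsum (fun x => ?_) h fun x ξ => ?_
  · unfold dotProduct
    fun_prop
  · rw [norm_mul, norm_exp_I_mul, mul_one]

lemma exp_dotProduct_add_period (x : Fin d → ℤ) (ξ : Fin d → ℝ) (m : Fin d → ℤ) :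
    Complex.exp (Complex.I * ((latticePt x ⬝ᵥ (ξ + (2 * Real.pi) • latticePt m) : ℝ) : ℂ)) =
      Complex.exp (Complex.I * ((latticePt x ⬝ᵥ ξ : ℝ) : ℂ)) := by
  rw [Complex.exp_eq_exp_iff_exists_int]
  refine ⟨x ⬝ᵥ m, ?_⟩
  have h : latticePt x ⬝ᵥ latticePt m = ((x ⬝ᵥ m : ℤ) : ℝ) := by
    simp [dotProduct, latticePt]
  rw [dotProduct_add, dotProduct_smul, h, smul_eq_mul]
  push_cast
  ring

lemma fourierT_add_period (ξ : Fin d → ℝ) (m : Fin d → ℤ) :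
    fourierT φ (ξ + (2 * Real.pi) • latticePt m) = fourierT φ ξ := by
  simp only [fourierT, exp_dotProduct_add_period]

lemma exists_add_period_mem_torus (ξ : Fin d → ℝ) :
    ∃ m : Fin d → ℤ, ξ + (2 * Real.pi) • latticePt m ∈ torus d := by
  have h2 := Real.two_pi_pos
  refine ⟨fun j => -toIocDiv h2 (-Real.pi) (ξ j), fun j => ?_⟩
  have h := sub_toIocDiv_zsmul_mem_Ioc h2 (-Real.pi) (ξ j)
  have h3 : -Real.pi + 2 * Real.pi = Real.pi := by ring
  rw [h3, zsmul_eq_mul] at h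
  convert! h using 1
  simp only [Pi.add_apply, Pi.smul_apply, latticePt, smul_eq_mul]
  push_cast
  ring

lemma IsNormalizedHolo.norm_fourierT_le (hφ : IsNormalizedHolo φ) (ξ : Fin d → ℝ) :
    ‖fourierT φ ξ‖ ≤ 1 := by
  obtain ⟨m, hm⟩ := exists_add_period_mem_torus ξ
  rw [← fourierT_add_period ξ m]
  exact hφ.2.1 ⟨_, hm, rfl⟩

/-- Holomorphy is assumed only near the half-open torus; periodicity transports it to every real
point. -/
lemma IsHolo.exists_extension (hφ : IsHolo φ) (ξ₀ : Fin d → ℝ) :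
    ∃ r > 0, ∃ G : (Fin d → ℂ) → ℂ, DifferentiableOn ℂ G (Metric.ball 0 r) ∧
      ∀ ξ : Fin d → ℝ, ‖ξ‖ < r → G (toComplex ξ) = fourierT φ (ξ + ξ₀) := by
  obtain ⟨-, U, F, hU, hT, hF, hFφ⟩ := hφ
  obtain ⟨m, hm⟩ := exists_add_period_mem_torus ξ₀
  set ζ := ξ₀ + (2 * Real.pi) • latticePt m
  obtain ⟨r, hr, hball⟩ := Metric.isOpen_iff.1 hU _ (hT _ hm)
  have hmem : ∀ z : Fin d → ℂ, ‖z‖ < r → z + toComplex ζ ∈ U := fun z hz => hball (by simpa using hz)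
  refine ⟨r, hr, fun z => F (z + toComplex ζ), hF.comp (by fun_prop) fun z hz =>
    hmem z (mem_ball_zero_iff.1 hz), fun ξ hξ => ?_⟩
  have h1 : toComplex ξ + toComplex ζ = toComplex (ξ + ζ) := by
    ext j; simp [toComplex]
  have h2 := hmem (toComplex ξ) (by rwa [norm_toComplex])
  rw [h1] at h2
  simp only [h1]
  rw [hFφ _ h2, ← fourierT_add_period (ξ + ξ₀) m, add_assoc]

lemma IsHolo.analyticAt_line (hφ : IsHolo φ) (ζ v : Fin d → ℝ) (s : ℝ) :
    AnalyticAt ℝ (fun s : ℝ => fourierT φ (ζ + s • v)) s := by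
  obtain ⟨r, hr, G, hG, hGφ⟩ := hφ.exists_extension (ζ + s • v)
  set g : ℂ → Fin d → ℂ := fun w => (w - s) • toComplex v
  have hg : Differentiable ℂ g := by fun_prop
  have hU : IsOpen (g ⁻¹' Metric.ball 0 r) := Metric.isOpen_ball.preimage hg.continuous
  have hs : (s : ℂ) ∈ g ⁻¹' Metric.ball 0 r := by simp [g, hr]
  have h1 : AnalyticAt ℂ (G ∘ g) (s : ℂ) :=
    (hG.comp hg.differentiableOn fun _ h => h).analyticAt (hU.mem_nhds hs)
  have h2 : AnalyticAt ℝ ((G ∘ g) ∘ Complex.ofRealCLM) s :=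
    (h1.restrictScalars (𝕜 := ℝ)).comp (f := Complex.ofRealCLM)
      (Complex.ofRealCLM.analyticAt s)
  refine h2.congr ?_
  have h3 : ∀ᶠ w : ℝ in 𝓝 s, (w : ℂ) ∈ g ⁻¹' Metric.ball 0 r :=
    Complex.continuous_ofReal.continuousAt.eventually (hU.mem_nhds hs)
  filter_upwards [h3] with w hw
  have h4 : g w = toComplex ((w - s) • v) := by
    ext j; simp [g, toComplex]
  have h5 : ‖(w - s) • v‖ < r := by
    rw [← norm_toComplex, ← h4]; exact mem_ball_zero_iff.1 hw
  simp only [Function.comp_apply, Complex.ofRealCLM_apply, h4]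
  rw [hGφ _ h5]
  congr 1
  rw [sub_smul]
  abel

lemma analyticAt_exp_line (α v : Fin d → ℝ) (P : MvPolynomial (Fin d) ℂ) (A : ℂ) (s : ℝ) :
    AnalyticAt ℝ (fun s : ℝ => A * Complex.exp (Complex.I * ((α ⬝ᵥ (s • v) : ℝ) : ℂ) -
      evalR P (s • v))) s := by
  set f : ℂ → ℂ := fun w => A * Complex.exp (Complex.I * (w * ((α ⬝ᵥ v : ℝ) : ℂ)) -
    MvPolynomial.eval (w • toComplex v) P)
  have hf : Differentiable ℂ f := by
    have h1 : Differentiable ℂ fun w : ℂ => MvPolynomial.eval (w • toComplex v) P :=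
      differentiable_eval_comp (differentiable_id.smul_const _)
    fun_prop
  have h1 : AnalyticAt ℝ (f ∘ Complex.ofRealCLM) s :=
    (((hf.analyticAt (s : ℂ)).restrictScalars (𝕜 := ℝ))).comp (f := Complex.ofRealCLM)
      (Complex.ofRealCLM.analyticAt s)
  refine h1.congr (Eventually.of_forall fun w => ?_)
  have h2 : (w : ℂ) • toComplex v = toComplex (w • v) := by
    ext j; simp [toComplex]
  simp only [Function.comp_apply, Complex.ofRealCLM_apply, f, h2, evalR, dotProduct_smul, smul_eq_mul]
  push_cast
  rfl

/-- A maximizer of `|φ̂|` of positive-homogeneous type: the remainder does not vanish near `0`. -/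
lemma IsHolo.not_forall_eq_exp (hd : 0 < d) (hφ : IsHolo φ) (hP : IsPosHom P)
    {ξ₀ : Fin d → ℝ} (h0 : ‖fourierT φ ξ₀‖ = 1) (α : Fin d → ℝ) {r : ℝ} (hr : 0 < r) :
    ¬ ∀ ξ : Fin d → ℝ, ‖ξ‖ < r → fourierT φ (ξ + ξ₀) =
      fourierT φ ξ₀ * Complex.exp (Complex.I * ((α ⬝ᵥ ξ : ℝ) : ℂ) - evalR P ξ) := by
  intro h
  set v : Fin d → ℝ := Pi.single ⟨0, hd⟩ 1
  have hv : ‖v‖ = 1 := by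
    rw [Pi.norm_single, norm_one]
  -- Both sides are real-analytic on the whole line, so the local identity is global. One period
  -- away the left side has modulus 1 and the right side e^{-R} < 1.
  have hEq := AnalyticOnNhd.eq_of_eventuallyEq (z₀ := 0)
    (f := fun s : ℝ => fourierT φ (ξ₀ + s • v))
    (g := fun s : ℝ => fourierT φ ξ₀ * Complex.exp (Complex.I * ((α ⬝ᵥ (s • v) : ℝ) : ℂ) -
      evalR P (s • v)))
    (fun s _ => hφ.analyticAt_line ξ₀ v s) (fun s _ => analyticAt_exp_line α v P _ s) (by
      filter_upwards [Metric.ball_mem_nhds (0 : ℝ) hr] with s hs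
      rw [add_comm]
      exact h _ (by rwa [norm_smul, hv, mul_one, ← mem_ball_zero_iff]))
  have h1 := congrArg norm (congrFun hEq (2 * Real.pi))
  have h2 : v = latticePt (Pi.single ⟨0, hd⟩ 1 : Fin d → ℤ) := by
    ext j; by_cases hj : j = ⟨0, hd⟩ <;> simp [v, latticePt, hj]
  have h3 : (2 * Real.pi) • v ≠ 0 :=
    smul_ne_zero Real.two_pi_pos.ne' fun hv0 => by simp [hv0] at hv
  have h4 := hP.rePart_pos h3
  simp only [norm_mul, h0, one_mul, Complex.norm_exp] at h1
  rw [h2, fourierT_add_period, h0, ← h2] at h1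
  have h5 : (Complex.I * ((α ⬝ᵥ ((2 * Real.pi) • v) : ℝ) : ℂ) - evalR P ((2 * Real.pi) • v)).re =
      -rePart P ((2 * Real.pi) • v) := by
    simp [rePart]
  rw [h5] at h1
  have h6 : Real.exp (-rePart P ((2 * Real.pi) • v)) < 1 := Real.exp_lt_one_iff.2 (by linarith)
  linarith

lemma IsPosHom.exists_sublevel_subset_ball (hP : IsPosHom P) {δ : ℝ} (hδ : 0 < δ) :
    ∃ c > 0, ∀ ξ : Fin d → ℝ, rePart P ξ < c → ‖ξ‖ < δ := by
  obtain ⟨c, hc, h⟩ := hP.exists_le_of_le_norm hδ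
  exact ⟨c, hc, fun ξ hξ => by
    by_contra! hcon
    exact absurd (h ξ hcon) (not_le.2 hξ)⟩

/-- The local structure of `φ̂` at a maximizer of positive-homogeneous type. -/
theorem IsHolo.exists_localData (hd : 0 < d) (hφ : IsHolo φ) {ξ₀ α : Fin d → ℝ}
    (h0 : ‖fourierT φ ξ₀‖ = 1) (hP : IsPosHomType φ ξ₀ α P) :
    ∃ lam : ℝ, 0 < lam ∧ ∃ W : (Fin d → ℂ) → ℂ, ∃ r > 0, ∃ C > 0,
      DifferentiableOn ℂ W (Metric.ball 0 r) ∧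
      (∀ ξ : Fin d → ℝ, ‖ξ‖ < r → W (toComplex ξ) = remainder φ ξ₀ α P ξ) ∧
      (∀ ξ : Fin d → ℝ, ‖ξ‖ < r → fourierT φ (ξ + ξ₀) = fourierT φ ξ₀ *
        Complex.exp (Complex.I * ((α ⬝ᵥ ξ : ℝ) : ℂ) - evalR P ξ + W (toComplex ξ))) ∧
      (∀ ξ η : Fin d → ℝ, ‖ξ‖ < r → ‖η‖ < r →
        ‖W (cpt ξ η)‖ ≤ C * (rePart P ξ + rePart P η) ^ (1 + lam)) ∧
      ∃ c > 0, ∀ᶠ t in 𝓝[>] 0, ∃ ξ, rePart P ξ ≤ t ∧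
        c * t ^ (1 + lam) ≤ ‖remainder φ ξ₀ α P ξ‖ := by
  obtain ⟨r, hr, G, hG, hGφ⟩ := hφ.exists_extension ξ₀
  have hF0 : fourierT φ ξ₀ ≠ 0 := fun h => by simp [h] at h0
  have hG0 : G 0 = fourierT φ ξ₀ := by
    have := hGφ 0 (by simpa using hr)
    have h2 : toComplex (0 : Fin d → ℝ) = 0 := by ext j; simp [toComplex]
    rwa [zero_add, h2] at this
  have hGc : ContinuousAt (fun z => G z / fourierT φ ξ₀) 0 :=
    ((hG 0 (Metric.mem_ball_self hr)).differentiableAt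
      (Metric.ball_mem_nhds 0 hr)).continuousAt.div_const _
  have hslit : ∀ᶠ z in 𝓝 (0 : Fin d → ℂ), G z / fourierT φ ξ₀ ∈ Complex.slitPlane :=
    hGc.eventually (Complex.isOpen_slitPlane.mem_nhds (by
      simp [hG0, div_self hF0]))
  obtain ⟨r₁, hr₁, hs⟩ := Metric.eventually_nhds_iff_ball.1 hslit
  -- The holomorphic extension of the remainder; the principal logarithm is holomorphic because the
  -- quotient is near 1.
  set W : (Fin d → ℂ) → ℂ := fun z =>
    Complex.log (G z / fourierT φ ξ₀) - Complex.I * (∑ j, (α j : ℂ) * z j) + MvPolynomial.eval z P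
  set r₂ := min r r₁
  have hr₂ : 0 < r₂ := lt_min hr hr₁
  have hW : DifferentiableOn ℂ W (Metric.ball 0 r₂) := by
    have h1 : DifferentiableOn ℂ (fun z => Complex.log (G z / fourierT φ ξ₀)) (Metric.ball 0 r₂) := by
      intro z hz
      have h2 : DifferentiableWithinAt ℂ (fun z => G z / fourierT φ ξ₀) (Metric.ball 0 r₂) z := by
        simp only [div_eq_mul_inv]
        exact (hG.mono (Metric.ball_subset_ball (min_le_left _ _)) z hz).mul_const _
      exact (Complex.differentiableAt_log (hs z (Metric.ball_subset_ball (min_le_right _ _)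
        hz))).comp_differentiableWithinAt z h2
    have h2 : Differentiable ℂ fun z : Fin d → ℂ => Complex.I * ∑ j, (α j : ℂ) * z j := by fun_prop
    have h3 : Differentiable ℂ fun z : Fin d → ℂ => MvPolynomial.eval z P :=
      fun z => ((AnalyticOnNhd.eval_mvPolynomial P) z trivial).differentiableAt
    exact (h1.sub h2.differentiableOn).add h3.differentiableOn
  have hdot : ∀ ξ : Fin d → ℝ, ∑ j, (α j : ℂ) * toComplex ξ j = ((α ⬝ᵥ ξ : ℝ) : ℂ) := fun ξ => by
    simp [dotProduct, toComplex]
  have hWre : ∀ ξ : Fin d → ℝ, ‖ξ‖ < r₂ → W (toComplex ξ) = remainder φ ξ₀ α P ξ := fun ξ hξ => by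
    simp only [W, remainder, logRatio, hdot, hGφ ξ (hξ.trans_le (min_le_left _ _)), evalR]
  have hfac : ∀ ξ : Fin d → ℝ, ‖ξ‖ < r₂ → fourierT φ (ξ + ξ₀) = fourierT φ ξ₀ *
      Complex.exp (Complex.I * ((α ⬝ᵥ ξ : ℝ) : ℂ) - evalR P ξ + W (toComplex ξ)) := fun ξ hξ => by
    have h1 := hs (toComplex ξ) (by
      rw [mem_ball_zero_iff, norm_toComplex]; exact hξ.trans_le (min_le_right _ _))
    rw [hGφ ξ (hξ.trans_le (min_le_left _ _))] at h1
    have h2 : Complex.I * ((α ⬝ᵥ ξ : ℝ) : ℂ) - evalR P ξ + W (toComplex ξ) =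
        Complex.log (fourierT φ (ξ + ξ₀) / fourierT φ ξ₀) := by
      rw [hWre ξ hξ, remainder, logRatio]; ring
    rw [h2, Complex.exp_log (Complex.slitPlane_ne_zero h1), mul_div_cancel₀ _ hF0]
  obtain ⟨lam, hlam, ⟨C, hC, r₃, hr₃, hup⟩, c, hc, hlow⟩ := hP.1.exists_order hr₂ hW (by
      intro r' hr'
      by_contra! hz
      refine hφ.not_forall_eq_exp hd hP.1 h0 α (lt_min hr' hr₂) fun ξ hξ => ?_
      rw [hfac ξ (hξ.trans_le (min_le_right _ _)), hz (toComplex ξ) (by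
        rw [mem_ball_zero_iff, norm_toComplex]; exact hξ.trans_le (min_le_left _ _)), add_zero])
    (hP.2.congr' (by
      filter_upwards [Metric.ball_mem_nhds (0 : Fin d → ℝ) hr₂] with ξ hξ
      rw [hWre ξ (mem_ball_zero_iff.1 hξ)]) EventuallyEq.rfl)
  obtain ⟨s₀, hs₀, hsub⟩ := hP.1.exists_sublevel_subset_ball hr₂
  refine ⟨lam, hlam, W, min r₂ r₃, lt_min hr₂ hr₃, C, hC,
    hW.mono (Metric.ball_subset_ball (min_le_left _ _)),
    fun ξ hξ => hWre ξ (hξ.trans_le (min_le_left _ _)),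
    fun ξ hξ => hfac ξ (hξ.trans_le (min_le_left _ _)),
    fun ξ η hξ hη => hup ξ η (hξ.trans_le (min_le_right _ _)) (hη.trans_le (min_le_right _ _)),
    c, hc, ?_⟩
  filter_upwards [hlow, nhdsWithin_le_nhds (gt_mem_nhds hs₀)] with t ⟨ξ, hξ, h⟩ ht
  exact ⟨ξ, hξ, by rwa [hWre ξ (hsub ξ (hξ.trans_lt ht))] at h⟩

/-- The order of a remainder with matching upper and lower bounds. -/
theorem IsPosHom.isLUB_orderSet (hP : IsPosHom P) {E : Matrix (Fin d) (Fin d) ℝ}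
    (hE : E ∈ expSet P) {Υ : (Fin d → ℝ) → ℂ} {lam C r : ℝ} (hlam : 0 < lam) (hC : 0 < C)
    (hr : 0 < r) (hup : ∀ ξ, ‖ξ‖ < r → ‖Υ ξ‖ ≤ C * rePart P ξ ^ (1 + lam))
    (hlow : ∃ c > 0, ∀ᶠ t in 𝓝[>] 0, ∃ ξ, rePart P ξ ≤ t ∧ c * t ^ (1 + lam) ≤ ‖Υ ξ‖) :
    IsLUB (orderSet P Υ E) lam := by
  obtain ⟨s₀, hs₀, hsub⟩ := hP.exists_sublevel_subset_ball hr
  obtain ⟨c, hc, hlow⟩ := hlow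
  set S : ℝ → Set ℝ := fun t => (fun ξ => ‖Υ (dil E t *ᵥ ξ)‖) '' {ξ | rePart P ξ ≤ 1}
  have hub : ∀ t, 0 < t → t < s₀ → ∀ v ∈ S t, v ≤ C * t ^ (1 + lam) := by
    rintro t ht hts _ ⟨ξ, hξ, rfl⟩
    have hξ : rePart P ξ ≤ 1 := hξ
    have h1 : rePart P (dil E t *ᵥ ξ) ≤ t := by
      rw [rePart_dil hE ht]; exact mul_le_of_le_one_right ht.le hξ
    refine (hup _ (hsub _ (h1.trans_lt hts))).trans ?_
    have := hP.2.1 (dil E t *ᵥ ξ)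
    gcongr
  have hne : ∀ t, (S t).Nonempty := fun t => ⟨_, 0, by
    show rePart P 0 ≤ 1
    rw [hP.rePart_zero]; exact zero_le_one, rfl⟩
  have hsup0 : ∀ t, 0 ≤ sSup (S t) := fun t => Real.sSup_nonneg (by
    rintro _ ⟨ξ, -, rfl⟩; exact norm_nonneg _)
  have hsmall : ∀ᶠ t : ℝ in 𝓝[>] 0, 0 < t ∧ t < s₀ := by
    filter_upwards [self_mem_nhdsWithin, nhdsWithin_le_nhds (gt_mem_nhds hs₀)] with t h1 h2
    exact ⟨h1, h2⟩
  have hmem : ∀ γ, 0 ≤ γ → γ < lam → γ ∈ orderSet P Υ E := fun γ hγ hγl => by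
    refine ⟨hγ, squeeze_zero' (g := fun t : ℝ => C * t ^ (lam - γ)) ?_ ?_ ?_⟩
    · filter_upwards [hsmall] with t ht
      exact mul_nonneg (Real.rpow_nonneg ht.1.le _) (hsup0 t)
    · filter_upwards [hsmall] with t ht
      calc t ^ (-(1 + γ)) * sSup (S t) ≤ t ^ (-(1 + γ)) * (C * t ^ (1 + lam)) :=
            mul_le_mul_of_nonneg_left (csSup_le (hne t) (hub t ht.1 ht.2))
              (Real.rpow_nonneg ht.1.le _)
        _ = C * (t ^ (-(1 + γ)) * t ^ (1 + lam)) := by ring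
        _ = C * t ^ (lam - γ) := by rw [← Real.rpow_add ht.1]; ring_nf
    · have h1 : Continuous fun t : ℝ => C * t ^ (lam - γ) :=
        continuous_const.mul (continuous_id.rpow_const fun _ => Or.inr (by linarith))
      exact (h1.tendsto' 0 0 (by
        rw [Real.zero_rpow (by linarith), mul_zero])).mono_left nhdsWithin_le_nhds
  refine ⟨fun γ hγ => ?_, fun b hb => ?_⟩
  · by_contra! hlt
    -- For γ > λ the lower bound keeps the quotient above c t^{λ-γ} ≥ c, so it cannot tend to 0.
    have h1 : ∀ᶠ t : ℝ in 𝓝[>] 0, c ≤ t ^ (-(1 + γ)) * sSup (S t) := by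
      filter_upwards [hlow, hsmall, nhdsWithin_le_nhds (gt_mem_nhds one_pos)] with t ⟨ξ, hξ, h⟩ ht ht1
      have h2 : ‖Υ ξ‖ ∈ S t := ⟨dil E t⁻¹ *ᵥ ξ, by
        show rePart P _ ≤ 1
        rw [rePart_dil hE (inv_pos.2 ht.1), inv_mul_le_iff₀ ht.1, mul_one]
        exact hξ, by
        simp only
        rw [dil_mulVec_inv ht.1]⟩
      -- The upper bound is used as well: for an unbounded set `sSup` would take the default value
      -- 0.
      have h3 := h.trans (le_csSup ⟨_, hub t ht.1 ht.2⟩ h2)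
      calc c ≤ c * t ^ (lam - γ) :=
            le_mul_of_one_le_right hc.le
              (Real.one_le_rpow_of_pos_of_le_one_of_nonpos ht.1 (le_of_lt ht1) (by linarith))
        _ = t ^ (-(1 + γ)) * (c * t ^ (1 + lam)) := by
            have : lam - γ = -(1 + γ) + (1 + lam) := by ring
            rw [this, Real.rpow_add ht.1]; ring
        _ ≤ _ := mul_le_mul_of_nonneg_left h3 (Real.rpow_nonneg ht.1.le _)
    exact absurd (ge_of_tendsto hγ.2 h1) (not_le.2 hc)
  · by_contra! hlt
    have h0 : 0 ≤ b := hb (hmem 0 le_rfl hlam)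
    have := hb (hmem ((b + lam) / 2) (by linarith) (by linarith))
    linarith

end FourierTransform

/-! ### Convolution powers and Fourier inversion on the lattice. -/

section Inversion

variable {d : ℕ} {φ ψ : (Fin d → ℤ) → ℂ}

lemma latticePt_add (x y : Fin d → ℤ) : latticePt (x + y) = latticePt x + latticePt y := by
  ext j; simp [latticePt]

lemma exp_add_dotProduct (x y : Fin d → ℤ) (ξ : Fin d → ℝ) :
    Complex.exp (Complex.I * ((latticePt (x + y) ⬝ᵥ ξ : ℝ) : ℂ)) =
      Complex.exp (Complex.I * ((latticePt x ⬝ᵥ ξ : ℝ) : ℂ)) *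
        Complex.exp (Complex.I * ((latticePt y ⬝ᵥ ξ : ℝ) : ℂ)) := by
  rw [latticePt_add, add_dotProduct, ← Complex.exp_add]
  push_cast
  ring_nf

/-- The change of variables `(x, y) ↦ (x - y, y)`. -/
def shearEquiv (G : Type*) [AddCommGroup G] : G × G ≃ G × G where
  toFun p := (p.1 - p.2, p.2)
  invFun p := (p.1 + p.2, p.2)
  left_inv p := by simp
  right_inv p := by simp

lemma summable_shear (hφ : Summable fun x => ‖φ x‖) (hψ : Summable fun x => ‖ψ x‖) :
    Summable fun p : (Fin d → ℤ) × (Fin d → ℤ) => ‖φ (p.1 - p.2) * ψ p.2‖ :=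
  (shearEquiv (Fin d → ℤ)).summable_iff.2 (Summable.mul_norm hφ hψ)

lemma summable_convolve (hφ : Summable fun x => ‖φ x‖) (hψ : Summable fun x => ‖ψ x‖) :
    Summable fun x => ‖convolve φ ψ x‖ := by
  have h := summable_shear hφ hψ
  refine Summable.of_nonneg_of_le (fun _ => norm_nonneg _) (fun x => ?_) h.prod
  exact norm_tsum_le_tsum_norm (h.prod_factor x)

lemma fourierT_convolve (hφ : Summable fun x => ‖φ x‖) (hψ : Summable fun x => ‖ψ x‖)
    (ξ : Fin d → ℝ) : fourierT (convolve φ ψ) ξ = fourierT φ ξ * fourierT ψ ξ := by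
  set e : (Fin d → ℤ) → ℂ := fun x => Complex.exp (Complex.I * ((latticePt x ⬝ᵥ ξ : ℝ) : ℂ))
  have hs : ∀ {f : (Fin d → ℤ) → ℂ}, (Summable fun x => ‖f x‖) → Summable fun x => ‖f x * e x‖ :=
    fun hf => by simpa only [e, norm_mul, norm_exp_I_mul, mul_one] using hf
  have h1 : Summable fun p : (Fin d → ℤ) × (Fin d → ℤ) =>
      (φ (p.1 - p.2) * e (p.1 - p.2)) * (ψ p.2 * e p.2) := (summable_shear (hs hφ) (hs hψ)).of_norm
  have h2 : ∀ x y : Fin d → ℤ, e x = e (x - y) * e y := fun x y => by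
    have := exp_add_dotProduct (x - y) y ξ
    rwa [sub_add_cancel] at this
  calc fourierT (convolve φ ψ) ξ
      = ∑' x, ∑' y, (φ (x - y) * e (x - y)) * (ψ y * e y) := by
        refine tsum_congr fun x => ?_
        rw [convolve, ← tsum_mul_right]
        refine tsum_congr fun y => ?_
        show φ (x - y) * ψ y * e x = _
        rw [h2 x y]; ring
    _ = ∑' p : (Fin d → ℤ) × (Fin d → ℤ), (φ (p.1 - p.2) * e (p.1 - p.2)) * (ψ p.2 * e p.2) :=
        h1.tsum_prod.symm
    _ = ∑' p : (Fin d → ℤ) × (Fin d → ℤ), (φ p.1 * e p.1) * (ψ p.2 * e p.2) :=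
        (shearEquiv (Fin d → ℤ)).tsum_eq
          (fun p : (Fin d → ℤ) × (Fin d → ℤ) => (φ p.1 * e p.1) * (ψ p.2 * e p.2))
    _ = _ := (tsum_mul_tsum_of_summable_norm (hs hφ) (hs hψ)).symm

lemma summable_convPow (hφ : Summable fun x => ‖φ x‖) {n : ℕ} (hn : 1 ≤ n) :
    Summable fun x => ‖convPow φ n x‖ := by
  induction n, hn using Nat.le_induction with
  | base => exact hφ
  | succ n hn ih =>
    obtain ⟨m, rfl⟩ := Nat.exists_eq_add_of_le' hn
    exact summable_convolve ih hφ

lemma fourierT_convPow (hφ : Summable fun x => ‖φ x‖) {n : ℕ} (hn : 1 ≤ n) (ξ : Fin d → ℝ) :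
    fourierT (convPow φ n) ξ = fourierT φ ξ ^ n := by
  induction n, hn using Nat.le_induction with
  | base => rw [pow_one]; rfl
  | succ n hn ih =>
    obtain ⟨m, rfl⟩ := Nat.exists_eq_add_of_le' hn
    rw [pow_succ, ← ih, ← fourierT_convolve (summable_convPow hφ hn) hφ]
    rfl

/-- A fundamental domain of `ℝ^d / 2πℤ^d`. -/
def cube (d : ℕ) (b : ℝ) : Set (Fin d → ℝ) := Set.univ.pi fun _ => Set.Ioc b (b + 2 * Real.pi)

lemma integral_exp_int (b : ℝ) (m : ℤ) :
    ∫ s in Set.Ioc b (b + 2 * Real.pi), Complex.exp (Complex.I * ((m * s : ℝ) : ℂ)) =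
      if m = 0 then ((2 * Real.pi : ℝ) : ℂ) else 0 := by
  rw [← intervalIntegral.integral_of_le (by linarith [Real.two_pi_pos])]
  split_ifs with h
  · simp [h]
  · have hc : Complex.I * m ≠ 0 := mul_ne_zero Complex.I_ne_zero (by exact_mod_cast h)
    have h1 : ∀ s : ℝ, Complex.I * ((m * s : ℝ) : ℂ) = Complex.I * m * s := fun s => by
      push_cast; ring
    simp only [h1]
    rw [integral_exp_mul_complex hc, div_eq_zero_iff]
    left
    have h2 : Complex.I * m * ((b + 2 * Real.pi : ℝ) : ℂ) =
        Complex.I * m * b + m * (2 * Real.pi * Complex.I) := by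
      push_cast; ring
    rw [h2, Complex.exp_add, Complex.exp_int_mul_two_pi_mul_I, mul_one, sub_self]

lemma integral_cube_exp (b : ℝ) (m : Fin d → ℤ) :
    ∫ ξ in cube d b, Complex.exp (Complex.I * ((latticePt m ⬝ᵥ ξ : ℝ) : ℂ)) =
      if m = 0 then (((2 * Real.pi) ^ d : ℝ) : ℂ) else 0 := by
  have h1 : ∀ ξ : Fin d → ℝ, Complex.exp (Complex.I * ((latticePt m ⬝ᵥ ξ : ℝ) : ℂ)) =
      ∏ j, Complex.exp (Complex.I * ((m j * ξ j : ℝ) : ℂ)) := fun ξ => by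
    rw [← Complex.exp_sum, ← Finset.mul_sum, dotProduct]
    push_cast
    rfl
  simp only [h1]
  rw [cube, volume_pi, Measure.restrict_pi_pi,
    integral_fintype_prod_eq_prod (f := fun j (s : ℝ) => Complex.exp (Complex.I * ((m j * s : ℝ) : ℂ)))]
  simp only [integral_exp_int]
  split_ifs with h
  · simp [h]
  · obtain ⟨j, hj⟩ := Function.ne_iff.1 h
    exact Finset.prod_eq_zero (Finset.mem_univ j) (if_neg hj)

lemma volume_cube_lt_top (b : ℝ) : volume (cube d b) < ⊤ := by
  rw [cube, volume_pi_pi]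
  exact ENNReal.prod_lt_top fun _ _ => by
    rw [Real.volume_Ioc]; exact ENNReal.ofReal_lt_top

/-- Fourier inversion on `ℤ^d`. -/
theorem fourier_inversion (hφ : Summable fun x => ‖φ x‖) (b : ℝ) (x : Fin d → ℤ) :
    φ x = (((2 * Real.pi) ^ d : ℝ) : ℂ)⁻¹ *
      ∫ ξ in cube d b, fourierT φ ξ * Complex.exp (-Complex.I * ((latticePt x ⬝ᵥ ξ : ℝ) : ℂ)) := by
  have hpi : (((2 * Real.pi) ^ d : ℝ) : ℂ) ≠ 0 := by
    exact_mod_cast (pow_pos Real.two_pi_pos d).ne'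
  have : IsFiniteMeasure (volume.restrict (cube d b)) := ⟨by
    rw [Measure.restrict_apply_univ]; exact volume_cube_lt_top b⟩
  have hcont : ∀ y : Fin d → ℤ, Continuous fun ξ : Fin d → ℝ =>
      φ y * Complex.exp (Complex.I * ((latticePt (y - x) ⬝ᵥ ξ : ℝ) : ℂ)) := fun y => by
    unfold dotProduct
    fun_prop
  have hnorm : ∀ (y : Fin d → ℤ) (ξ : Fin d → ℝ),
      ‖φ y * Complex.exp (Complex.I * ((latticePt (y - x) ⬝ᵥ ξ : ℝ) : ℂ))‖ = ‖φ y‖ := fun y ξ => by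
    rw [norm_mul, norm_exp_I_mul, mul_one]
  have h1 : ∀ ξ : Fin d → ℝ,
      fourierT φ ξ * Complex.exp (-Complex.I * ((latticePt x ⬝ᵥ ξ : ℝ) : ℂ)) =
        ∑' y, φ y * Complex.exp (Complex.I * ((latticePt (y - x) ⬝ᵥ ξ : ℝ) : ℂ)) := fun ξ => by
    rw [fourierT, ← tsum_mul_right]
    refine tsum_congr fun y => ?_
    have h2 := exp_add_dotProduct (y - x) x ξ
    rw [sub_add_cancel] at h2
    rw [h2, neg_mul, Complex.exp_neg]
    field_simp
  simp only [h1]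
  rw [← integral_tsum_of_summable_integral_norm]
  · simp only [integral_const_mul, integral_cube_exp, sub_eq_zero]
    rw [tsum_eq_single x fun y hy => by rw [if_neg hy, mul_zero], if_pos rfl]
    field_simp
  · exact fun y => Integrable.of_bound (hcont y).aestronglyMeasurable ‖φ y‖
      (Eventually.of_forall fun ξ => (hnorm y ξ).le)
  · simp only [hnorm, integral_const]
    exact hφ.const_smul _

end Inversion

/-! ### The local limit theorem at a single maximizer. -/

section Expansion

variable {d : ℕ} {φ : (Fin d → ℤ) → ℂ} {P : MvPolynomial (Fin d) ℂ}

lemma exp_neg_legendre_anti (hP : IsPosHom P) {t M M' : ℝ} (ht : 0 ≤ t) (hM : M' ≤ M)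
    (y : Fin d → ℝ) :
    Real.exp (-(t * M * legendre P y)) ≤ Real.exp (-(t * M' * legendre P y)) := by
  have h := hP.legendre_nonneg y
  refine Real.exp_le_exp.2 (neg_le_neg ?_)
  gcongr

/-- The Legendre transform is bounded for bounded y, so any exponentially small error fits into the
required form. -/
lemma IsPosHom.exists_exp_neg_le (hP : IsPosHom P) (L a : ℝ) {c : ℝ} (hc : 0 < c) :
    ∃ K > 0, ∃ M > 0, ∀ t : ℝ, 1 ≤ t → ∀ y : Fin d → ℝ, ‖y‖ ≤ L →
      Real.exp (-(c * t)) ≤ K * t ^ (-a) * Real.exp (-(t * M * legendre P y)) := by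
  obtain ⟨K, hK, h⟩ := exists_exp_neg_le_rpow a (half_pos hc)
  obtain ⟨S, hS, hle⟩ := hP.exists_legendre_le L
  refine ⟨K, hK, c / 2 / S, by positivity, fun t ht y hy => ?_⟩
  have ht0 : 0 < t := by linarith
  have h1 := h t ht
  rw [mul_div_cancel₀ c two_ne_zero] at h1
  have := Real.rpow_pos_of_pos ht0 (-a)
  refine h1.trans (mul_le_mul_of_nonneg_left (Real.exp_le_exp.2 (neg_le_neg ?_)) (by positivity))
  calc t * (c / 2 / S) * legendre P y ≤ t * (c / 2 / S) * S := by
        gcongr; exact hle y hy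
    _ = c / 2 * t := by field_simp

/-- The contribution to `(2π)^d φ^{(n)}(x)` of a neighbourhood of `ξ₀`, up to a phase. -/
noncomputable def localTerm (φ : (Fin d → ℤ) → ℂ) (ξ₀ : Fin d → ℝ) (δ : ℝ) (n : ℕ)
    (x : Fin d → ℤ) : ℂ :=
  ∫ ζ, scaledBump d δ ζ • (fourierT φ (ζ + ξ₀) ^ n *
    Complex.exp (-Complex.I * ((latticePt x ⬝ᵥ ζ : ℝ) : ℂ)))

lemma continuous_fourierT_pow_mul_exp (hφ : Summable fun x => ‖φ x‖) (ξ₀ : Fin d → ℝ) (n : ℕ)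
    (x : Fin d → ℤ) : Continuous fun ζ => fourierT φ (ζ + ξ₀) ^ n *
      Complex.exp (-Complex.I * ((latticePt x ⬝ᵥ ζ : ℝ) : ℂ)) := by
  have h1 : Continuous fun ζ => fourierT φ (ζ + ξ₀) :=
    (continuous_fourierT hφ).comp (continuous_id.add continuous_const)
  have h2 : Continuous fun ζ : Fin d → ℝ => latticePt x ⬝ᵥ ζ := by
    unfold dotProduct; fun_prop
  fun_prop

lemma integrable_scaledBump_smul {δ : ℝ} (hδ : 0 < δ) {f : (Fin d → ℝ) → ℂ} (hf : Continuous f) :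
    Integrable fun ζ => scaledBump d δ ζ • f ζ :=
  ((contDiff_scaledBump δ).continuous.smul hf).integrable_of_hasCompactSupport
    (hasCompactSupport_scaledBump hδ).smul_right

lemma localTerm_eq (hφ : Summable fun x => ‖φ x‖) {ξ₀ α : Fin d → ℝ} (h0 : fourierT φ ξ₀ ≠ 0)
    {W : (Fin d → ℂ) → ℂ} {r δ : ℝ}
    (hfac : ∀ ξ : Fin d → ℝ, ‖ξ‖ < r → fourierT φ (ξ + ξ₀) = fourierT φ ξ₀ *
        Complex.exp (Complex.I * ((α ⬝ᵥ ξ : ℝ) : ℂ) - evalR P ξ + W (toComplex ξ)))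
    (hδ : 0 < δ) (hδr : 2 * δ ≤ r) {n : ℕ} (hn : 1 ≤ n) (x : Fin d → ℤ) :
    localTerm φ ξ₀ δ n x = fourierT φ ξ₀ ^ n *
      ((∫ ζ, scaledBump d δ ζ • localFn P W n ((n : ℝ)⁻¹ • (latticePt x - (n : ℝ) • α)) (toComplex ζ)) +
        ∫ ζ, scaledBump d δ ζ • kernelFn P n (latticePt x - (n : ℝ) • α) (toComplex ζ)) := by
  have hn0 : (n : ℝ) ≠ 0 := by exact_mod_cast (by omega : n ≠ 0)
  have hF : fourierT φ ξ₀ ^ n ≠ 0 := pow_ne_zero n h0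
  have h1 := integrable_scaledBump_smul hδ (continuous_fourierT_pow_mul_exp hφ ξ₀ n x)
  have h2 := integrable_scaledBump_smul hδ (f := fun ζ =>
    kernelFn P n (latticePt x - (n : ℝ) • α) (toComplex ζ))
    ((differentiable_kernelFn n _).continuous.comp continuous_toComplex)
  have h3 : ∀ ζ, scaledBump d δ ζ • localFn P W n ((n : ℝ)⁻¹ • (latticePt x - (n : ℝ) • α))
      (toComplex ζ) = (fourierT φ ξ₀ ^ n)⁻¹ * (scaledBump d δ ζ • (fourierT φ (ζ + ξ₀) ^ n *
        Complex.exp (-Complex.I * ((latticePt x ⬝ᵥ ζ : ℝ) : ℂ)))) -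
        scaledBump d δ ζ • kernelFn P n (latticePt x - (n : ℝ) • α) (toComplex ζ) := fun ζ => by
    rcases lt_or_ge ‖ζ‖ (2 * δ) with h | h
    · have h4 : fourierT φ (ζ + ξ₀) ^ n * Complex.exp (-Complex.I * ((latticePt x ⬝ᵥ ζ : ℝ) : ℂ)) =
          fourierT φ ξ₀ ^ n * (kernelFn P n (latticePt x - (n : ℝ) • α) (toComplex ζ) *
            Complex.exp (((n : ℝ) : ℂ) * W (toComplex ζ))) := by
        rw [hfac ζ (h.trans_le hδr), mul_pow, ← Complex.exp_nat_mul, kernelFn, sum_mul_toComplex,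
          mul_assoc, ← Complex.exp_add, ← Complex.exp_add, evalR, sub_dotProduct, smul_dotProduct, smul_eq_mul]
        congr 2
        push_cast
        ring
      rw [h4, localFn, smul_inv_smul₀ hn0]
      simp only [Complex.real_smul]
      field_simp
    · rw [scaledBump_eq_zero hδ h]; simp
  simp only [h3]
  rw [integral_sub (h1.const_mul _) h2, integral_const_mul, sub_add_cancel, ← localTerm,
    mul_inv_cancel_left₀ hF]

/-- The local limit theorem at one maximizer of `|φ̂|`. -/
theorem IsHolo.exists_expansion (hd : 0 < d) (hφ : IsHolo φ) {ξ₀ α : Fin d → ℝ}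
    (h0 : ‖fourierT φ ξ₀‖ = 1) (hP : IsPosHomType φ ξ₀ α P) :
    ∃ lam : ℝ, 0 < lam ∧ (∀ E ∈ expSet P, IsLUB (orderSet P (remainder φ ξ₀ α P) E) lam) ∧
      ∀ E ∈ expSet P, ∀ᶠ δ in 𝓝[>] (0 : ℝ), ∀ L : ℝ, ∃ K > 0, ∃ M > 0,
        ∀ n : ℕ, 1 ≤ n → ∀ x : Fin d → ℤ, ‖latticePt x‖ ≤ n * L →
        ‖(((2 * Real.pi) ^ d : ℝ) : ℂ)⁻¹ * localTerm φ ξ₀ δ n x -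
            fourierT φ ξ₀ ^ n * heatKernel P n (latticePt x - (n : ℝ) • α)‖ ≤
          K * (n : ℝ) ^ (-(E.trace + lam)) *
            Real.exp (-(n * M * legendre P ((n : ℝ)⁻¹ • (latticePt x - (n : ℝ) • α)))) := by
  obtain ⟨lam, hlam, W, r, hr, C, hC, hW, hWre, hfac, hup, hlow⟩ := hφ.exists_localData hd h0 hP
  have hF0 : fourierT φ ξ₀ ≠ 0 := fun h => by simp [h] at h0
  refine ⟨lam, hlam, fun E hE => hP.1.isLUB_orderSet hE hlam hC hr (fun ξ hξ => ?_) hlow,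
    fun E hE => ?_⟩
  · have h1 := hup ξ 0 hξ (by simpa using hr)
    rwa [cpt_zero_right, hWre ξ hξ, hP.1.rePart_zero, add_zero] at h1
  obtain ⟨δ₀, hδ₀, hloc⟩ := hP.1.exists_local_le hE hlam hC hr hW hup
  -- Valid for all small δ, so that one cutoff scale can later serve every maximizer.
  filter_upwards [self_mem_nhdsWithin, nhdsWithin_le_nhds (gt_mem_nhds hδ₀),
    nhdsWithin_le_nhds (gt_mem_nhds (half_pos hr))] with δ hδ hδδ hδr L
  have hδ : 0 < δ := hδ
  have hδr : δ < r / 2 := hδr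
  obtain ⟨K₁, hK₁, M₁, hM₁, h1⟩ := hloc δ hδ (le_of_lt hδδ) (L + ‖α‖)
  obtain ⟨c, hc, D, hD, h2⟩ := hP.1.exists_tail_le hδ
  obtain ⟨K₂, hK₂, M₂, hM₂, h3⟩ := hP.1.exists_exp_neg_le (L + ‖α‖) (E.trace + lam) hc
  refine ⟨((2 * Real.pi) ^ d)⁻¹ * (K₁ + D * K₂), by positivity, min M₁ M₂, lt_min hM₁ hM₂,
    fun n hn x hx => ?_⟩
  have hn1 : (1 : ℝ) ≤ n := by exact_mod_cast hn
  have hn0 : (0 : ℝ) < n := by linarith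
  set y := (n : ℝ)⁻¹ • (latticePt x - (n : ℝ) • α)
  have hy : ‖y‖ ≤ L + ‖α‖ := by
    rw [norm_smul, norm_inv, Real.norm_of_nonneg hn0.le, inv_mul_le_iff₀ hn0]
    refine (norm_sub_le _ _).trans ?_
    rw [norm_smul, Real.norm_of_nonneg hn0.le]
    linarith
  rw [localTerm_eq hφ.1 hF0 hfac hδ (by linarith) hn, heatKernel_eq]
  have h4 := h1 n hn1 y hy
  have h5 := (h2 n hn1 (latticePt x - (n : ℝ) • α)).trans
    (mul_le_mul_of_nonneg_left (h3 n hn1 y hy) hD.le)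
  set I₁ := ∫ ζ, scaledBump d δ ζ • localFn P W n y (toComplex ζ)
  set I₂ := ∫ ζ, scaledBump d δ ζ • kernelFn P n (latticePt x - (n : ℝ) • α) (toComplex ζ)
  set I₃ := ∫ ζ, kernelFn P n (latticePt x - (n : ℝ) • α) (toComplex ζ)
  -- I₁ is the local error and I₃ - I₂ the part of the heat kernel integral removed by the cutoff.
  have h6 : (((2 * Real.pi) ^ d : ℝ) : ℂ)⁻¹ * (fourierT φ ξ₀ ^ n * (I₁ + I₂)) -
      fourierT φ ξ₀ ^ n * ((((2 * Real.pi) ^ d : ℝ) : ℂ)⁻¹ * I₃) =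
      (((2 * Real.pi) ^ d : ℝ) : ℂ)⁻¹ * (fourierT φ ξ₀ ^ n * (I₁ - (I₃ - I₂))) := by ring
  have hpi : (0 : ℝ) < (2 * Real.pi) ^ d := by positivity
  rw [h6, norm_mul, norm_mul, norm_pow, h0, one_pow, one_mul, norm_inv, Complex.norm_real,
    Real.norm_of_nonneg hpi.le]
  have hpow := Real.rpow_pos_of_pos hn0 (-(E.trace + lam))
  have e1 := mul_le_mul_of_nonneg_left (exp_neg_legendre_anti hP.1 hn0.le (min_le_left M₁ M₂) y)
    (mul_pos hK₁ hpow).le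
  have e2 := mul_le_mul_of_nonneg_left (exp_neg_legendre_anti hP.1 hn0.le (min_le_right M₁ M₂) y)
    (mul_pos (mul_pos hD hK₂) hpow).le
  rw [mul_assoc ((2 * Real.pi) ^ d)⁻¹, mul_assoc ((2 * Real.pi) ^ d)⁻¹]
  refine mul_le_mul_of_nonneg_left ((norm_sub_le _ _).trans ?_) (by positivity)
  linarith

end Expansion

/-! ### Finiteness of the set of maximizers and its position in a period cell. -/

section MaxSet

variable {d : ℕ} {φ : (Fin d → ℤ) → ℂ} {P : MvPolynomial (Fin d) ℂ}

/-- Near ξ₀ one has |φ̂| = exp(-R + Re Υ) with |Υ| ≤ R/2, so maximizers are isolated. -/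
lemma IsPosHomType.eventually_norm_lt_one (hφ : Summable fun x => ‖φ x‖) {ξ₀ α : Fin d → ℝ}
    (h0 : ‖fourierT φ ξ₀‖ = 1) (hP : IsPosHomType φ ξ₀ α P) :
    ∀ᶠ ζ in 𝓝 ξ₀, ζ ≠ ξ₀ → ‖fourierT φ ζ‖ < 1 := by
  have hF0 : fourierT φ ξ₀ ≠ 0 := fun h => by simp [h] at h0
  have h1 : ∀ᶠ ζ in 𝓝 ξ₀, fourierT φ ζ ≠ 0 :=
    (continuous_fourierT hφ).continuousAt.eventually_ne hF0
  have h2 : ∀ᶠ ξ in 𝓝 (0 : Fin d → ℝ), ‖remainder φ ξ₀ α P ξ‖ ≤ 1 / 2 * ‖rePart P ξ‖ :=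
    hP.2.bound (by norm_num)
  have h3 : Tendsto (fun ζ : Fin d → ℝ => ζ - ξ₀) (𝓝 ξ₀) (𝓝 0) :=
    (continuous_id.sub continuous_const).tendsto' _ _ (sub_self _)
  filter_upwards [h1, h3.eventually h2] with ζ hζ hr hne
  have h4 := hP.1.rePart_pos (sub_ne_zero.2 hne)
  rw [Real.norm_of_nonneg h4.le] at hr
  have h5 : fourierT φ ζ = fourierT φ ξ₀ * Complex.exp (Complex.I * ((α ⬝ᵥ (ζ - ξ₀) : ℝ) : ℂ) -
      evalR P (ζ - ξ₀) + remainder φ ξ₀ α P (ζ - ξ₀)) := by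
    have h6 : Complex.I * ((α ⬝ᵥ (ζ - ξ₀) : ℝ) : ℂ) - evalR P (ζ - ξ₀) +
        remainder φ ξ₀ α P (ζ - ξ₀) = Complex.log (fourierT φ ζ / fourierT φ ξ₀) := by
      rw [remainder, logRatio, sub_add_cancel]; ring
    rw [h6, Complex.exp_log (div_ne_zero hζ hF0), mul_div_cancel₀ _ hF0]
  rw [h5, norm_mul, h0, one_mul, Complex.norm_exp, Real.exp_lt_one_iff]
  have h7 := Complex.re_le_norm (remainder φ ξ₀ α P (ζ - ξ₀))
  have h8 : (Complex.I * ((α ⬝ᵥ (ζ - ξ₀) : ℝ) : ℂ)).re = 0 := by simp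
  rw [Complex.add_re, Complex.sub_re, h8]
  change 0 - rePart P (ζ - ξ₀) + _ < 0
  linarith

lemma torus_subset_Icc :
    torus d ⊆ Set.Icc (fun _ => -Real.pi) fun _ => Real.pi := fun _ hξ =>
  ⟨fun j => (hξ j).1.le, fun j => (hξ j).2⟩

theorem finite_maxSet (hφ : Summable fun x => ‖φ x‖) {α : (Fin d → ℝ) → Fin d → ℝ}
    {P : (Fin d → ℝ) → MvPolynomial (Fin d) ℂ}
    (hP : ∀ ξ ∈ maxSet φ, IsPosHomType φ ξ (α ξ) (P ξ)) : (maxSet φ).Finite := by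
  by_contra hinf
  obtain ⟨ζ, -, hζ⟩ := Set.Infinite.exists_accPt_of_subset_isCompact hinf
    (isCompact_Icc (a := fun _ : Fin d => -Real.pi) (b := fun _ => Real.pi))
    fun ξ hξ => torus_subset_Icc hξ.1
  have hcl : IsClosed {ξ | ‖fourierT φ ξ‖ = 1} :=
    isClosed_eq (continuous_fourierT hφ).norm continuous_const
  have h1 : ‖fourierT φ ζ‖ = 1 :=
    hcl.closure_subset_iff.2 (fun ξ hξ => hξ.2) (mem_closure_iff_clusterPt.2 hζ.clusterPt)
  -- The torus is half-open, so the accumulation point may lie on a missing face; a period moves it,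
  -- and its neighbours, to a point where the hypothesis applies.
  obtain ⟨m, hm⟩ := exists_add_period_mem_torus ζ
  set ζ' := ζ + (2 * Real.pi) • latticePt m
  have hζ' : ζ' ∈ maxSet φ := ⟨hm, by rw [fourierT_add_period, h1]⟩
  have h2 := (hP ζ' hζ').eventually_norm_lt_one hφ hζ'.2
  have h3 : Tendsto (fun ξ : Fin d → ℝ => ξ + (2 * Real.pi) • latticePt m) (𝓝 ζ) (𝓝 ζ') :=
    (continuous_id.add continuous_const).tendsto _
  obtain ⟨ξ, hξ, hξ'⟩ := ((accPt_iff_frequently.1 hζ).and_eventually (h3.eventually h2)).exists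
  have h4 := hξ' fun h => hξ.1 (add_right_cancel h)
  rw [fourierT_add_period, hξ.2.2] at h4
  exact lt_irrefl _ h4

theorem IsNormalizedHolo.maxSet_nonempty (hφ : IsNormalizedHolo φ) : (maxSet φ).Nonempty := by
  have hne : (Set.Icc (fun _ : Fin d => -Real.pi) fun _ => Real.pi).Nonempty :=
    Set.nonempty_Icc.2 fun _ => by linarith [Real.pi_pos]
  obtain ⟨ζ, -, hmax⟩ := isCompact_Icc.exists_isMaxOn hne
    (continuous_fourierT hφ.1.1).norm.continuousOn
  have h1 : (1 : ℝ) ≤ ‖fourierT φ ζ‖ := hφ.2.2 (by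
    rintro _ ⟨ξ, hξ, rfl⟩
    exact hmax (torus_subset_Icc hξ))
  obtain ⟨m, hm⟩ := exists_add_period_mem_torus ζ
  exact ⟨_, hm, by
    rw [fourierT_add_period]; exact le_antisymm (hφ.norm_fourierT_le ζ) h1⟩

lemma eq_of_abs_sub_lt {a b : Fin d → ℝ} {m : Fin d → ℤ}
    (h : a = b + (2 * Real.pi) • latticePt m) (hab : ∀ j, |a j - b j| < 2 * Real.pi) : a = b := by
  have hm : m = 0 := by
    ext j
    have h1 := hab j
    have h2 : a j - b j = 2 * Real.pi * m j := by
      rw [h]; simp [latticePt]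
    rw [h2, abs_mul, abs_of_pos Real.two_pi_pos] at h1
    have h3 : |(m j : ℝ)| < 1 := by
      by_contra! h4
      have := mul_le_mul_of_nonneg_left h4 Real.two_pi_pos.le
      linarith
    have h4 : |m j| < 1 := by exact_mod_cast h3
    simpa using Int.abs_lt_one_iff.1 h4
  have h0 : latticePt (0 : Fin d → ℤ) = 0 := by ext j; simp [latticePt]
  rw [h, hm, h0, smul_zero, add_zero]

/-- The translation taking a point of the torus to the cube with corner `(b, …, b)`. -/
noncomputable def cubeShift (b : ℝ) (ξ : Fin d → ℝ) : Fin d → ℤ := fun j => if b < ξ j then 0 else 1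

/-- The representative in the cube with corner `(b, …, b)` of a point of the torus. -/
noncomputable def cubeRep (b : ℝ) (ξ : Fin d → ℝ) : Fin d → ℝ :=
  ξ + (2 * Real.pi) • latticePt (cubeShift b ξ)

lemma cubeRep_mem {b : ℝ} (hb : b ∈ Set.Ioo (-Real.pi) Real.pi) {ξ : Fin d → ℝ} (hξ : ξ ∈ torus d)
    (hne : ∀ j, ξ j ≠ b) (j : Fin d) : cubeRep b ξ j ∈ Set.Ioo b (b + 2 * Real.pi) := by
  have h1 := hξ j
  have h2 := hb.1
  have h3 := hb.2
  have h4 := h1.1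
  have h5 := h1.2
  by_cases h : b < ξ j
  · have : cubeRep b ξ j = ξ j := by simp [cubeRep, cubeShift, latticePt, h]
    rw [this]
    exact ⟨h, by linarith⟩
  · have : cubeRep b ξ j = ξ j + 2 * Real.pi := by simp [cubeRep, cubeShift, latticePt, h]
    have h6 : ξ j < b := lt_of_le_of_ne (not_lt.1 h) (hne j)
    rw [this]
    exact ⟨by linarith, by linarith⟩

lemma cubeRep_injOn (b : ℝ) : Set.InjOn (cubeRep (d := d) b) (torus d) := by
  intro ξ hξ ξ' hξ' h
  refine eq_of_abs_sub_lt (m := cubeShift b ξ' - cubeShift b ξ) ?_ fun j => ?_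
  · have h1 : latticePt (cubeShift b ξ' - cubeShift b ξ) =
        latticePt (cubeShift b ξ') - latticePt (cubeShift b ξ) := by
      ext j; simp [latticePt]
    rw [h1, smul_sub, ← add_sub_assoc, ← cubeRep, ← h, cubeRep, add_sub_cancel_right]
  · have h1 := hξ j
    have h2 := hξ' j
    rw [abs_lt]
    exact ⟨by linarith [h1.1, h2.2], by linarith [h1.2, h2.1]⟩

lemma exists_eq_cubeRep {b : ℝ} (hb : b ∈ Set.Ioo (-Real.pi) Real.pi)
    (hne : ∀ ξ ∈ maxSet φ, ∀ j, ξ j ≠ b) {ζ : Fin d → ℝ}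
    (hζ : ζ ∈ Set.Icc (fun _ => b) fun _ => b + 2 * Real.pi) (h1 : ‖fourierT φ ζ‖ = 1) :
    ∃ ξ ∈ maxSet φ, ζ = cubeRep b ξ := by
  obtain ⟨m, hm⟩ := exists_add_period_mem_torus ζ
  set ξ := ζ + (2 * Real.pi) • latticePt m
  have hξ : ξ ∈ maxSet φ := ⟨hm, by rw [fourierT_add_period, h1]⟩
  refine ⟨ξ, hξ, (eq_of_abs_sub_lt (m := m + cubeShift b ξ) ?_ fun j => ?_).symm⟩
  · rw [cubeRep, latticePt_add, smul_add, add_assoc]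
  · have h2 := cubeRep_mem hb hm (hne ξ hξ) j
    have h3 := hζ.1 j
    have h4 := hζ.2 j
    simp only at h3 h4
    rw [abs_lt]
    exact ⟨by linarith [h2.1], by linarith [h2.2]⟩

/-- The bumps equal 1 within δ of their centre and vanish beyond 2δ. Separation 3δ ensures that
within δ of one centre all other bumps vanish. -/
lemma eventually_cube_separated {s : Finset (Fin d → ℝ)} {p : (Fin d → ℝ) → Fin d → ℝ} {b : ℝ}
    (hp : ∀ ξ ∈ s, ∀ j, p ξ j ∈ Set.Ioo b (b + 2 * Real.pi)) (hinj : Set.InjOn p s) :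
    ∀ᶠ δ in 𝓝[>] (0 : ℝ), (∀ ξ ∈ s, ∀ ζ, ‖ζ - p ξ‖ < 2 * δ → ζ ∈ cube d b) ∧
      ∀ ξ ∈ s, ∀ ξ' ∈ s, ξ ≠ ξ' → 3 * δ < ‖p ξ - p ξ'‖ := by
  have hlt : ∀ a : ℝ, 0 < a → ∀ᶠ δ in 𝓝[>] (0 : ℝ), 3 * δ < a := fun a ha => by
    filter_upwards [nhdsWithin_le_nhds (gt_mem_nhds (show 0 < a / 3 by positivity))] with δ hδ
    have hδ : δ < a / 3 := hδ
    linarith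
  refine Eventually.and ((Filter.eventually_all_finset s).2 fun ξ hξ => ?_)
    ((Filter.eventually_all_finset s).2 fun ξ hξ => (Filter.eventually_all_finset s).2 fun ξ' hξ' => ?_)
  · have hopen : IsOpen (Set.univ.pi fun _ : Fin d => Set.Ioo b (b + 2 * Real.pi)) :=
      isOpen_set_pi Set.finite_univ fun _ _ => isOpen_Ioo
    obtain ⟨ε, hε, hball⟩ := Metric.isOpen_iff.1 hopen (p ξ) fun j _ => hp ξ hξ j
    filter_upwards [hlt ε hε, self_mem_nhdsWithin] with δ hδ hδ0 ζ hζ j hj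
    have hδ0 : 0 < δ := hδ0
    have h1 := hball (mem_ball_iff_norm.2 (by linarith : ‖ζ - p ξ‖ < ε)) j hj
    exact ⟨h1.1, h1.2.le⟩
  · by_cases h : ξ = ξ'
    · exact Eventually.of_forall fun _ hne => absurd h hne
    · filter_upwards [hlt ‖p ξ - p ξ'‖ (norm_pos_iff.2 (sub_ne_zero.2 fun he => h (hinj hξ hξ' he)))]
        with δ hδ _ using hδ

end MaxSet

/-! ### Localization of the inversion integral at the maximizers. -/

section Decomposition

variable {d : ℕ} {φ : (Fin d → ℤ) → ℂ}

lemma exp_neg_dotProduct_add_period (x : Fin d → ℤ) (ξ : Fin d → ℝ) (m : Fin d → ℤ) :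
    Complex.exp (-Complex.I * ((latticePt x ⬝ᵥ (ξ + (2 * Real.pi) • latticePt m) : ℝ) : ℂ)) =
      Complex.exp (-Complex.I * ((latticePt x ⬝ᵥ ξ : ℝ) : ℂ)) := by
  rw [neg_mul, neg_mul, Complex.exp_neg, Complex.exp_neg, exp_dotProduct_add_period]

lemma exp_mul_localTerm (ξ : Fin d → ℝ) (m : Fin d → ℤ) (δ : ℝ) (n : ℕ) (x : Fin d → ℤ) :
    Complex.exp (-Complex.I * ((latticePt x ⬝ᵥ ξ : ℝ) : ℂ)) * localTerm φ ξ δ n x =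
      ∫ ζ, scaledBump d δ (ζ - (ξ + (2 * Real.pi) • latticePt m)) • (fourierT φ ζ ^ n *
        Complex.exp (-Complex.I * ((latticePt x ⬝ᵥ ζ : ℝ) : ℂ))) := by
  set p := ξ + (2 * Real.pi) • latticePt m
  have h1 := integral_sub_right_eq_self (μ := volume) (fun u => scaledBump d δ u •
    (fourierT φ (u + p) ^ n * Complex.exp (-Complex.I * ((latticePt x ⬝ᵥ (u + p) : ℝ) : ℂ)))) p
  simp only [sub_add_cancel] at h1
  rw [h1, localTerm, ← integral_const_mul]
  refine integral_congr_ae (Eventually.of_forall fun u => ?_)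
  simp only [p, ← add_assoc, fourierT_add_period, exp_neg_dotProduct_add_period]
  rw [dotProduct_add, mul_smul_comm]
  push_cast
  rw [mul_add, Complex.exp_add]
  ring_nf

lemma exists_norm_fourierT_le_exp (hφ : IsNormalizedHolo φ) {K : Set (Fin d → ℝ)} (hK : IsCompact K)
    (h : ∀ ζ ∈ K, ‖fourierT φ ζ‖ ≠ 1) : ∃ c > 0, ∀ ζ ∈ K, ‖fourierT φ ζ‖ ≤ Real.exp (-c) := by
  rcases K.eq_empty_or_nonempty with rfl | hne
  · exact ⟨1, one_pos, fun ζ hζ => absurd hζ (Set.notMem_empty ζ)⟩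
  · obtain ⟨ζ₀, hζ₀, hmax⟩ := hK.exists_isMaxOn hne (continuous_fourierT hφ.1.1).norm.continuousOn
    have h1 : ‖fourierT φ ζ₀‖ < 1 := lt_of_le_of_ne (hφ.norm_fourierT_le ζ₀) (h ζ₀ hζ₀)
    refine ⟨1 - ‖fourierT φ ζ₀‖, by linarith, fun ζ hζ => (hmax hζ).trans ?_⟩
    have := Real.add_one_le_exp (-(1 - ‖fourierT φ ζ₀‖))
    linarith

/-- Up to an exponentially small error, `φ^{(n)}` is the sum of the contributions of the
maximizers of `|φ̂|`. -/
theorem IsNormalizedHolo.eventually_decomposition (hφ : IsNormalizedHolo φ)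
    (hΩ : (maxSet φ).Finite) :
    ∀ᶠ δ in 𝓝[>] (0 : ℝ), ∃ c > 0, ∃ D > 0, ∀ n : ℕ, 1 ≤ n → ∀ x : Fin d → ℤ,
      ‖convPow φ n x - ∑ ξ ∈ hΩ.toFinset, Complex.exp (-Complex.I * ((latticePt x ⬝ᵥ ξ : ℝ) : ℂ)) *
        ((((2 * Real.pi) ^ d : ℝ) : ℂ)⁻¹ * localTerm φ ξ δ n x)‖ ≤ D * Real.exp (-(c * n)) := by
  -- Only finitely many coordinates occur, so the period cell can be moved until no maximizer lies
  -- on its boundary and no bump is cut off.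
  obtain ⟨b, hb, hbne⟩ : ∃ b ∈ Set.Ioo (-Real.pi) Real.pi, ∀ ξ ∈ maxSet φ, ∀ j, ξ j ≠ b := by
    have hfin : (⋃ ξ ∈ maxSet φ, Set.range ξ).Finite := hΩ.biUnion fun ξ _ => Set.finite_range ξ
    obtain ⟨b, hb, hb'⟩ := ((Set.Ioo_infinite (show -Real.pi < Real.pi by
      linarith [Real.pi_pos])).sdiff hfin).nonempty
    exact ⟨b, hb, fun ξ hξ j h => hb' (Set.mem_biUnion hξ ⟨j, h⟩)⟩
  set s := hΩ.toFinset
  have hs : ∀ ξ, ξ ∈ s ↔ ξ ∈ maxSet φ := fun ξ => hΩ.mem_toFinset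
  filter_upwards [eventually_cube_separated (s := s) (p := cubeRep b)
    (fun ξ hξ => cubeRep_mem hb ((hs ξ).1 hξ).1 (hbne ξ ((hs ξ).1 hξ)))
    ((cubeRep_injOn b).mono fun ξ hξ => ((hs ξ).1 hξ).1), self_mem_nhdsWithin] with δ ⟨hin, hsep⟩ hδ
  have hδ : 0 < δ := hδ
  set K : Set (Fin d → ℝ) := Set.Icc (fun _ => b) (fun _ => b + 2 * Real.pi) ∩
    ⋂ ξ ∈ s, {ζ | δ ≤ ‖ζ - cubeRep b ξ‖}
  have hK : IsCompact K := isCompact_Icc.inter_right (isClosed_biInter fun ξ _ =>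
    isClosed_le continuous_const (continuous_id.sub continuous_const).norm)
  obtain ⟨c, hc, hcK⟩ := exists_norm_fourierT_le_exp hφ hK fun ζ hζ h => by
    obtain ⟨ξ, hξ, rfl⟩ := exists_eq_cubeRep hb hbne hζ.1 h
    have h1 := Set.mem_iInter₂.1 hζ.2 ξ ((hs ξ).2 hξ)
    have h2 : δ ≤ ‖cubeRep b ξ - cubeRep b ξ‖ := h1
    rw [sub_self, norm_zero] at h2
    linarith
  have hpi : (0 : ℝ) < (2 * Real.pi) ^ d := by positivity
  set V := (volume (cube d b)).toReal
  have hV : 0 ≤ V := ENNReal.toReal_nonneg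
  refine ⟨c, hc, ((2 * Real.pi) ^ d)⁻¹ * (1 + s.card) * V + 1, by positivity, fun n hn x => ?_⟩
  set f : (Fin d → ℝ) → ℂ := fun ζ => fourierT φ ζ ^ n *
    Complex.exp (-Complex.I * ((latticePt x ⬝ᵥ ζ : ℝ) : ℂ))
  have hf : Continuous f := by
    have := continuous_fourierT_pow_mul_exp hφ.1.1 0 n x
    simpa only [add_zero] using this
  have hfn : ∀ ζ, ‖f ζ‖ = ‖fourierT φ ζ‖ ^ n := fun ζ => by
    have h1 : -Complex.I * ((latticePt x ⬝ᵥ ζ : ℝ) : ℂ) =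
        Complex.I * ((-(latticePt x ⬝ᵥ ζ) : ℝ) : ℂ) := by push_cast; ring
    simp only [f]
    rw [norm_mul, h1, norm_exp_I_mul, mul_one, norm_pow]
  have hcube : cube d b ⊆ Set.Icc (fun _ => b) (fun _ => b + 2 * Real.pi) := fun ζ hζ =>
    ⟨fun j => (hζ j trivial).1.le, fun j => (hζ j trivial).2⟩
  have hint : ∀ {g : (Fin d → ℝ) → ℂ}, Continuous g → IntegrableOn g (cube d b) := fun hg =>
    (hg.continuousOn.integrableOn_compact isCompact_Icc).mono_set hcube
  have hbump : ∀ ξ, Continuous fun ζ => scaledBump d δ (ζ - cubeRep b ξ) := fun ξ =>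
    (contDiff_scaledBump δ).continuous.comp (continuous_id.sub continuous_const)
  have hbf : ∀ ξ, IntegrableOn (fun ζ => scaledBump d δ (ζ - cubeRep b ξ) • f ζ) (cube d b) :=
    fun ξ => hint ((hbump ξ).smul hf)
  have h1 : convPow φ n x = (((2 * Real.pi) ^ d : ℝ) : ℂ)⁻¹ * ∫ ζ in cube d b, f ζ := by
    rw [fourier_inversion (summable_convPow hφ.1.1 hn) b x]
    simp only [fourierT_convPow hφ.1.1 hn, f]
  have h2 : ∀ ξ ∈ s, Complex.exp (-Complex.I * ((latticePt x ⬝ᵥ ξ : ℝ) : ℂ)) *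
      ((((2 * Real.pi) ^ d : ℝ) : ℂ)⁻¹ * localTerm φ ξ δ n x) = (((2 * Real.pi) ^ d : ℝ) : ℂ)⁻¹ *
        ∫ ζ in cube d b, scaledBump d δ (ζ - cubeRep b ξ) • f ζ := fun ξ hξ => by
    rw [mul_left_comm, exp_mul_localTerm ξ (cubeShift b ξ)]
    congr 1
    refine (setIntegral_eq_integral_of_forall_compl_eq_zero fun ζ hζ => ?_).symm
    have h3 : 2 * δ ≤ ‖ζ - cubeRep b ξ‖ := by
      by_contra! h
      exact hζ (hin ξ hξ ζ h)
    change scaledBump d δ (ζ - cubeRep b ξ) • f ζ = 0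
    rw [scaledBump_eq_zero hδ h3, zero_smul]
  rw [h1, Finset.sum_congr rfl h2, ← Finset.mul_sum, ← mul_sub,
    ← integral_finsetSum _ fun ξ _ => hbf ξ,
    ← integral_sub (hint hf) (integrable_finsetSum _ fun ξ _ => hbf ξ)]
  have h3 : ∀ ζ ∈ cube d b, ‖f ζ - ∑ ξ ∈ s, scaledBump d δ (ζ - cubeRep b ξ) • f ζ‖ ≤
      (1 + s.card) * Real.exp (-(c * n)) := fun ζ hζ => by
    by_cases hnear : ∃ ξ ∈ s, ‖ζ - cubeRep b ξ‖ < δ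
    · obtain ⟨ξ, hξ, h⟩ := hnear
      rw [Finset.sum_eq_single_of_mem ξ hξ fun ξ' hξ' hne => ?_, scaledBump_eq_one hδ h.le, one_smul,
        sub_self, norm_zero]
      · positivity
      · have h4 := hsep ξ hξ ξ' hξ' hne.symm
        have h5 := norm_sub_le_norm_sub_add_norm_sub (cubeRep b ξ) ζ (cubeRep b ξ')
        rw [norm_sub_rev (cubeRep b ξ) ζ] at h5
        rw [scaledBump_eq_zero hδ (by linarith), zero_smul]
    · push Not at hnear
      have h4 : ‖f ζ‖ ≤ Real.exp (-(c * n)) := by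
        have h5 := hcK ζ ⟨hcube hζ, Set.mem_iInter₂.2 hnear⟩
        rw [hfn]
        refine (pow_le_pow_left₀ (norm_nonneg _) h5 n).trans (le_of_eq ?_)
        rw [← Real.exp_nat_mul]; ring_nf
      have h6 : ‖∑ ξ ∈ s, scaledBump d δ (ζ - cubeRep b ξ) • f ζ‖ ≤ s.card * ‖f ζ‖ := by
        rw [← nsmul_eq_mul]
        refine (norm_sum_le _ _).trans (Finset.sum_le_card_nsmul _ _ _ fun ξ _ => ?_)
        rw [norm_smul, Real.norm_of_nonneg (scaledBump_nonneg _ _)]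
        exact mul_le_of_le_one_left (norm_nonneg _) (scaledBump_le_one _ _)
      calc _ ≤ ‖f ζ‖ + s.card * ‖f ζ‖ := (norm_sub_le _ _).trans (by linarith)
        _ = (1 + s.card) * ‖f ζ‖ := by ring
        _ ≤ _ := by gcongr
  have h4 := norm_setIntegral_le_of_norm_le_const (volume_cube_lt_top b) h3
  rw [norm_mul, norm_inv, Complex.norm_real, Real.norm_of_nonneg hpi.le]
  calc _ ≤ ((2 * Real.pi) ^ d)⁻¹ * ((1 + s.card) * Real.exp (-(c * n)) * V) := by gcongr; exact h4
    _ = ((2 * Real.pi) ^ d)⁻¹ * (1 + s.card) * V * Real.exp (-(c * n)) := by ring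
    _ ≤ _ := by
      have := Real.exp_pos (-(c * n))
      linarith

end Decomposition

/-! ### Summation over the maximizers and the region far from the origin. -/

section Global

variable {d : ℕ} {φ : (Fin d → ℤ) → ℂ}

lemma norm_le_euclNorm (x : Fin d → ℝ) : ‖x‖ ≤ euclNorm x := by
  refine (pi_norm_le_iff_of_nonneg (Real.sqrt_nonneg _)).2 fun j => ?_
  rw [Real.norm_eq_abs, ← Real.sqrt_sq_eq_abs]
  exact Real.sqrt_le_sqrt (Finset.single_le_sum (f := fun j => x j ^ 2)
    (fun i _ => sq_nonneg (x i)) (Finset.mem_univ j))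

lemma euclNorm_le (x : Fin d → ℝ) : euclNorm x ≤ d * ‖x‖ := by
  rcases Nat.eq_zero_or_pos d with rfl | hd
  · simp [euclNorm]
  have hd1 : (1 : ℝ) ≤ d := by exact_mod_cast hd
  refine Real.sqrt_le_iff.2 ⟨by positivity, ?_⟩
  calc ∑ j, x j ^ 2 ≤ ∑ _j : Fin d, ‖x‖ ^ 2 := Finset.sum_le_sum fun j _ => by
        have := norm_le_pi_norm x j
        rw [← sq_abs, ← Real.norm_eq_abs]
        gcongr
    _ = d * ‖x‖ ^ 2 := by simp
    _ ≤ (d * ‖x‖) ^ 2 := by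
        rw [mul_pow]
        gcongr
        nlinarith

lemma gaussBound_mono {s : Finset (Fin d → ℝ)} {α : (Fin d → ℝ) → Fin d → ℝ}
    {P : (Fin d → ℝ) → MvPolynomial (Fin d) ℂ} (hP : ∀ ξ ∈ s, IsPosHom (P ξ))
    {a C C' M M' : (Fin d → ℝ) → ℝ} (hC0 : ∀ ξ ∈ s, 0 ≤ C ξ) (hC : ∀ ξ ∈ s, C ξ ≤ C' ξ)
    (hM : ∀ ξ ∈ s, M' ξ ≤ M ξ) (n : ℕ) (x : Fin d → ℤ) :
    gaussBound s α P a C M n x ≤ gaussBound s α P a C' M' n x := by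
  refine Finset.sum_le_sum fun ξ hξ => ?_
  have h1 := exp_neg_legendre_anti (hP ξ hξ) (Nat.cast_nonneg n) (hM ξ hξ)
    ((n : ℝ)⁻¹ • (latticePt x - (n : ℝ) • α ξ))
  have h2 : (0 : ℝ) ≤ (n : ℝ) ^ a ξ := Real.rpow_nonneg (Nat.cast_nonneg n) _
  exact mul_le_mul (div_le_div_of_nonneg_right (hC ξ hξ) h2) h1 (Real.exp_pos _).le
    (div_nonneg ((hC0 ξ hξ).trans (hC ξ hξ)) h2)

lemma norm_exp_neg_I_mul (a : ℝ) : ‖Complex.exp (-Complex.I * (a : ℂ))‖ = 1 := by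
  have h : -Complex.I * (a : ℂ) = Complex.I * ((-a : ℝ) : ℂ) := by push_cast; ring
  rw [h, norm_exp_I_mul]

/-- The local limit theorem in the region `|x| ≤ n L`. -/
theorem IsNormalizedHolo.exists_gaussBound (hφ : IsNormalizedHolo φ) (hΩ : (maxSet φ).Finite)
    {α : (Fin d → ℝ) → Fin d → ℝ} {P : (Fin d → ℝ) → MvPolynomial (Fin d) ℂ}
    (hP : ∀ ξ ∈ maxSet φ, IsPosHom (P ξ)) {a : (Fin d → ℝ) → ℝ}
    (hloc : ∀ ξ ∈ maxSet φ, ∀ᶠ δ in 𝓝[>] (0 : ℝ), ∀ L : ℝ, ∃ K > 0, ∃ M > 0,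
        ∀ n : ℕ, 1 ≤ n → ∀ x : Fin d → ℤ, ‖latticePt x‖ ≤ n * L →
        ‖(((2 * Real.pi) ^ d : ℝ) : ℂ)⁻¹ * localTerm φ ξ δ n x -
            fourierT φ ξ ^ n * heatKernel (P ξ) n (latticePt x - (n : ℝ) • α ξ)‖ ≤
          K * (n : ℝ) ^ (-a ξ) *
            Real.exp (-(n * M * legendre (P ξ) ((n : ℝ)⁻¹ • (latticePt x - (n : ℝ) • α ξ)))))
    (L : ℝ) :
    ∃ C M : (Fin d → ℝ) → ℝ, (∀ ξ ∈ maxSet φ, 0 < C ξ ∧ 0 < M ξ) ∧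
      ∀ n : ℕ, 1 ≤ n → ∀ x : Fin d → ℤ, euclNorm (latticePt x) ≤ n * L →
        ‖convPow φ n x - localLimit φ hΩ.toFinset α P n x‖ ≤
          gaussBound hΩ.toFinset α P a C M n x := by
  have hs : ∀ ξ, ξ ∈ hΩ.toFinset ↔ ξ ∈ maxSet φ := fun ξ => hΩ.mem_toFinset
  obtain ⟨δ, ⟨c, hc, D, hD, hdec⟩, hloc⟩ := ((hφ.eventually_decomposition hΩ).and
    ((Filter.eventually_all_finset hΩ.toFinset).2 fun ξ hξ => hloc ξ ((hs ξ).1 hξ))).exists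
  have hloc' := fun ξ hξ => hloc ξ ((hs ξ).2 hξ) L
  choose! K hK M₁ hM₁ h1 using hloc'
  have hexp := fun ξ (hξ : ξ ∈ maxSet φ) => (hP ξ hξ).exists_exp_neg_le (L + ‖α ξ‖) (a ξ) hc
  choose! K₂ hK₂ M₂ hM₂ h2 using hexp
  refine ⟨fun ξ => K ξ + D * K₂ ξ, fun ξ => min (M₁ ξ) (M₂ ξ), fun ξ hξ =>
    ⟨add_pos (hK ξ hξ) (mul_pos hD (hK₂ ξ hξ)), lt_min (hM₁ ξ hξ) (hM₂ ξ hξ)⟩, fun n hn x hx => ?_⟩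
  have hn1 : (1 : ℝ) ≤ n := by exact_mod_cast hn
  have hn0 : (0 : ℝ) < n := by linarith
  have hx' : ‖latticePt x‖ ≤ n * L := (norm_le_euclNorm _).trans hx
  set y : (Fin d → ℝ) → Fin d → ℝ := fun ξ => (n : ℝ)⁻¹ • (latticePt x - (n : ℝ) • α ξ)
  have hy : ∀ ξ, ‖y ξ‖ ≤ L + ‖α ξ‖ := fun ξ => by
    rw [norm_smul, norm_inv, Real.norm_of_nonneg hn0.le, inv_mul_le_iff₀ hn0]
    refine (norm_sub_le _ _).trans ?_
    rw [norm_smul, Real.norm_of_nonneg hn0.le]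
    linarith
  have h3 := hdec n hn x
  set T : (Fin d → ℝ) → ℂ := fun ξ => (((2 * Real.pi) ^ d : ℝ) : ℂ)⁻¹ * localTerm φ ξ δ n x
  have h4 : ‖∑ ξ ∈ hΩ.toFinset, Complex.exp (-Complex.I * ((latticePt x ⬝ᵥ ξ : ℝ) : ℂ)) * T ξ -
      localLimit φ hΩ.toFinset α P n x‖ ≤ ∑ ξ ∈ hΩ.toFinset,
        K ξ * (n : ℝ) ^ (-a ξ) * Real.exp (-(n * M₁ ξ * legendre (P ξ) (y ξ))) := by
    rw [localLimit, ← Finset.sum_sub_distrib]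
    refine norm_sum_le_of_le _ fun ξ hξ => ?_
    rw [mul_assoc, ← mul_sub, norm_mul, norm_exp_neg_I_mul, one_mul]
    exact h1 ξ ((hs ξ).1 hξ) n hn x hx'
  have h5 : D * Real.exp (-(c * n)) ≤ ∑ ξ ∈ hΩ.toFinset,
      D * (K₂ ξ * (n : ℝ) ^ (-a ξ) * Real.exp (-(n * M₂ ξ * legendre (P ξ) (y ξ)))) := by
    -- The exponentially small error has to be charged to some maximizer, so existence of one
    -- matters.
    obtain ⟨ξ₁, hξ₁⟩ := hφ.maxSet_nonempty
    calc D * Real.exp (-(c * n)) ≤ ∑ ξ ∈ hΩ.toFinset, D * Real.exp (-(c * n)) :=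
          Finset.single_le_sum (f := fun _ => D * Real.exp (-(c * n))) (fun _ _ => by positivity)
            ((hs ξ₁).2 hξ₁)
      _ ≤ _ := Finset.sum_le_sum fun ξ hξ =>
          mul_le_mul_of_nonneg_left (h2 ξ ((hs ξ).1 hξ) n hn1 (y ξ) (hy ξ)) hD.le
  calc ‖convPow φ n x - localLimit φ hΩ.toFinset α P n x‖ ≤ _ + _ :=
        norm_sub_le_norm_sub_add_norm_sub _ _ _
    _ ≤ _ := add_le_add (h3.trans h5) h4
    _ ≤ _ := by
        rw [← Finset.sum_add_distrib]
        refine Finset.sum_le_sum fun ξ hξ => ?_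
        have hξ := (hs ξ).1 hξ
        have hpow := Real.rpow_pos_of_pos hn0 (-a ξ)
        have e1 := mul_le_mul_of_nonneg_left (exp_neg_legendre_anti (hP ξ hξ) hn0.le
          (min_le_left (M₁ ξ) (M₂ ξ)) (y ξ)) (mul_pos (hK ξ hξ) hpow).le
        have e2 := mul_le_mul_of_nonneg_left (exp_neg_legendre_anti (hP ξ hξ) hn0.le
          (min_le_right (M₁ ξ) (M₂ ξ)) (y ξ)) (mul_pos (mul_pos hD (hK₂ ξ hξ)) hpow).le
        rw [div_eq_mul_inv, ← Real.rpow_neg hn0.le]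
        linarith

lemma exists_norm_le_of_convPow_ne_zero (hφ : φ.support.Finite) :
    ∃ L > 0, ∀ n : ℕ, 1 ≤ n → ∀ x : Fin d → ℤ, convPow φ n x ≠ 0 → ‖latticePt x‖ ≤ n * L := by
  obtain ⟨L, hL⟩ : ∃ L : ℝ, ∀ x ∈ φ.support, ‖latticePt x‖ ≤ L := by
    obtain ⟨L, hL⟩ := (hφ.image fun x => ‖latticePt x‖).bddAbove
    exact ⟨L, fun x hx => hL ⟨x, hx, rfl⟩⟩
  have hL' : ∀ x, φ x ≠ 0 → ‖latticePt x‖ ≤ max L 1 := fun x hx => (hL x hx).trans (le_max_left _ _)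
  refine ⟨max L 1, by positivity, fun n hn => ?_⟩
  induction n, hn using Nat.le_induction with
  | base => intro x hx; simpa using hL' x hx
  | succ n hn ih =>
    intro x hx
    obtain ⟨m, rfl⟩ := Nat.exists_eq_add_of_le' hn
    have hx : convolve (convPow φ (m + 1)) φ x ≠ 0 := hx
    obtain ⟨y, hy⟩ : ∃ y, convPow φ (m + 1) (x - y) * φ y ≠ 0 := by
      by_contra! h
      exact hx (by simp [convolve, h])
    have h1 := ih (x - y) (left_ne_zero_of_mul hy)
    have h2 := hL' y (right_ne_zero_of_mul hy)
    have h3 : latticePt x = latticePt (x - y) + latticePt y := by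
      rw [← latticePt_add, sub_add_cancel]
    rw [h3, Nat.cast_succ, add_mul, one_mul]
    exact (norm_add_le _ _).trans (add_le_add h1 h2)

/-- Far from the origin the heat kernel is smaller than the error term. -/
lemma IsPosHom.exists_heatKernel_far_le {P : MvPolynomial (Fin d) ℂ} (hd : 0 < d) (hP : IsPosHom P)
    {E : Matrix (Fin d) (Fin d) ℝ} (hE : E ∈ expSet P) {lam : ℝ} (hlam : 0 < lam) :
    ∃ L > 0, ∃ C > 0, ∃ M > 0, ∀ t : ℝ, 0 < t → ∀ y : Fin d → ℝ, L ≤ ‖y‖ →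
      ‖heatKernel P t (t • y)‖ ≤
        C * t ^ (-(E.trace + lam)) * Real.exp (-(t * M * legendre P y)) := by
  obtain ⟨L, hL, hleg⟩ := hP.exists_one_le_legendre hd
  obtain ⟨C, hC, M, hM, h⟩ := hP.exists_heatKernel_le hE
  obtain ⟨K, hK, hKe⟩ := exists_rpow_le_exp hlam.le (half_pos hM)
  -- As the Legendre transform is at least 1, half of the exponent is at most -tM/2, which pays for
  -- the extra factor t^{-λ}.
  refine ⟨L, hL, C * K, by positivity, M / 2, by positivity, fun t ht y hy => (h t ht y).trans ?_⟩
  have h1 : 1 ≤ K * t ^ (-lam) * Real.exp (M / 2 * t) := by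
    have h2 := hKe t ht.le
    have h3 := Real.rpow_pos_of_pos ht lam
    rw [Real.rpow_neg ht.le, mul_assoc, mul_left_comm, ← div_eq_inv_mul, le_div_iff₀ h3, one_mul]
    exact h2
  have h2 : t ^ (-(E.trace + lam)) = t ^ (-E.trace) * t ^ (-lam) := by
    rw [← Real.rpow_add ht]; ring_nf
  have h3 := Real.rpow_pos_of_pos ht (-E.trace)
  have h4 := Real.rpow_pos_of_pos ht (-lam)
  have h5 := hleg y hy
  calc C * t ^ (-E.trace) * Real.exp (-(t * M * legendre P y))
      ≤ C * t ^ (-E.trace) * Real.exp (-(t * M * legendre P y)) *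
          (K * t ^ (-lam) * Real.exp (M / 2 * t)) := le_mul_of_one_le_right (by positivity) h1
    _ = C * t ^ (-E.trace) * (K * t ^ (-lam)) *
          Real.exp (-(t * M * legendre P y) + M / 2 * t) := by rw [Real.exp_add]; ring
    _ ≤ C * t ^ (-E.trace) * (K * t ^ (-lam)) * Real.exp (-(t * (M / 2) * legendre P y)) := by
        refine mul_le_mul_of_nonneg_left (Real.exp_le_exp.2 ?_) (by positivity)
        have := mul_le_mul_of_nonneg_left h5 (show 0 ≤ t * (M / 2) by positivity)
        linarith
    _ = _ := by rw [h2]; ring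

/-- The local limit far from the origin is smaller than the error term. -/
lemma exists_localLimit_far_le (hd : 0 < d) (hΩ : (maxSet φ).Finite)
    {α : (Fin d → ℝ) → Fin d → ℝ} {P : (Fin d → ℝ) → MvPolynomial (Fin d) ℂ}
    (hP : ∀ ξ ∈ maxSet φ, IsPosHom (P ξ)) {E : (Fin d → ℝ) → Matrix (Fin d) (Fin d) ℝ}
    (hE : ∀ ξ ∈ maxSet φ, E ξ ∈ expSet (P ξ)) {lam : (Fin d → ℝ) → ℝ}
    (hlam : ∀ ξ ∈ maxSet φ, 0 < lam ξ) :
    ∃ L > 0, ∃ C M : (Fin d → ℝ) → ℝ, (∀ ξ ∈ maxSet φ, 0 < C ξ ∧ 0 < M ξ) ∧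
      ∀ n : ℕ, 1 ≤ n → ∀ x : Fin d → ℤ, n * L ≤ ‖latticePt x‖ →
        ‖localLimit φ hΩ.toFinset α P n x‖ ≤
          gaussBound hΩ.toFinset α P (fun ξ => (E ξ).trace + lam ξ) C M n x := by
  have hs : ∀ ξ, ξ ∈ hΩ.toFinset ↔ ξ ∈ maxSet φ := fun ξ => hΩ.mem_toFinset
  have hfar := fun ξ hξ => (hP ξ hξ).exists_heatKernel_far_le hd (hE ξ hξ) (hlam ξ hξ)
  choose! L hL C hC M hM h using hfar
  have hnn : ∀ ξ ∈ hΩ.toFinset, 0 ≤ L ξ + ‖α ξ‖ := fun ξ hξ =>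
    add_nonneg (hL ξ ((hs ξ).1 hξ)).le (norm_nonneg _)
  -- The sum exceeds each L ξ + ‖α ξ‖, so (x - nα)/n is far enough out for every maximizer at once.
  refine ⟨1 + ∑ ξ ∈ hΩ.toFinset, (L ξ + ‖α ξ‖),
    add_pos_of_pos_of_nonneg one_pos (Finset.sum_nonneg hnn), C, M,
    fun ξ hξ => ⟨hC ξ hξ, hM ξ hξ⟩, fun n hn x hx => norm_sum_le_of_le _ fun ξ hξ => ?_⟩
  have hn0 : (0 : ℝ) < n := by exact_mod_cast hn
  have hξ' := (hs ξ).1 hξ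
  rw [norm_mul, norm_mul, norm_exp_neg_I_mul, norm_pow, hξ'.2, one_pow, one_mul, one_mul,
    div_eq_mul_inv, ← Real.rpow_neg hn0.le]
  have h1 := h ξ hξ' n hn0 ((n : ℝ)⁻¹ • (latticePt x - (n : ℝ) • α ξ)) (by
    rw [norm_smul, norm_inv, Real.norm_of_nonneg hn0.le, le_inv_mul_iff₀ hn0]
    have h2 := norm_sub_norm_le (latticePt x) ((n : ℝ) • α ξ)
    rw [norm_smul, Real.norm_of_nonneg hn0.le] at h2
    have h3 := mul_le_mul_of_nonneg_left (Finset.single_le_sum hnn hξ) hn0.le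
    linarith)
  rwa [smul_inv_smul₀ hn0.ne'] at h1

end Global

end ConvPow

open ConvPow
theorem theorem1p8 {d : ℕ} (hd : 0 < d) (φ : (Fin d → ℤ) → ℂ) (hφ : IsNormalizedHolo φ)
    (α : (Fin d → ℝ) → Fin d → ℝ) (P : (Fin d → ℝ) → MvPolynomial (Fin d) ℂ)
    (hP : ∀ ξ ∈ maxSet φ, IsPosHomType φ ξ (α ξ) (P ξ)) :
    ∃ (hΩ : (maxSet φ).Finite) (μ lam : (Fin d → ℝ) → ℝ),
      (∀ ξ ∈ maxSet φ, 0 < μ ξ ∧ 0 < lam ξ ∧ ∀ E ∈ expSet (P ξ),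
        E.trace = μ ξ ∧ IsLUB (orderSet (P ξ) (remainder φ ξ (α ξ) (P ξ)) E) (lam ξ)) ∧
      (∀ L : ℝ, 0 < L → ∃ C M : (Fin d → ℝ) → ℝ, (∀ ξ ∈ maxSet φ, 0 < C ξ ∧ 0 < M ξ) ∧
        ∀ n : ℕ, 1 ≤ n → ∀ x : Fin d → ℤ, euclNorm (latticePt x) ≤ n * L →
          ‖convPow φ n x - localLimit φ hΩ.toFinset α P n x‖ ≤
            gaussBound hΩ.toFinset α P (fun ξ => μ ξ + lam ξ) C M n x) ∧
      (φ.support.Finite → ∃ C M : (Fin d → ℝ) → ℝ, (∀ ξ ∈ maxSet φ, 0 < C ξ ∧ 0 < M ξ) ∧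
        ∀ n : ℕ, 1 ≤ n → ∀ x : Fin d → ℤ,
          ‖convPow φ n x - localLimit φ hΩ.toFinset α P n x‖ ≤
            gaussBound hΩ.toFinset α P (fun ξ => μ ξ + lam ξ) C M n x) := by
  have hΩ := finite_maxSet hφ.1.1 hP
  have hpos : ∀ ξ ∈ maxSet φ, IsPosHom (P ξ) := fun ξ hξ => (hP ξ hξ).1
  have hexp := fun ξ (hξ : ξ ∈ maxSet φ) => hφ.1.exists_expansion hd hξ.2 (hP ξ hξ)
  choose! lam hlam hLUB hloc using hexp
  have hne := fun ξ (hξ : ξ ∈ maxSet φ) => (hpos ξ hξ).1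
  choose! E hE using hne
  have hmain := hφ.exists_gaussBound (a := fun ξ => (E ξ).trace + lam ξ) hΩ hpos
    fun ξ hξ => hloc ξ hξ (E ξ) (hE ξ hξ)
  refine ⟨hΩ, fun ξ => (E ξ).trace, lam, fun ξ hξ => ⟨(hpos ξ hξ).trace_pos hd (hE ξ hξ), hlam ξ hξ,
    fun E' hE' => ⟨(hpos ξ hξ).trace_eq hE' (hE ξ hξ), hLUB ξ hξ E' hE'⟩⟩, fun L _ => hmain L,
    fun hsupp => ?_⟩
  obtain ⟨L₀, hL₀, hzero⟩ := exists_norm_le_of_convPow_ne_zero hsupp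
  obtain ⟨L₁, hL₁, C₁, M₁, h₁, hfar⟩ := exists_localLimit_far_le (α := α) hd hΩ hpos hE hlam
  -- Beyond n(L₀ + L₁) in sup norm the convolution power vanishes and the local limit is small by
  -- itself. The factor d passes from the sup norm to the Euclidean one.
  obtain ⟨C₂, M₂, h₂, hnear⟩ := hmain (d * (L₀ + L₁))
  have hmem : ∀ ξ ∈ hΩ.toFinset, ξ ∈ maxSet φ := fun ξ hξ => hΩ.mem_toFinset.1 hξ
  refine ⟨fun ξ => C₁ ξ + C₂ ξ, fun ξ => min (M₁ ξ) (M₂ ξ), fun ξ hξ =>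
    ⟨add_pos (h₁ ξ hξ).1 (h₂ ξ hξ).1, lt_min (h₁ ξ hξ).2 (h₂ ξ hξ).2⟩, fun n hn x => ?_⟩
  have hn0 : (0 : ℝ) < n := by exact_mod_cast hn
  rcases le_or_gt ‖latticePt x‖ (n * (L₀ + L₁)) with hx | hx
  · refine (hnear n hn x ((euclNorm_le _).trans ?_)).trans (gaussBound_mono
      (fun ξ hξ => hpos ξ (hmem ξ hξ)) (fun ξ hξ => (h₂ ξ (hmem ξ hξ)).1.le)
      (fun ξ hξ => by linarith [(h₁ ξ (hmem ξ hξ)).1]) (fun ξ _ => min_le_right _ _) n x)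
    calc (d : ℝ) * ‖latticePt x‖ ≤ d * (n * (L₀ + L₁)) := by gcongr
      _ = n * (d * (L₀ + L₁)) := by ring
  · have h0 : convPow φ n x = 0 := by
      by_contra h
      have := hzero n hn x h
      nlinarith
    rw [h0, zero_sub, norm_neg]
    refine (hfar n hn x ?_).trans (gaussBound_mono
      (fun ξ hξ => hpos ξ (hmem ξ hξ)) (fun ξ hξ => (h₁ ξ (hmem ξ hξ)).1.le)
      (fun ξ hξ => by linarith [(h₂ ξ (hmem ξ hξ)).1]) (fun ξ _ => min_le_left _ _) n x)
    nlinarith
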